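/- Let $\pi$ be a finitely generated group (for instance the fundamental group of a closed oriented surface of genus $g\ge 2$) with generators $\gamma_1,\dots,\gamma_k$. Let $\omega$ be the standard symplectic form on $\mathbb{R}^4$, and for a subspace $V\subseteq\mathbb{R}^4$ let $V^{\perp}=\{v\in\mathbb{R}^4 : \omega(v,w)=0 \text{ for all } w\in V\}$; $V$ is called coisotropic if $V^\perp\subseteq V$. Let $\rho:\pi\to \mathrm{Sp}(4,\mathbb{R})$ be a homomorphism. Then the following are equivalent: (i) $\rho$ is reductive, i.e. the real Zariski closure of $\rho(\pi)$ in $\mathrm{Sp}(4,\mathbb{R})$ is a reductive (not necessarily connected) algebraic group, that is, it has no nontrivial Zariski closed, Zariski connected, unipotent normal subgroup; (ii) the orbit $\{(g\rho(\gamma_1)g^{-1},\dots,g\rho(\gamma_k)g^{-1}) : g\in \mathrm{Sp}(4,\mathbb{R})\}$ is closed in $\mathrm{End}(\mathbb{R}^4)^k$ in the usual topology; (iii) for every coisotropic subspace $V\subseteq\mathbb{R}^4$ preserved by $\rho$ there is a $\rho$-invariant symplectic splitting $$\mathbb{R}^4 = V/V^\perp\oplus(\mathbb{R}^4/V\oplus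 V^\perp),$$ that is, there are subspaces $W,L\subseteq\mathbb{R}^4$ such that $V=W\oplus V^\perp$ (so $W\cong V/V^\perp$), $\mathbb{R}^4=V\oplus L$ (so $L\cong\mathbb{R}^4/V$), $\mathbb{R}^4=W\oplus(L\oplus V^\perp)$ with $W$ and $L\oplus V^\perp$ being $\omega$-orthogonal (so both are symplectic subspaces), $L$ is isotropic (so $\omega$ restricted to $L\oplus V^\perp$ is the natural form given by the duality between $\mathbb{R}^4/V$ and $V^\perp$), and $W$, $L$ and $V^\perp$ are all preserved by $\rho$. In particular $\rho(\pi)\subseteq \mathrm{Sp}(W)\times\mathrm{Sp}(L\oplus V^\perp)$. -/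

import Mathlib

namespace SpFour

/-- The index set of the coordinates of `ℝ⁴ = ℝ² ⊕ ℝ²`. -/
abbrev Idx : Type := Fin 2 ⊕ Fin 2

/-- The real symplectic group `Sp(4, ℝ)`, as a group of real `4 × 4` matrices. -/
abbrev Sp4 : Type := Matrix.symplecticGroup (Fin 2) ℝ

/-- The standard symplectic form `ω(v, w) = vᵀ J w` on `ℝ⁴`. -/
noncomputable def omega : LinearMap.BilinForm ℝ (Idx → ℝ) :=
  Matrix.toBilin' (Matrix.J (Fin 2) ℝ)

/-! ### The real Zariski topology and reductive subgroups of `Sp(4, ℝ)` -/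

/-- The sixteen matrix entries of an element of `Sp(4, ℝ)`. -/
def coords (g : Sp4) : Idx × Idx → ℝ := fun ij => (g : Matrix Idx Idx ℝ) ij.1 ij.2

/-- A subset of `Sp(4, ℝ)` is Zariski closed if it is the set of common zeros in `Sp(4, ℝ)` of a
family (equivalently, an ideal) of real polynomials in the matrix entries. -/
def IsZariskiClosed (S : Set Sp4) : Prop :=
  ∃ I : Ideal (MvPolynomial (Idx × Idx) ℝ), S = coords ⁻¹' MvPolynomial.zeroLocus ℝ I

/-- The real Zariski closure of a subset of `Sp(4, ℝ)`: the common zeros of all real polynomials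
in the matrix entries that vanish on it. -/
def zariskiClosure (S : Set Sp4) : Set Sp4 :=
  coords ⁻¹' MvPolynomial.zeroLocus ℝ (MvPolynomial.vanishingIdeal ℝ (coords '' S))

theorem mem_zariskiClosure {S : Set Sp4} {g : Sp4} :
    g ∈ zariskiClosure S ↔ ∀ p : MvPolynomial (Idx × Idx) ℝ,
      (∀ s ∈ S, MvPolynomial.aeval (coords s) p = 0) →
        MvPolynomial.aeval (coords g) p = 0 := by
  simp only [zariskiClosure, Set.mem_preimage, MvPolynomial.mem_zeroLocus_iff,
    MvPolynomial.mem_vanishingIdeal_iff, Set.forall_mem_image]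

theorem subset_zariskiClosure (S : Set Sp4) : S ⊆ zariskiClosure S :=
  fun s hs => mem_zariskiClosure.2 fun _ hp => hp s hs

/-- A self-map of `Sp(4, ℝ)` given by polynomials in the matrix entries that maps `S` into the
Zariski closure of `T` maps the Zariski closure of `S` into that of `T`. -/
theorem map_mem_zariskiClosure {S T : Set Sp4} (φ : Sp4 → Sp4)
    (q : Idx × Idx → MvPolynomial (Idx × Idx) ℝ)
    (hq : ∀ g, coords (φ g) = fun ij => MvPolynomial.aeval (coords g) (q ij))
    (h : ∀ s ∈ S, φ s ∈ zariskiClosure T) {g : Sp4} (hg : g ∈ zariskiClosure S) :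
    φ g ∈ zariskiClosure T := by
  rw [mem_zariskiClosure] at hg ⊢
  intro p hp
  have key : ∀ x : Sp4, MvPolynomial.aeval (coords (φ x)) p =
      MvPolynomial.aeval (coords x) (MvPolynomial.bind₁ q p) := by
    intro x
    rw [hq x, MvPolynomial.aeval_bind₁]
  rw [key]
  refine hg _ fun s hs => ?_
  rw [← key]
  exact mem_zariskiClosure.1 (h s hs) p hp

theorem mul_mem_zariskiClosure (H : Subgroup Sp4) {a b : Sp4}
    (ha : a ∈ zariskiClosure (H : Set Sp4)) (hb : b ∈ zariskiClosure (H : Set Sp4)) :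
    a * b ∈ zariskiClosure (H : Set Sp4) := by
  have hleft : ∀ s ∈ (H : Set Sp4), s * b ∈ zariskiClosure (H : Set Sp4) := by
    intro s hs
    refine map_mem_zariskiClosure (S := (H : Set Sp4)) (fun g => s * g)
      (fun ij => ∑ k, MvPolynomial.C ((s : Matrix Idx Idx ℝ) ij.1 k) *
        MvPolynomial.X (k, ij.2)) ?_ ?_ hb
    · intro g
      funext ij
      simp only [coords, map_sum, map_mul, MvPolynomial.aeval_X, MvPolynomial.aeval_C]
      simp [Matrix.mul_apply]
    · intro t ht
      exact subset_zariskiClosure _ (H.mul_mem hs ht)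
  refine map_mem_zariskiClosure (S := (H : Set Sp4)) (fun g => g * b)
    (fun ij => ∑ k, MvPolynomial.X (ij.1, k) *
      MvPolynomial.C ((b : Matrix Idx Idx ℝ) k ij.2)) ?_ hleft ha
  intro g
  funext ij
  simp only [coords, map_sum, map_mul, MvPolynomial.aeval_X, MvPolynomial.aeval_C]
  simp [Matrix.mul_apply]

theorem inv_mem_zariskiClosure (H : Subgroup Sp4) {a : Sp4}
    (ha : a ∈ zariskiClosure (H : Set Sp4)) : a⁻¹ ∈ zariskiClosure (H : Set Sp4) := by
  refine map_mem_zariskiClosure (S := (H : Set Sp4)) (fun g => g⁻¹)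
    (fun ij => ∑ k, (∑ l, MvPolynomial.C ((-Matrix.J (Fin 2) ℝ) ij.1 l) *
      MvPolynomial.X (k, l)) * MvPolynomial.C (Matrix.J (Fin 2) ℝ k ij.2)) ?_ ?_ ha
  · intro g
    funext ij
    simp only [coords, SymplecticGroup.coe_inv, Matrix.mul_apply, Matrix.transpose_apply, map_sum,
      map_mul, MvPolynomial.aeval_X, MvPolynomial.aeval_C, Algebra.algebraMap_self, RingHom.id_apply]
  · intro s hs
    exact subset_zariskiClosure _ (H.inv_mem hs)

/-- The real Zariski closure of a subgroup of `Sp(4, ℝ)`, which is again a subgroup. -/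
def zariskiClosureSubgroup (H : Subgroup Sp4) : Subgroup Sp4 where
  carrier := zariskiClosure (H : Set Sp4)
  mul_mem' := mul_mem_zariskiClosure H
  one_mem' := subset_zariskiClosure _ H.one_mem
  inv_mem' := inv_mem_zariskiClosure H

/-- Connectedness in the Zariski topology: nonempty, and not the union of two disjoint nonempty
relatively closed pieces. -/
def IsZariskiConnected (S : Set Sp4) : Prop :=
  S.Nonempty ∧ ∀ A B : Set Sp4, IsZariskiClosed A → IsZariskiClosed B →
    S ⊆ A ∪ B → S ∩ (A ∩ B) = ∅ → S ⊆ A ∨ S ⊆ B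

/-- A subgroup all of whose elements are unipotent matrices. -/
def IsUnipotent (N : Subgroup Sp4) : Prop :=
  ∀ n ∈ N, IsNilpotent ((n : Matrix Idx Idx ℝ) - 1)

/-- A (Zariski closed) subgroup `H` of `Sp(4, ℝ)` is reductive if its unipotent radical is
trivial: the only Zariski closed, Zariski connected, unipotent normal subgroup of `H` is the
trivial one. No connectedness of `H` is required. -/
def IsReductive (H : Subgroup Sp4) : Prop :=
  ∀ N : Subgroup Sp4, N ≤ H → (N.subgroupOf H).Normal → IsZariskiClosed (N : Set Sp4) →
    IsZariskiConnected (N : Set Sp4) → IsUnipotent N → N = ⊥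

/-! ### Representations into `Sp(4, ℝ)` -/

section Representations

variable {π : Type*} [Group π]

/-- A representation `ρ : π → Sp(4, ℝ)` is reductive if the real Zariski closure of `ρ(π)` is a
reductive group. -/
def IsReductiveRep (ρ : π →* Sp4) : Prop :=
  IsReductive (zariskiClosureSubgroup ρ.range)

/-- The map `j : Hom(π, Sp(4, ℝ)) → End(ℝ⁴)ᵏ`, `j(ρ) = (ρ(γ₁), …, ρ(γₖ))`. -/
def evalGenerators {k : ℕ} (γ : Fin k → π) (ρ : π →* Sp4) : Fin k → Matrix Idx Idx ℝ :=
  fun i => (ρ (γ i) : Matrix Idx Idx ℝ)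

/-- The orbit `Sp(4, ℝ) · x` of a tuple of matrices under simultaneous conjugation. -/
def conjOrbit {k : ℕ} (x : Fin k → Matrix Idx Idx ℝ) : Set (Fin k → Matrix Idx Idx ℝ) :=
  Set.range fun g : Sp4 => fun i =>
    (g : Matrix Idx Idx ℝ) * x i * ((g⁻¹ : Sp4) : Matrix Idx Idx ℝ)

/-- The subspace `V` of `ℝ⁴` is preserved by `ρ`. -/
def IsInvariant (ρ : π →* Sp4) (V : Submodule ℝ (Idx → ℝ)) : Prop :=
  ∀ x : π, ∀ v ∈ V, (ρ x : Matrix Idx Idx ℝ).mulVec v ∈ V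

/-- A subspace `V` of `ℝ⁴` is coisotropic if `V^⊥ ⊆ V`, where `V^⊥` is the `ω`-orthogonal. -/
def IsCoisotropic (V : Submodule ℝ (Idx → ℝ)) : Prop :=
  omega.orthogonal V ≤ V

/-- For a coisotropic subspace `V` preserved by `ρ`, the existence of a `ρ`-invariant symplectic
splitting `ℝ⁴ = V/V^⊥ ⊕ (ℝ⁴/V ⊕ V^⊥)`.
`W` is the copy of `V/V^⊥`: the projection `V → V/V^⊥` restricts to an isomorphism on `W`.
`L` is the copy of `ℝ⁴/V`: the projection `ℝ⁴ → ℝ⁴/V` restricts to an isomorphism on `L`.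
The splitting is symplectic for the natural structures: `W` carries the form that `V/V^⊥` inherits
from `ω`; the summands `W` and `L ⊕ V^⊥` are complementary and `ω`-orthogonal (hence both are
symplectic subspaces); and `L`, like `V^⊥`, is isotropic, so that `ω` on `L ⊕ V^⊥` is the form
given by the duality `ℝ⁴/V × V^⊥ → ℝ`. All the summands are preserved by `ρ`. -/
def HasInvariantSplitting (ρ : π →* Sp4) (V : Submodule ℝ (Idx → ℝ)) : Prop :=
  ∃ W L : Submodule ℝ (Idx → ℝ),
    W ⊓ omega.orthogonal V = ⊥ ∧ W ⊔ omega.orthogonal V = V ∧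
    IsCompl V L ∧
    IsCompl W (L ⊔ omega.orthogonal V) ∧
    (∀ w ∈ W, ∀ u ∈ L ⊔ omega.orthogonal V, omega w u = 0) ∧
    (∀ l ∈ L, ∀ l' ∈ L, omega l l' = 0) ∧
    IsInvariant ρ W ∧ IsInvariant ρ L ∧ IsInvariant ρ (omega.orthogonal V)

end Representations

end SpFour

/-! ### Traces, nilpotency, Engel's theorem, and conjugate replicas. -/

namespace SpFour

/-! The cycle is (i) ⇒ complete reducibility of `ℝ⁴` ⇒ (ii) ⇒ (iii) ⇒ (i).

Reductive implies completely reducible. Let `H` be the Zariski closure of the image. The `g ∈ H`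
with `g - 1` orthogonal to `H` under `tr(ab)` form a closed, normal, unipotent, hence connected
subgroup, which reductivity kills (`traceKernel_eq_bot`). Exponentiating, no nonzero element of the
complexified Lie algebra is trace-orthogonal to `H`. If `A` is tangent to `H`, so is its replica
`A'`, which acts on generalized eigenspaces by conjugate eigenvalues (`replica_mem_lieAlg`), and
`tr(AA')` is the sum of the `|μ|²`. This yields a Cartan criterion (`eq_bot_of_trace_replica`),
hence nondegenerate invariant forms and a Casimir operator of nonzero trace. Induction on dimension
then makes every cocycle `g q g⁻¹ - q` a coboundary (`exists_fixed_of_isReductive`); where the Lie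
algebra acts trivially, orbits are finite and averaging suffices. Applied to a projection onto an
invariant subspace, this gives an invariant complement.

Completely reducible implies closed orbit (`isClosed_conjOrbit`). The trace form on the algebra
generated by the image is nondegenerate. If conjugates by `gₙ` converge, the limit is an algebra
homomorphism `Φ`. Averaging with the Casimir element produces an intertwiner between the `n`-th
conjugate and `Φ` that tends to `1`, and a symplectic polar decomposition replaces it by a
symplectic one.

Closed orbit implies splittings. A closed orbit has a point of minimal Frobenius norm. There,
conjugation by the symplectic dilation attached to `V^⊥` would shrink the off-diagonal blocks, so
these vanish and the orthogonal projection onto `V^⊥` commutes with the representation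
(`exists_commuting_projection_of_minimal`).

Splittings imply reductive. For a unipotent normal `N` with fixed space `F`, a splitting for `(F ∩
F^⊥)^⊥` forces `F ∩ F^⊥ = 0`. A nonzero `F^⊥` would contain a nonzero vector fixed by `N`, so `F` is
everything. -/

open Polynomial in
/-- In characteristic zero, an endomorphism all of whose positive powers have trace zero is
nilpotent. -/
theorem isNilpotent_of_trace_pow_eq_zero {K V : Type*} [Field K] [CharZero K] [AddCommGroup V]
    [Module K V] [FiniteDimensional K V] (f : Module.End K V)
    (h : ∀ k : ℕ, LinearMap.trace K V (f ^ (k + 1)) = 0) : IsNilpotent f := by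
  have htr : ∀ q : K[X], LinearMap.trace K V (aeval f (X * q)) = 0 := by
    intro q
    induction q using Polynomial.induction_on' with
    | add p q hp hq => rw [mul_add, map_add, map_add, hp, hq, add_zero]
    | monomial n a =>
      rw [X_mul_monomial, aeval_monomial, ← Algebra.smul_def, map_smul, h, smul_zero]
  have hne : minpoly K f ≠ 0 := minpoly.ne_zero (Algebra.IsIntegral.isIntegral f)
  obtain ⟨r, hr, hrd⟩ := exists_eq_pow_rootMultiplicity_mul_and_not_dvd (minpoly K f) hne 0
  rw [C_0, sub_zero] at hr hrd
  set k := rootMultiplicity 0 (minpoly K f)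
  -- `a * X ^ (k + 1)` evaluates at `f` to the projector onto the part where `f` is invertible. The
  -- exponent `k + 1` keeps it divisible by `X` even when `k = 0`, so its trace vanishes; in
  -- characteristic zero a projector of trace zero is zero.
  have hcop : IsCoprime (X ^ (k + 1)) r :=
    IsCoprime.pow_left ((irreducible_X.coprime_iff_not_dvd).2 hrd)
  obtain ⟨a, b, hab⟩ := hcop
  have h0 : aeval f (X ^ k * r) = 0 := by rw [← hr, minpoly.aeval]
  have hsum : aeval f (a * X ^ (k + 1)) + aeval f (b * r) = 1 := by
    rw [← map_add, hab, map_one]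
  have hprod : aeval f (a * X ^ (k + 1)) * aeval f (b * r) = 0 := by
    rw [← map_mul, show a * X ^ (k + 1) * (b * r) = a * b * X * (X ^ k * r) by ring, map_mul, h0,
      mul_zero]
  have hidem : IsIdempotentElem (aeval f (a * X ^ (k + 1))) := by
    have := congrArg (aeval f (a * X ^ (k + 1)) * ·) hsum
    rw [IsIdempotentElem]
    simpa only [mul_add, hprod, add_zero, mul_one] using this
  have he : aeval f (a * X ^ (k + 1)) = 0 := by
    refine LinearMap.IsIdempotentElem.eq_zero_of_trace_eq_zero hidem ?_
    rw [show a * X ^ (k + 1) = X * (a * X ^ k) by ring]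
    exact htr _
  rw [he, zero_add] at hsum
  refine ⟨k, ?_⟩
  calc f ^ k = aeval f (X ^ k : K[X]) * aeval f (b * r) := by rw [hsum, mul_one, map_pow, aeval_X]
    _ = aeval f (b * (X ^ k * r)) := by
      rw [← map_mul, show (X : K[X]) ^ k * (b * r) = b * (X ^ k * r) by ring]
    _ = 0 := by rw [map_mul, h0, mul_zero]

theorem isNilpotent_matrix_of_trace_pow_eq_zero {K n : Type*} [Field K] [CharZero K] [Fintype n]
    [DecidableEq n] (A : Matrix n n K) (h : ∀ k : ℕ, (A ^ (k + 1)).trace = 0) :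
    IsNilpotent A := by
  have : IsNilpotent (Matrix.toLinAlgEquiv' A) := by
    refine isNilpotent_of_trace_pow_eq_zero _ fun k => ?_
    rw [← map_pow]
    exact (Matrix.trace_toLin'_eq _).trans (h k)
  exact (IsNilpotent.map_iff (Matrix.toLinAlgEquiv' (R := K) (n := n)).injective).1 this

theorem trace_eq_zero_of_isNilpotent {K n : Type*} [Field K] [Fintype n]
    [DecidableEq n] {A : Matrix n n K} (h : IsNilpotent A) : A.trace = 0 :=
  (Matrix.isNilpotent_trace_of_isNilpotent h).eq_zero

attribute [local instance] LieRing.ofAssociativeRing in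
/-- Engel's theorem for a space of nilpotent endomorphisms that is closed under commutators. -/
theorem exists_list_prod_eq_zero {K V : Type*} [Field K] [AddCommGroup V]
    [Module K V] [FiniteDimensional K V] (S : Submodule K (Module.End K V))
    (hlie : ∀ x ∈ S, ∀ y ∈ S, x * y - y * x ∈ S) (hnil : ∀ x ∈ S, IsNilpotent x) :
    ∃ m : ℕ, ∀ l : List (Module.End K V), l.length = m → (∀ x ∈ l, x ∈ S) → l.prod = 0 := by
  let L : LieSubalgebra K (Module.End K V) :=
    { S with lie_mem' := fun {x y} hx hy => hlie x hx y hy }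
  have hn : LieModule.IsNilpotent L V :=
    (LieModule.isNilpotent_iff_forall' (R := K)).2 fun x => hnil x.1 x.2
  obtain ⟨m, hm⟩ := LieModule.IsNilpotent.nilpotent K L V
  have key : ∀ l : List (Module.End K V), (∀ x ∈ l, x ∈ S) → ∀ v : V,
      l.prod v ∈ LieModule.lowerCentralSeries K L V l.length := by
    intro l
    induction l with
    | nil => intro _ v; simp
    | cons a l ih =>
      intro hl v
      rw [List.prod_cons, List.length_cons, LieModule.lowerCentralSeries_succ]
      exact LieSubmodule.lie_mem_lie (I := (⊤ : LieIdeal K L))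
        (x := (⟨a, hl a (by simp)⟩ : L)) (LieSubmodule.mem_top _)
        (ih (fun x hx => hl x (by simp [hx])) v)
  refine ⟨m, fun l hlen hl => LinearMap.ext fun v => ?_⟩
  have := key l hl v
  rw [hlen, hm] at this
  simpa using this

theorem exists_matrix_list_prod_eq_zero {K n : Type*} [Field K] [Fintype n] [DecidableEq n]
    (S : Submodule K (Matrix n n K))
    (hlie : ∀ x ∈ S, ∀ y ∈ S, x * y - y * x ∈ S) (hnil : ∀ x ∈ S, IsNilpotent x) :
    ∃ m : ℕ, ∀ l : List (Matrix n n K), l.length = m → (∀ x ∈ l, x ∈ S) → l.prod = 0 := by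
  let e := Matrix.toLinAlgEquiv' (R := K) (n := n)
  obtain ⟨m, hm⟩ := exists_list_prod_eq_zero (S.map e.toLinearMap) (by
      rintro _ ⟨x, hx, rfl⟩ _ ⟨y, hy, rfl⟩
      exact ⟨_, hlie x hx y hy, by simp⟩) (by
      rintro _ ⟨x, hx, rfl⟩
      exact (hnil x hx).map e)
  refine ⟨m, fun l hlen hl => e.injective ?_⟩
  rw [map_list_prod, map_zero]
  refine hm _ (by simpa using hlen) ?_
  intro x hx
  obtain ⟨a, ha, rfl⟩ := List.mem_map.1 hx
  exact ⟨a, hl a ha, rfl⟩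

/-- A space of nilpotent matrices that is closed under commutators kills a nonzero vector in
every nonzero stable subspace. -/
theorem exists_mem_forall_mulVec_eq_zero {K n : Type*} [Field K] [Fintype n] [DecidableEq n]
    (S : Submodule K (Matrix n n K))
    (hlie : ∀ x ∈ S, ∀ y ∈ S, x * y - y * x ∈ S) (hnil : ∀ x ∈ S, IsNilpotent x)
    (W : Submodule K (n → K)) (hW : W ≠ ⊥) (hSW : ∀ x ∈ S, ∀ w ∈ W, x.mulVec w ∈ W) :
    ∃ w ∈ W, w ≠ 0 ∧ ∀ x ∈ S, x.mulVec w = 0 := by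
  classical
  obtain ⟨m, hm⟩ := exists_matrix_list_prod_eq_zero S hlie hnil
  by_contra! hcon
  obtain ⟨w, hw, hw0⟩ := Submodule.exists_mem_ne_zero_of_ne_bot hW
  -- If no nonzero vector of `W` were killed by all of `S`, products not killing `w` could be
  -- lengthened forever, against the bound `m` from Engel's theorem.
  have key : ∀ k : ℕ, ∃ l : List (Matrix n n K), l.length = k ∧ (∀ x ∈ l, x ∈ S) ∧
      l.prod.mulVec w ∈ W ∧ l.prod.mulVec w ≠ 0 := by
    intro k
    induction k with
    | zero => exact ⟨[], rfl, by simp, by simpa using hw, by simpa using hw0⟩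
    | succ k ih =>
      obtain ⟨l, hl, hlS, h1, h2⟩ := ih
      obtain ⟨x, hx, hx0⟩ := hcon _ h1 h2
      refine ⟨x :: l, by simp [hl], by simpa [hx] using hlS, ?_, ?_⟩
      · rw [List.prod_cons, ← Matrix.mulVec_mulVec]; exact hSW x hx _ h1
      · rw [List.prod_cons, ← Matrix.mulVec_mulVec]; exact hx0
  obtain ⟨l, hl, hlS, -, h2⟩ := key m
  exact h2 (by rw [hm l hl hlS, Matrix.zero_mulVec])

/-! ### Conjugate replicas -/

section Replica

open Module.End

variable {V : Type*} [AddCommGroup V] [Module ℂ V]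

/-- `g` acts on each generalized eigenspace of `f` by the complex conjugate of the eigenvalue. -/
def IsConjReplica (f g : Module.End ℂ V) : Prop :=
  ∀ μ : ℂ, ∀ v ∈ f.maxGenEigenspace μ, g v = (starRingEnd ℂ μ) • v

theorem exists_isConjReplica [FiniteDimensional ℂ V] (f : Module.End ℂ V) :
    ∃ g, IsConjReplica f g := by
  classical
  have h := DirectSum.isInternal_submodule_of_iSupIndep_of_iSup_eq_top
    f.independent_maxGenEigenspace f.iSup_maxGenEigenspace_eq_top
  let e := LinearEquiv.ofBijective (DirectSum.coeLinearMap fun μ => f.maxGenEigenspace μ) h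
  let d : (DirectSum ℂ fun μ => f.maxGenEigenspace μ) →ₗ[ℂ] V :=
    DirectSum.toModule ℂ ℂ V fun μ => (starRingEnd ℂ μ) • (f.maxGenEigenspace μ).subtype
  refine ⟨d ∘ₗ e.symm.toLinearMap, fun μ v hv => ?_⟩
  have : e.symm v = DirectSum.lof ℂ ℂ (fun μ => f.maxGenEigenspace μ) μ ⟨v, hv⟩ := by
    rw [LinearEquiv.symm_apply_eq]
    exact (DirectSum.coeLinearMap_lof (fun μ => f.maxGenEigenspace μ) μ ⟨v, hv⟩).symm
  rw [LinearMap.comp_apply, LinearEquiv.coe_coe, this]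
  simp [d]

/-- If a finite sum of generalized eigenvectors for distinct eigenvalues lies in a stable
subspace, then so do the summands. -/
theorem mem_of_sum_mem_of_mem_maxGenEigenspace {f : Module.End ℂ V} {p : Submodule ℂ V}
    (hp : ∀ x ∈ p, f x ∈ p) (s : Finset ℂ) (v : ℂ → V) (hv : ∀ μ, v μ ∈ f.maxGenEigenspace μ)
    (hsum : ∑ μ ∈ s, v μ ∈ p) : ∀ μ ∈ s, v μ ∈ p := by
  have hp' : p ≤ p.comap f := hp
  let fq : Module.End ℂ (V ⧸ p) := p.mapQ p f hp'
  have hmem : ∀ μ, p.mkQ (v μ) ∈ fq.maxGenEigenspace μ := by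
    intro μ
    obtain ⟨k, hk⟩ := (mem_maxGenEigenspace f μ (v μ)).1 (hv μ)
    refine (mem_maxGenEigenspace fq μ _).2 ⟨k, ?_⟩
    have hcomm : ∀ (k : ℕ) (x : V), ((fq - μ • (1 : Module.End ℂ (V ⧸ p))) ^ k) (p.mkQ x) =
        p.mkQ (((f - μ • (1 : Module.End ℂ V)) ^ k) x) := by
      intro k
      induction k with
      | zero => intro x; simp
      | succ k ih =>
        intro x
        rw [pow_succ, pow_succ, Module.End.mul_apply, Module.End.mul_apply, ← ih]
        simp [fq]
    rw [hcomm, hk, map_zero]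
  have h0 : ∑ μ ∈ s, p.mkQ (v μ) = 0 := by
    rw [← map_sum]
    exact (Submodule.Quotient.mk_eq_zero p).2 hsum
  intro μ hμ
  have hz := (iSupIndep_iff_finsetSum_eq_zero_imp_eq_zero _).1 fq.independent_maxGenEigenspace s
    (fun μ => p.mkQ (v μ)) (fun μ _ => hmem μ) h0 μ hμ
  exact (Submodule.Quotient.mk_eq_zero p).1 hz

/-- Uniqueness of the decomposition into generalized eigenvectors: pieces of the generalized
eigenspaces that already span must be all of them. No finite-dimensionality is needed, so it applies
to derivations of a polynomial ring. -/
theorem mem_iSup_maxGenEigenspace_inf {f : Module.End ℂ V} {P : ℂ → Submodule ℂ V}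
    (hP : ∀ μ, P μ ≤ f.maxGenEigenspace μ) (htop : ⨆ μ, P μ = ⊤) {μ : ℂ} {v : V}
    (hv : v ∈ f.maxGenEigenspace μ) : v ∈ P μ := by
  classical
  obtain ⟨m, hm, hsum⟩ := (Submodule.mem_iSup_iff_exists_finsupp P v).1
    (htop ▸ Submodule.mem_top : v ∈ ⨆ μ, P μ)
  have hind := (iSupIndep_iff_finsetSum_eq_zero_imp_eq_zero _).1 f.independent_maxGenEigenspace
    (insert μ m.support) (fun ν => m ν - if ν = μ then v else 0) (fun ν _ => by
      split_ifs with h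
      · subst h; exact sub_mem (hP _ (hm _)) hv
      · simpa using hP _ (hm ν)) (by
      rw [Finset.sum_sub_distrib, Finset.sum_ite_eq' (insert μ m.support) μ (fun _ => v),
        if_pos (Finset.mem_insert_self _ _), sub_eq_zero, ← hsum, Finsupp.sum]
      exact (Finset.sum_subset (Finset.subset_insert _ _)
        fun x _ hx => by simpa using hx).symm) μ (Finset.mem_insert_self _ _)
  have : m μ = v := by simpa [sub_eq_zero] using hind
  exact this ▸ hm μ

namespace IsConjReplica

variable {f g : Module.End ℂ V}

theorem of_iSup_eq_top
    (h : ⨆ ν, f.maxGenEigenspace ν ⊓ LinearMap.ker (g - (starRingEnd ℂ ν) • 1) = ⊤) :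
    IsConjReplica f g := by
  intro μ v hv
  have := (mem_iSup_maxGenEigenspace_inf (fun ν => inf_le_left) h hv).2
  simpa [sub_eq_zero] using this

/-- A stable subspace contains the generalized eigencomponents of its elements, and `g` is scalar on
each component. The spanning hypothesis replaces finite dimension because `p` will be the vanishing
ideal of a group. -/
theorem apply_mem (hfg : IsConjReplica f g) (htop : ⨆ μ, f.maxGenEigenspace μ = ⊤)
    {p : Submodule ℂ V} (hp : ∀ x ∈ p, f x ∈ p) : ∀ x ∈ p, g x ∈ p := by
  intro x hx
  obtain ⟨m, hm, hsum⟩ := (Submodule.mem_iSup_iff_exists_finsupp _ x).1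
    (htop ▸ Submodule.mem_top : x ∈ ⨆ μ, f.maxGenEigenspace μ)
  rw [← hsum, Finsupp.sum] at hx ⊢
  rw [map_sum]
  refine sum_mem fun μ hμ => ?_
  rw [hfg μ _ (hm μ)]
  exact p.smul_mem _ (mem_of_sum_mem_of_mem_maxGenEigenspace hp _ _ hm hx μ hμ)

theorem apply_eq_zero (hfg : IsConjReplica f g) {v : V} {k : ℕ} (hv : (f ^ k) v = 0) :
    g v = 0 := by
  simpa using hfg 0 v ((mem_maxGenEigenspace f 0 v).2 ⟨k, by simpa using hv⟩)

theorem restrict (hfg : IsConjReplica f g) {p : Submodule ℂ V} (hf : ∀ x ∈ p, f x ∈ p)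
    (hg : ∀ x ∈ p, g x ∈ p) : IsConjReplica (f.restrict hf) (g.restrict hg) := by
  intro μ v hv
  rw [maxGenEigenspace, genEigenspace_restrict] at hv
  exact Subtype.ext (hfg μ v hv)

/-- On the generalized eigenspace of `μ` the trace of `f * g` is `|μ|²` times the dimension. A sum
of nonnegative terms vanishes only if every eigenvalue is zero. -/
theorem trace_mul [FiniteDimensional ℂ V] (hfg : IsConjReplica f g)
    (h : LinearMap.trace ℂ V (f * g) = 0) (μ : ℂ) (hμ : f.maxGenEigenspace μ ≠ ⊥) : μ = 0 := by
  classical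
  have hds := DirectSum.isInternal_submodule_of_iSupIndep_of_iSup_eq_top
    f.independent_maxGenEigenspace f.iSup_maxGenEigenspace_eq_top
  have hfin : {μ | f.maxGenEigenspace μ ≠ ⊥}.Finite :=
    WellFoundedGT.finite_ne_bot_of_iSupIndep f.independent_maxGenEigenspace
  have hmf := fun μ => f.mapsTo_maxGenEigenspace_of_comm (Commute.refl f) μ
  have hmaps : ∀ μ, Set.MapsTo (f * g) (f.maxGenEigenspace μ) (f.maxGenEigenspace μ) := by
    intro μ v hv
    rw [Module.End.mul_apply, hfg μ v hv]
    exact hmf μ (Submodule.smul_mem _ _ hv)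
  have htr : ∀ μ, LinearMap.trace ℂ _ ((f * g).restrict (hmaps μ)) =
      ((Complex.normSq μ * Module.finrank ℂ (f.maxGenEigenspace μ) : ℝ) : ℂ) := by
    intro μ
    have h1 : (f * g).restrict (hmaps μ) = (starRingEnd ℂ μ) • f.restrict (hmf μ) := by
      ext v
      change f (g v) = (starRingEnd ℂ μ) • f v
      rw [hfg μ v v.2, map_smul]
    have h2 : LinearMap.trace ℂ _ (f.restrict (hmf μ)) =
        μ * Module.finrank ℂ (f.maxGenEigenspace μ) := by
      have hn := LinearMap.isNilpotent_trace_of_isNilpotent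
        (f.isNilpotent_restrict_maxGenEigenspace_sub_algebraMap μ)
      have h3 : (f - algebraMap ℂ (Module.End ℂ V) μ).restrict
          (f.mapsTo_maxGenEigenspace_of_comm (Algebra.mul_sub_algebraMap_commutes f μ) μ) =
          f.restrict (hmf μ) - μ • 1 := by
        ext v
        simp [LinearMap.restrict_apply, Algebra.algebraMap_eq_smul_one]
        rfl
      rw [h3, map_sub, map_smul, LinearMap.trace_one, isNilpotent_iff_eq_zero, sub_eq_zero] at hn
      rw [hn, smul_eq_mul]
    rw [h1, map_smul, h2, smul_eq_mul, ← mul_assoc, ← Complex.normSq_eq_conj_mul_self]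
    push_cast
    rfl
  rw [LinearMap.trace_eq_sum_trace_restrict' hds hfin hmaps] at h
  simp_rw [htr] at h
  rw [← Complex.ofReal_sum, Complex.ofReal_eq_zero, Finset.sum_eq_zero_iff_of_nonneg
    (fun μ _ => mul_nonneg (Complex.normSq_nonneg μ) (Nat.cast_nonneg _))] at h
  have := h μ (by simpa using hμ)
  rcases mul_eq_zero.1 this with h0 | h0
  · exact Complex.normSq_eq_zero.1 h0
  · rw [Nat.cast_eq_zero, Submodule.finrank_eq_zero] at h0
    exact absurd h0 hμ

theorem eq_zero_of_trace_mul [FiniteDimensional ℂ V] (hfg : IsConjReplica f g)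
    (h : LinearMap.trace ℂ V (f * g) = 0) : g = 0 := by
  have htop := f.iSup_maxGenEigenspace_eq_top
  have hle : ⨆ μ, f.maxGenEigenspace μ ≤ LinearMap.ker g := by
    refine iSup_le fun μ v hv => ?_
    by_cases hμ : f.maxGenEigenspace μ = ⊥
    · rw [hμ, Submodule.mem_bot] at hv
      simp [hv]
    · simp [hfg μ v hv, hfg.trace_mul h μ hμ]
  rw [htop, top_le_iff, LinearMap.ker_eq_top] at hle
  exact hle

theorem isNilpotent_of_trace_mul [FiniteDimensional ℂ V] (hfg : IsConjReplica f g)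
    (h : LinearMap.trace ℂ V (f * g) = 0) : IsNilpotent f := by
  have htop := f.iSup_maxGenEigenspace_eq_top
  have hle : ⨆ μ, f.maxGenEigenspace μ ≤ f.maxGenEigenspace 0 := by
    refine iSup_le fun μ => ?_
    by_cases hμ : f.maxGenEigenspace μ = ⊥
    · simp [hμ]
    · rw [hfg.trace_mul h μ hμ]
  rw [htop, top_le_iff] at hle
  refine ((LinearMap.charpoly_nilpotent_tfae f).out 0 2).2 fun v => ?_
  simpa using (mem_maxGenEigenspace f 0 v).1 (hle ▸ Submodule.mem_top)

theorem neg (hfg : IsConjReplica f g) : IsConjReplica (-f) (-g) := by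
  intro μ v hv
  have := genEigenspace_le_smul (-f) μ (-1) ⊤ hv
  simp only [smul_neg, neg_smul, one_smul, neg_neg, neg_mul, one_mul] at this
  rw [LinearMap.neg_apply, hfg (-μ) v this, map_neg, neg_smul, neg_neg]

/-- Commuting endomorphisms have joint generalized eigenspaces that span; there the eigenvalues add,
and so do their conjugates. -/
theorem add [FiniteDimensional ℂ V] {f' g' : Module.End ℂ V} (hfg : IsConjReplica f g)
    (hfg' : IsConjReplica f' g') (hcomm : Commute f f') : IsConjReplica (f + f') (g + g') := by
  apply of_iSup_eq_top
  rw [eq_top_iff, ← f.iSup_maxGenEigenspace_eq_top]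
  refine iSup_le fun μ => ?_
  have h1 := Submodule.inf_iSup_genEigenspace (p := f.maxGenEigenspace μ) (f := f')
    (fun x hx => f.mapsTo_maxGenEigenspace_of_comm hcomm μ hx) ⊤
  have h2 : ⨆ ν, f'.genEigenspace ν ⊤ = ⊤ := f'.iSup_maxGenEigenspace_eq_top
  rw [h2, inf_top_eq] at h1
  rw [h1]
  refine iSup_le fun ν => ?_
  refine le_trans ?_ (le_iSup _ (μ + ν))
  rintro v ⟨hv, hv'⟩
  refine ⟨?_, ?_⟩
  · have := genEigenspace_inf_le_add f f' μ ν ⊤ ⊤ hcomm ⟨hv, hv'⟩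
    simpa using this
  · simp [hfg μ v hv, hfg' ν v hv', add_smul]

/-- The transpose of a conjugate replica is a conjugate replica of the transpose. -/
theorem comp_eq_smul [FiniteDimensional ℂ V] (hfg : IsConjReplica f g) {φ : Module.Dual ℂ V}
    {μ : ℂ} {k : ℕ} (hφ : φ ∘ₗ ((f - μ • (1 : Module.End ℂ V)) ^ k) = 0) :
    φ ∘ₗ g = (starRingEnd ℂ μ) • φ := by
  have hle : ⨆ ν, f.maxGenEigenspace ν ≤ LinearMap.ker (φ ∘ₗ g - (starRingEnd ℂ μ) • φ) := by
    refine iSup_le fun ν v hv => ?_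
    have hgv := hfg ν v hv
    simp only [LinearMap.mem_ker, LinearMap.sub_apply, LinearMap.comp_apply, LinearMap.smul_apply,
      hgv, map_smul]
    by_cases hν : ν = μ
    · rw [hν, sub_self]
    -- For `ν ≠ μ` the operator `(f - μ) ^ k` is bijective on the generalized eigenspace of `ν`, so
    -- a functional that vanishes after it vanishes there.
    have hφv : φ v = 0 := by
      let d := (f - μ • (1 : Module.End ℂ V)) ^ k
      have hd : ∀ x ∈ f.maxGenEigenspace ν, d x ∈ f.maxGenEigenspace ν := fun x hx =>
        f.mapsTo_maxGenEigenspace_of_comm (g := d)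
          (((Commute.refl f).sub_right (by
            rw [← Algebra.algebraMap_eq_smul_one]
            exact Algebra.commute_algebraMap_right μ f)).pow_right k) ν hx
      have hinj : Function.Injective (d.restrict hd) := by
        rw [← LinearMap.ker_eq_bot, LinearMap.ker_eq_bot']
        intro x hx
        have hx0 : d x = 0 := congrArg Subtype.val hx
        have hx1 : (x : V) ∈ f.genEigenspace μ k := (mem_genEigenspace_nat).2 hx0
        have hdis := disjoint_genEigenspace f (Ne.symm hν) k ⊤
        exact Subtype.ext ((Submodule.disjoint_def.1 hdis) x hx1 x.2)
      obtain ⟨u, hu⟩ := (LinearMap.injective_iff_surjective.1 hinj) ⟨v, hv⟩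
      have hu' : d u = v := congrArg Subtype.val hu
      rw [← hu']
      exact LinearMap.congr_fun hφ u
    rw [hφv, smul_zero, smul_zero, sub_zero]
  rw [f.iSup_maxGenEigenspace_eq_top, top_le_iff, LinearMap.ker_eq_top, sub_eq_zero] at hle
  exact hle

end IsConjReplica

section MatrixReplica

variable {n : Type*} [Fintype n] [DecidableEq n]

/-- The commutator with a matrix. -/
def adMat {K : Type*} [CommRing K] (X : Matrix n n K) : Module.End K (Matrix n n K) :=
  LinearMap.mulLeft K X - LinearMap.mulRight K X

@[simp] theorem adMat_apply {K : Type*} [CommRing K] (X Y : Matrix n n K) :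
    adMat X Y = X * Y - Y * X := rfl

variable {X X' : Matrix n n ℂ}

theorem IsConjReplica.mulLeft (h : IsConjReplica (Matrix.toLin' X) (Matrix.toLin' X')) :
    IsConjReplica (LinearMap.mulLeft ℂ X) (LinearMap.mulLeft ℂ X') := by
  intro μ M hM
  obtain ⟨k, hk⟩ := (mem_maxGenEigenspace _ μ M).1 hM
  have hpow : ∀ (k : ℕ) (M : Matrix n n ℂ),
      ((LinearMap.mulLeft ℂ X - μ • (1 : Module.End ℂ (Matrix n n ℂ))) ^ k) M =
      (X - μ • (1 : Matrix n n ℂ)) ^ k * M := by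
    intro k
    induction k with
    | zero => intro M; simp
    | succ k ih =>
      intro M
      rw [pow_succ, Module.End.mul_apply, ih, pow_succ, mul_assoc]
      congr 1
      simp [sub_mul]
  rw [hpow] at hk
  have hcol : ∀ j, X'.mulVec (M.col j) = (starRingEnd ℂ μ) • M.col j := by
    intro j
    rw [← Matrix.toLin'_apply]
    refine h μ _ ((mem_maxGenEigenspace _ μ _).2 ⟨k, ?_⟩)
    have : Matrix.toLin' X - μ • (1 : Module.End ℂ (n → ℂ)) =
        Matrix.toLinAlgEquiv' (X - μ • (1 : Matrix n n ℂ)) := by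
      rw [map_sub, map_smul, map_one]; rfl
    rw [this, ← map_pow]
    change Matrix.toLin' _ _ = 0
    rw [Matrix.toLin'_apply]
    ext i
    exact congrFun (congrFun hk i) j
  ext i j
  exact congrFun (hcol j) i

/-- Each row of a generalized eigenmatrix is a generalized eigenvector of the transpose, which is
where `comp_eq_smul` enters. -/
theorem IsConjReplica.mulRight (h : IsConjReplica (Matrix.toLin' X) (Matrix.toLin' X')) :
    IsConjReplica (LinearMap.mulRight ℂ X) (LinearMap.mulRight ℂ X') := by
  intro μ M hM
  obtain ⟨k, hk⟩ := (mem_maxGenEigenspace _ μ M).1 hM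
  have hpow : ∀ (k : ℕ) (M : Matrix n n ℂ),
      ((LinearMap.mulRight ℂ X - μ • (1 : Module.End ℂ (Matrix n n ℂ))) ^ k) M =
      M * (X - μ • (1 : Matrix n n ℂ)) ^ k := by
    intro k
    induction k with
    | zero => intro M; simp
    | succ k ih =>
      intro M
      rw [pow_succ, Module.End.mul_apply, ih, pow_succ', ← mul_assoc]
      congr 1
      simp [mul_sub]
  rw [hpow] at hk
  have hrow : ∀ i (v : n → ℂ), M i ⬝ᵥ X'.mulVec v = (starRingEnd ℂ μ) * (M i ⬝ᵥ v) := by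
    intro i v
    have : Matrix.toLin' X - μ • (1 : Module.End ℂ (n → ℂ)) =
        Matrix.toLinAlgEquiv' (X - μ • (1 : Matrix n n ℂ)) := by
      rw [map_sub, map_smul, map_one]; rfl
    have := h.comp_eq_smul (φ := dotProductBilin ℂ ℂ (M i)) (μ := μ) (k := k) (by
      rw [this, ← map_pow]
      ext j
      have h2 := congrFun (congrFun hk i) j
      change M i ⬝ᵥ ((X - μ • (1 : Matrix n n ℂ)) ^ k).mulVec (Pi.single j 1) = 0
      rw [Matrix.mulVec_single_one]
      exact h2)
    exact LinearMap.congr_fun this v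
  ext i j
  have := hrow i (Pi.single j 1)
  rw [Matrix.mulVec_single_one, dotProduct_single_one] at this
  exact this

/-- Left and right multiplication by `X` commute, so replicas of the two combine. This transfers
information from the matrix to its action by commutators. -/
theorem IsConjReplica.adMat (h : IsConjReplica (Matrix.toLin' X) (Matrix.toLin' X')) :
    IsConjReplica (adMat X) (adMat X') := by
  have hc : Commute (LinearMap.mulLeft ℂ X) (LinearMap.mulRight ℂ X) :=
    LinearMap.ext fun M => (mul_assoc X M X).symm
  have := h.mulLeft.add h.mulRight.neg hc.neg_right
  rw [← sub_eq_add_neg, ← sub_eq_add_neg] at this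
  exact this

end MatrixReplica

end Replica

end SpFour

/-! ### The complexified Lie algebra of a subgroup, through derivations of the polynomial ring. -/

namespace SpFour

open MvPolynomial

/-- Complex polynomials in the sixteen matrix entries. -/
abbrev PolyC : Type := MvPolynomial (Idx × Idx) ℂ

/-- A real symplectic matrix as a complex matrix. -/
noncomputable def cmat : Sp4 →* Matrix Idx Idx ℂ :=
  (Complex.ofRealHom.mapMatrix : Matrix Idx Idx ℝ →+* Matrix Idx Idx ℂ).toMonoidHom.comp
    (Matrix.symplecticGroup (Fin 2) ℝ).subtype

theorem cmat_mul_inv (g : Sp4) : cmat g * cmat g⁻¹ = 1 := by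
  rw [← map_mul, mul_inv_cancel, map_one]

theorem cmat_inv_mul (g : Sp4) : cmat g⁻¹ * cmat g = 1 := by
  rw [← map_mul, inv_mul_cancel, map_one]

/-- The adjoint with respect to the standard symplectic form. -/
def symplAdj {R : Type*} [CommRing R] (A : Matrix Idx Idx R) : Matrix Idx Idx R :=
  -Matrix.J (Fin 2) R * A.transpose * Matrix.J (Fin 2) R

theorem J_map {R S : Type*} [CommRing R] [CommRing S] (f : R →+* S) :
    (Matrix.J (Fin 2) R).map f = Matrix.J (Fin 2) S := by
  ext i j
  rcases i with i | i <;> rcases j with j | j <;>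
    simp [Matrix.J, Matrix.map_apply, Matrix.one_apply, apply_ite f]

theorem symplAdj_map {R S : Type*} [CommRing R] [CommRing S] (f : R →+* S)
    (A : Matrix Idx Idx R) : (symplAdj A).map f = symplAdj (A.map f) := by
  have h := RingHom.mapMatrix_apply f (symplAdj A)
  rw [← h, symplAdj, map_mul, map_mul, map_neg, RingHom.mapMatrix_apply, RingHom.mapMatrix_apply,
    J_map, Matrix.transpose_map]
  rfl

theorem cmat_inv (g : Sp4) : cmat g⁻¹ = symplAdj (cmat g) := by
  change ((g⁻¹ : Sp4) : Matrix Idx Idx ℝ).map Complex.ofRealHom =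
    symplAdj ((g : Matrix Idx Idx ℝ).map Complex.ofRealHom)
  rw [← symplAdj_map, SymplecticGroup.coe_inv]
  rfl

/-- Evaluation of a polynomial at a matrix. -/
noncomputable def evalAt (A : Matrix Idx Idx ℂ) : PolyC →ₐ[ℂ] ℂ := aeval fun ij => A ij.1 ij.2

/-- The matrix of coordinate functions. -/
noncomputable def genMat : Matrix Idx Idx PolyC := Matrix.of fun i j => X (i, j)

/-- A complex matrix as a matrix of constant polynomials. -/
noncomputable def constMat (A : Matrix Idx Idx ℂ) : Matrix Idx Idx PolyC := A.map C

theorem map_evalAt_genMat (A : Matrix Idx Idx ℂ) : genMat.map (evalAt A) = A := by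
  ext i j
  simp [genMat, evalAt]

theorem map_algHom_constMat (φ : PolyC →ₐ[ℂ] PolyC) (A : Matrix Idx Idx ℂ) :
    (constMat A).map φ = constMat A := by
  ext1 i j
  exact φ.commutes _

theorem map_evalAt_constMat (B A : Matrix Idx Idx ℂ) : (constMat A).map (evalAt B) = A := by
  ext i j
  exact (evalAt B).commutes _

theorem map_mul_matrix {R S : Type*} [CommRing R] [CommRing S] (f : R →+* S)
    (A B : Matrix Idx Idx R) : (A * B).map f = A.map f * B.map f := Matrix.map_mul

theorem constMat_mul (A B : Matrix Idx Idx ℂ) : constMat (A * B) = constMat A * constMat B :=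
  map_mul_matrix C A B

/-- Substitution of a matrix of polynomials for the coordinates. -/
noncomputable def substMat (Q : Matrix Idx Idx PolyC) : PolyC →ₐ[ℂ] PolyC :=
  aeval fun ij => Q ij.1 ij.2

theorem map_substMat_genMat (Q : Matrix Idx Idx PolyC) : genMat.map (substMat Q) = Q := by
  ext1 i j
  simp [genMat, substMat]

theorem evalAt_substMat (A : Matrix Idx Idx ℂ) (Q : Matrix Idx Idx PolyC) (F : PolyC) :
    evalAt A (substMat Q F) = evalAt (Q.map (evalAt A)) F := by
  have : (evalAt A).comp (substMat Q) = evalAt (Q.map (evalAt A)) := by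
    ext ij
    simp [evalAt, substMat]
  exact DFunLike.congr_fun this F

/-- The left-invariant vector field attached to a matrix. -/
noncomputable def invField (A : Matrix Idx Idx ℂ) : Derivation ℂ PolyC PolyC :=
  mkDerivation ℂ fun ij => (genMat * constMat A) ij.1 ij.2

theorem map_invField_genMat (A : Matrix Idx Idx ℂ) :
    genMat.map (invField A) = genMat * constMat A := by
  ext1 i j
  simp [genMat, invField]

theorem map_derivation_mul (D : Derivation ℂ PolyC PolyC) (P Q : Matrix Idx Idx PolyC) :
    (P * Q).map D = P.map D * Q + P * Q.map D := by
  ext1 i j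
  simp only [Matrix.map_apply, Matrix.mul_apply, map_sum, Derivation.leibniz, smul_eq_mul,
    Matrix.add_apply, ← Finset.sum_add_distrib]
  exact Finset.sum_congr rfl fun k _ => by ring

theorem map_derivation_constMat (D : Derivation ℂ PolyC PolyC) (A : Matrix Idx Idx ℂ) :
    (constMat A).map D = 0 := by
  ext1 i j
  exact D.map_algebraMap _

/-- Chain rule: vector fields related by a polynomial map on the coordinate functions are related on
all polynomials, since both sides obey the Leibniz rule. -/
theorem derivation_substMat {D D' : Derivation ℂ PolyC PolyC} {Q : Matrix Idx Idx PolyC}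
    (h : Q.map D = (genMat.map D').map (substMat Q)) (F : PolyC) :
    D (substMat Q F) = substMat Q (D' F) := by
  induction F using MvPolynomial.induction_on with
  | C a =>
    rw [show (C a : PolyC) = algebraMap ℂ PolyC a from rfl, AlgHom.commutes, D.map_algebraMap,
      D'.map_algebraMap, map_zero]
  | add p q hp hq => rw [map_add, map_add, hp, hq, map_add, map_add]
  | mul_X p ij hp =>
    have hX : D (substMat Q (X ij)) = substMat Q (D' (X ij)) := by
      have := congrFun (congrFun h ij.1) ij.2
      simpa [genMat, substMat] using this
    simp only [map_mul, Derivation.leibniz, smul_eq_mul, map_add, hX, hp]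

theorem invField_add (A B : Matrix Idx Idx ℂ) : invField (A + B) = invField A + invField B := by
  refine MvPolynomial.derivation_ext fun ij => ?_
  simp [invField, constMat, Matrix.mul_apply, mul_add, Finset.sum_add_distrib]

theorem invField_smul (c : ℂ) (A : Matrix Idx Idx ℂ) : invField (c • A) = c • invField A := by
  refine MvPolynomial.derivation_ext fun ij => ?_
  simp only [invField, constMat, mkDerivation_X, Derivation.smul_apply, Matrix.mul_apply,
    Matrix.map_apply, Matrix.smul_apply, Finset.smul_sum]
  refine Finset.sum_congr rfl fun k _ => ?_
  rw [smul_eq_mul, C_mul, MvPolynomial.smul_eq_C_mul]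
  ring

/-- A linear functional on matrices, applied to a matrix of polynomials. -/
noncomputable def functionalPoly (ℓ : Module.Dual ℂ (Matrix Idx Idx ℂ))
    (Q : Matrix Idx Idx PolyC) : PolyC :=
  ∑ i, ∑ j, C (ℓ (Matrix.single i j 1)) * Q i j

theorem functional_eq_sum (ℓ : Module.Dual ℂ (Matrix Idx Idx ℂ)) (A : Matrix Idx Idx ℂ) :
    ℓ A = ∑ i, ∑ j, ℓ (Matrix.single i j 1) * A i j := by
  conv_lhs => rw [Matrix.matrix_eq_sum_single A]
  simp only [map_sum]
  refine Finset.sum_congr rfl fun i _ => Finset.sum_congr rfl fun j _ => ?_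
  rw [← mul_one (A i j), ← smul_eq_mul (A i j) 1, ← Matrix.smul_single, map_smul, smul_eq_mul,
    smul_eq_mul, mul_one, mul_comm]

theorem evalAt_functionalPoly (A : Matrix Idx Idx ℂ) (ℓ : Module.Dual ℂ (Matrix Idx Idx ℂ))
    (Q : Matrix Idx Idx PolyC) : evalAt A (functionalPoly ℓ Q) = ℓ (Q.map (evalAt A)) := by
  have hC : ∀ c : ℂ, evalAt A (C c) = c := fun c => (evalAt A).commutes c
  rw [functional_eq_sum]
  simp only [functionalPoly, map_sum, map_mul, hC, Matrix.map_apply]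

theorem derivation_functionalPoly (D : Derivation ℂ PolyC PolyC)
    (ℓ : Module.Dual ℂ (Matrix Idx Idx ℂ)) (Q : Matrix Idx Idx PolyC) :
    D (functionalPoly ℓ Q) = functionalPoly ℓ (Q.map D) := by
  simp only [functionalPoly, map_sum, Matrix.map_apply, ← MvPolynomial.smul_eq_C_mul,
    Derivation.map_smul]

/-- The complex polynomials that vanish on `H`. -/
noncomputable def vanIdeal (H : Subgroup Sp4) : Ideal PolyC where
  carrier := {F | ∀ g ∈ H, evalAt (cmat g) F = 0}
  add_mem' ha hb g hg := by rw [map_add, ha g hg, hb g hg, add_zero]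
  zero_mem' _ _ := map_zero _
  smul_mem' c F hF g hg := by rw [smul_eq_mul, map_mul, hF g hg, mul_zero]

theorem mem_vanIdeal {H : Subgroup Sp4} {F : PolyC} :
    F ∈ vanIdeal H ↔ ∀ g ∈ H, evalAt (cmat g) F = 0 := Iff.rfl

/-- The (complexified) Lie algebra of `H`, as the left-invariant vector fields tangent to `H`. -/
noncomputable def lieAlg (H : Subgroup Sp4) : Submodule ℂ (Matrix Idx Idx ℂ) where
  carrier := {A | ∀ F ∈ vanIdeal H, invField A F ∈ vanIdeal H}
  add_mem' ha hb F hF := by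
    rw [invField_add]
    exact add_mem (ha F hF) (hb F hF)
  zero_mem' F hF := by
    have : invField 0 = 0 := by simpa using invField_smul 0 0
    rw [this]
    exact zero_mem _
  smul_mem' c A hA F hF := by
    rw [invField_smul, Derivation.smul_apply, MvPolynomial.smul_eq_C_mul]
    exact Ideal.mul_mem_left _ _ (hA F hF)

variable {H : Subgroup Sp4}

theorem substMat_left_mem_vanIdeal {g : Sp4} (hg : g ∈ H) {F : PolyC} (hF : F ∈ vanIdeal H) :
    substMat (constMat (cmat g) * genMat) F ∈ vanIdeal H := by
  intro h hh
  rw [evalAt_substMat, show (constMat (cmat g) * genMat).map (evalAt (cmat h)) =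
    (constMat (cmat g)).map (evalAt (cmat h)) * genMat.map (evalAt (cmat h)) from
    map_mul_matrix (evalAt (cmat h)).toRingHom _ _, map_evalAt_constMat, map_evalAt_genMat,
    ← map_mul]
  exact hF _ (H.mul_mem hg hh)

theorem invField_substMat_left (B A : Matrix Idx Idx ℂ) (F : PolyC) :
    invField A (substMat (constMat B * genMat) F) =
      substMat (constMat B * genMat) (invField A F) := by
  refine derivation_substMat ?_ F
  rw [map_derivation_mul, map_derivation_constMat, map_invField_genMat, zero_mul, zero_add,
    show (genMat * constMat A).map (substMat (constMat B * genMat)) =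
    genMat.map (substMat (constMat B * genMat)) *
      (constMat A).map (substMat (constMat B * genMat)) from
    map_mul_matrix (substMat (constMat B * genMat)).toRingHom _ _, map_substMat_genMat,
    map_algHom_constMat, mul_assoc]

theorem evalAt_invField (A : Matrix Idx Idx ℂ) (B : Matrix Idx Idx ℂ) (F : PolyC) :
    evalAt B (invField A F) = evalAt 1 (invField A (substMat (constMat B * genMat) F)) := by
  rw [invField_substMat_left, evalAt_substMat,
    show (constMat B * genMat).map (evalAt 1) =
    (constMat B).map (evalAt 1) * genMat.map (evalAt 1) from
    map_mul_matrix (evalAt 1).toRingHom _ _, map_evalAt_constMat, map_evalAt_genMat, mul_one]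

/-- Tangency at the identity is enough: the field commutes with left translations, and these
preserve the vanishing ideal of `H`. -/
theorem mem_lieAlg_iff {A : Matrix Idx Idx ℂ} :
    A ∈ lieAlg H ↔ ∀ F ∈ vanIdeal H, evalAt 1 (invField A F) = 0 := by
  refine ⟨fun h F hF => ?_, fun h F hF g hg => ?_⟩
  · have := h F hF 1 H.one_mem
    rwa [map_one] at this
  · rw [evalAt_invField]
    exact h _ (substMat_left_mem_vanIdeal hg hF)

/-- Conjugation by `k` is a polynomial map that preserves `H`, fixes `1`, and has differential `A ↦
k A k⁻¹` there. -/
theorem conj_mem_lieAlg {A : Matrix Idx Idx ℂ} (hA : A ∈ lieAlg H) {k : Sp4} (hk : k ∈ H) :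
    cmat k * A * cmat k⁻¹ ∈ lieAlg H := by
  rw [mem_lieAlg_iff]
  intro F hF
  set Q := constMat (cmat k) * genMat * constMat (cmat k⁻¹) with hQ
  have hev : ∀ B, Q.map (evalAt B) = cmat k * B * cmat k⁻¹ := by
    intro B
    rw [hQ, show ∀ P P' : Matrix Idx Idx PolyC, (P * P').map (evalAt B) =
      P.map (evalAt B) * P'.map (evalAt B) from map_mul_matrix (evalAt B).toRingHom,
      show ∀ P P' : Matrix Idx Idx PolyC, (P * P').map (evalAt B) =
      P.map (evalAt B) * P'.map (evalAt B) from map_mul_matrix (evalAt B).toRingHom,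
      map_evalAt_constMat, map_evalAt_constMat, map_evalAt_genMat]
  have hder : invField A (substMat Q F) =
      substMat Q (invField (cmat k * A * cmat k⁻¹) F) := by
    refine derivation_substMat ?_ F
    rw [map_invField_genMat, show ∀ P P' : Matrix Idx Idx PolyC, (P * P').map (substMat Q) =
      P.map (substMat Q) * P'.map (substMat Q) from map_mul_matrix (substMat Q).toRingHom,
      map_substMat_genMat, map_algHom_constMat, hQ, map_derivation_mul, map_derivation_mul,
      map_derivation_constMat, map_derivation_constMat, map_invField_genMat, zero_mul, zero_add,
      mul_zero, add_zero]
    simp only [mul_assoc, ← constMat_mul]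
    rw [← mul_assoc (cmat k⁻¹) (cmat k), cmat_inv_mul, one_mul]
  have h1 : evalAt 1 (invField (cmat k * A * cmat k⁻¹) F) =
      evalAt 1 (invField A (substMat Q F)) := by
    rw [hder, evalAt_substMat, hev, mul_one, cmat_mul_inv]
  rw [h1]
  refine mem_lieAlg_iff.1 hA _ fun h hh => ?_
  rw [evalAt_substMat, hev, ← map_mul, ← map_mul]
  exact hF _ (H.mul_mem (H.mul_mem hk hh) (H.inv_mem hk))

theorem map_derivation_symplAdj (D : Derivation ℂ PolyC PolyC) (Q : Matrix Idx Idx PolyC) :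
    (symplAdj Q).map D = symplAdj (Q.map D) := by
  have hJ : Matrix.J (Fin 2) PolyC = constMat (Matrix.J (Fin 2) ℂ) :=
    (J_map (C : ℂ →+* PolyC)).symm
  have hJ' : -Matrix.J (Fin 2) PolyC = constMat (-Matrix.J (Fin 2) ℂ) := by
    rw [hJ, constMat, constMat, Matrix.map_neg _ (fun a => map_neg C a)]
  rw [symplAdj, symplAdj, hJ', hJ, map_derivation_mul, map_derivation_mul, map_derivation_constMat,
    map_derivation_constMat, zero_mul, zero_add, mul_zero, add_zero, Matrix.transpose_map]

theorem symplAdj_mul {R : Type*} [CommRing R] (A B : Matrix Idx Idx R) :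
    symplAdj (A * B) = symplAdj B * symplAdj A := by
  have h : Matrix.J (Fin 2) R * -Matrix.J (Fin 2) R = 1 := by
    rw [mul_neg, Matrix.J_squared, neg_neg]
  simp only [symplAdj, Matrix.transpose_mul]
  calc _ = -Matrix.J (Fin 2) R * B.transpose * (1 * (A.transpose * Matrix.J (Fin 2) R)) := by
        rw [one_mul]; simp only [mul_assoc]
    _ = _ := by rw [← h]; simp only [mul_assoc]

/-- Functionals turn matrix-valued conditions into scalar polynomials, to which the definition of
the Lie algebra applies. -/
theorem mem_of_forall_dual {K V : Type*} [Field K] [AddCommGroup V] [Module K V]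
    {p : Submodule K V} {v : V} (h : ∀ ℓ : Module.Dual K V, p ≤ LinearMap.ker ℓ → ℓ v = 0) :
    v ∈ p := by
  by_contra hv
  obtain ⟨ℓ, hℓ, hp⟩ := Submodule.exists_le_ker_of_notMem hv
  exact hℓ (h ℓ hp)

theorem map_evalAt_mul (B : Matrix Idx Idx ℂ) (P P' : Matrix Idx Idx PolyC) :
    (P * P').map (evalAt B) = P.map (evalAt B) * P'.map (evalAt B) :=
  map_mul_matrix (evalAt B).toRingHom P P'

theorem map_evalAt_add (B : Matrix Idx Idx ℂ) (P P' : Matrix Idx Idx PolyC) :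
    (P + P').map (evalAt B) = P.map (evalAt B) + P'.map (evalAt B) :=
  Matrix.map_add _ (fun a b => map_add (evalAt B) a b) P P'

theorem map_evalAt_symplAdj (B : Matrix Idx Idx ℂ) (P : Matrix Idx Idx PolyC) :
    (symplAdj P).map (evalAt B) = symplAdj (P.map (evalAt B)) :=
  symplAdj_map (evalAt B).toRingHom P

theorem symplAdj_one {R : Type*} [CommRing R] : symplAdj (1 : Matrix Idx Idx R) = 1 := by
  rw [symplAdj, Matrix.transpose_one, mul_one, neg_mul, Matrix.J_squared, neg_neg]

theorem evalAt_C (B : Matrix Idx Idx ℂ) (c : ℂ) : evalAt B (C c) = c := (evalAt B).commutes c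

/-- Differentiate the equation `X * symplAdj X = 1`, valid on `H`, at the identity. -/
theorem symplAdj_eq_neg_of_mem_lieAlg {A : Matrix Idx Idx ℂ} (hA : A ∈ lieAlg H) :
    symplAdj A = -A := by
  have key : ∀ ℓ : Module.Dual ℂ (Matrix Idx Idx ℂ), ℓ (A + symplAdj A) = 0 := by
    intro ℓ
    have := mem_lieAlg_iff.1 hA (functionalPoly ℓ (genMat * symplAdj genMat) - C (ℓ 1)) (by
      intro g hg
      rw [map_sub, evalAt_functionalPoly, map_evalAt_mul, map_evalAt_symplAdj, map_evalAt_genMat,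
        ← cmat_inv, cmat_mul_inv, evalAt_C, sub_self])
    rwa [map_sub, show invField A (C (ℓ 1)) = 0 from (invField A).map_algebraMap _, sub_zero,
      derivation_functionalPoly, evalAt_functionalPoly, map_derivation_mul,
      map_derivation_symplAdj, map_invField_genMat, map_evalAt_add, map_evalAt_mul, map_evalAt_mul,
      map_evalAt_mul, map_evalAt_symplAdj, map_evalAt_symplAdj, map_evalAt_mul, map_evalAt_genMat,
      map_evalAt_constMat, symplAdj_one, one_mul, one_mul, mul_one] at this
  exact eq_neg_of_add_eq_zero_right
    ((Submodule.mem_bot ℂ).1 (mem_of_forall_dual fun ℓ _ => key ℓ))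

/-- If conjugation by `H` moves `Y` within the coset `Y + U`, then so does the Lie algebra. -/
theorem commutator_mem_of_conj_sub_mem {A : Matrix Idx Idx ℂ} (hA : A ∈ lieAlg H)
    {Y : Matrix Idx Idx ℂ} {U : Submodule ℂ (Matrix Idx Idx ℂ)}
    (h : ∀ g ∈ H, cmat g * Y * cmat g⁻¹ - Y ∈ U) : A * Y - Y * A ∈ U := by
  refine mem_of_forall_dual fun ℓ hℓ => ?_
  -- The polynomial `ℓ(X Y symplAdj X) - ℓ(Y)` vanishes on `H`, and its derivative at `1` along `A`
  -- is `ℓ(A * Y - Y * A)`.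
  have := mem_lieAlg_iff.1 hA
    (functionalPoly ℓ (genMat * constMat Y * symplAdj genMat) - C (ℓ Y)) (by
      intro g hg
      rw [map_sub, evalAt_functionalPoly, map_evalAt_mul, map_evalAt_mul, map_evalAt_symplAdj,
        map_evalAt_genMat, map_evalAt_constMat, ← cmat_inv, evalAt_C, ← map_sub]
      exact hℓ (h g hg))
  rwa [map_sub, show invField A (C (ℓ Y)) = 0 from (invField A).map_algebraMap _, sub_zero,
    derivation_functionalPoly, evalAt_functionalPoly, map_derivation_mul, map_derivation_mul,
    map_derivation_constMat, mul_zero, add_zero, map_derivation_symplAdj, map_invField_genMat,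
    map_evalAt_add, map_evalAt_mul, map_evalAt_mul, map_evalAt_mul, map_evalAt_mul,
    map_evalAt_mul, map_evalAt_symplAdj, map_evalAt_symplAdj, map_evalAt_mul, map_evalAt_genMat,
    map_evalAt_constMat, map_evalAt_constMat, symplAdj_one, one_mul, one_mul, mul_one,
    symplAdj_eq_neg_of_mem_lieAlg hA, mul_neg, ← sub_eq_add_neg] at this

/-- A linear equation satisfied by `H` is its own derivative at the identity, so it is satisfied by
the Lie algebra. -/
theorem mem_span_of_mem_lieAlg {A : Matrix Idx Idx ℂ} (hA : A ∈ lieAlg H) :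
    A ∈ Submodule.span ℂ (cmat '' (H : Set Sp4)) := by
  refine mem_of_forall_dual fun ℓ hℓ => ?_
  have := mem_lieAlg_iff.1 hA (functionalPoly ℓ genMat) (by
    intro g hg
    rw [evalAt_functionalPoly, map_evalAt_genMat]
    exact hℓ (Submodule.subset_span ⟨g, hg, rfl⟩))
  rwa [derivation_functionalPoly, evalAt_functionalPoly, map_invField_genMat, map_evalAt_mul,
    map_evalAt_genMat, map_evalAt_constMat, one_mul] at this

theorem evalAt_map_conj (B : Matrix Idx Idx ℂ) (F : PolyC) :
    evalAt (B.map (starRingEnd ℂ)) (MvPolynomial.map (starRingEnd ℂ) F) =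
      starRingEnd ℂ (evalAt B F) := by
  simp only [evalAt, MvPolynomial.aeval_def, MvPolynomial.eval₂_map, Algebra.algebraMap_self,
    RingHomCompTriple.comp_eq, Matrix.map_apply]
  rw [MvPolynomial.hom_eval₂]
  rfl

theorem invField_map_conj (A : Matrix Idx Idx ℂ) (F : PolyC) :
    invField (A.map (starRingEnd ℂ)) (MvPolynomial.map (starRingEnd ℂ) F) =
      MvPolynomial.map (starRingEnd ℂ) (invField A F) := by
  induction F using MvPolynomial.induction_on with
  | C a =>
    rw [MvPolynomial.map_C, show ∀ (B : Matrix Idx Idx ℂ) (c : ℂ), invField B (C c) = 0 from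
      fun B c => (invField B).map_algebraMap c, show invField A (C a) = 0 from
      (invField A).map_algebraMap a, map_zero]
  | add p q hp hq => simp only [map_add, hp, hq]
  | mul_X p ij hp =>
    have hX : invField (A.map (starRingEnd ℂ)) (X ij) =
        MvPolynomial.map (starRingEnd ℂ) (invField A (X ij)) := by
      simp [invField, constMat, genMat, Matrix.mul_apply]
    simp only [map_mul, Derivation.leibniz, smul_eq_mul, map_add, MvPolynomial.map_X, hX, hp]

theorem cmat_map_conj (g : Sp4) : (cmat g).map (starRingEnd ℂ) = cmat g := by
  ext i j
  simp [cmat]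

theorem map_conj_mem_vanIdeal {F : PolyC} (hF : F ∈ vanIdeal H) :
    MvPolynomial.map (starRingEnd ℂ) F ∈ vanIdeal H := by
  intro g hg
  rw [← cmat_map_conj, evalAt_map_conj, hF g hg, map_zero]

theorem map_conj_map_conj (F : PolyC) :
    MvPolynomial.map (starRingEnd ℂ) (MvPolynomial.map (starRingEnd ℂ) F) = F := by
  rw [MvPolynomial.map_map, show (starRingEnd ℂ).comp (starRingEnd ℂ) = RingHom.id ℂ from
    RingHom.ext fun z => Complex.conj_conj z, MvPolynomial.map_id]

/-- The points of `H` are real, so conjugating coefficients preserves the vanishing ideal. Hence the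
Lie algebra contains the real and imaginary parts of its elements. -/
theorem conj_entries_mem_lieAlg {A : Matrix Idx Idx ℂ} (hA : A ∈ lieAlg H) :
    A.map (starRingEnd ℂ) ∈ lieAlg H := by
  intro F hF
  rw [← map_conj_map_conj F, invField_map_conj]
  exact map_conj_mem_vanIdeal (hA _ (map_conj_mem_vanIdeal hF))

/-! ### One-parameter unipotent subgroups -/

/-- The exponential `exp (tA)` of a matrix with `A ^ (n + 1) = 0`, with entries polynomials
in `t`. -/
noncomputable def expPoly (A : Matrix Idx Idx ℂ) (n : ℕ) : Matrix Idx Idx (Polynomial ℂ) :=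
  Matrix.of fun i j => ∑ k ∈ Finset.range (n + 1),
    Polynomial.monomial k ((k.factorial : ℂ)⁻¹ * (A ^ k) i j)

theorem derivative_expPoly {A : Matrix Idx Idx ℂ} {n : ℕ} (hA : A ^ (n + 1) = 0) (i j : Idx) :
    Polynomial.derivative (expPoly A n i j) =
      ∑ l, expPoly A n i l * Polynomial.C (A l j) := by
  simp only [expPoly, Matrix.of_apply, Polynomial.derivative_sum, Polynomial.derivative_monomial,
    Finset.sum_mul, Polynomial.monomial_mul_C]
  rw [Finset.sum_comm]
  have hterm : ∀ k, ∑ l, Polynomial.monomial k ((k.factorial : ℂ)⁻¹ * (A ^ k) i l * A l j) =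
      Polynomial.monomial k ((k.factorial : ℂ)⁻¹ * (A ^ (k + 1)) i j) := by
    intro k
    rw [← map_sum, pow_succ, Matrix.mul_apply, Finset.mul_sum]
    simp only [mul_assoc]
  simp only [hterm]
  rw [Finset.sum_range_succ', Finset.sum_range_succ, hA]
  simp only [Matrix.zero_apply, mul_zero, map_zero, add_zero, Nat.cast_zero]
  refine Finset.sum_congr rfl fun k _ => ?_
  congr 1
  have : ((k + 1 : ℕ) : ℂ) ≠ 0 := Nat.cast_ne_zero.2 (Nat.succ_ne_zero k)
  rw [Nat.factorial_succ]
  push_cast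
  push_cast at this
  have hk : (k.factorial : ℂ) ≠ 0 := Nat.cast_ne_zero.2 (Nat.factorial_ne_zero k)
  field_simp

/-- Polynomials in `H`'s vanishing ideal vanish along nilpotent one-parameter subgroups tangent
to `H`. -/
theorem aeval_expPoly_eq_zero {A : Matrix Idx Idx ℂ} {n : ℕ} (hA : A ^ (n + 1) = 0)
    (hAH : A ∈ lieAlg H) {F : PolyC} (hF : F ∈ vanIdeal H) :
    aeval (fun ij => expPoly A n ij.1 ij.2) F = 0 := by
  set θ : PolyC →ₐ[ℂ] Polynomial ℂ := aeval (fun ij => expPoly A n ij.1 ij.2) with hθ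
  -- Restriction to the curve `exp (tA)` turns the invariant field of `A` into `d/dt`.
  have hder : ∀ G, Polynomial.derivative (θ G) = θ (invField A G) := by
    intro G
    induction G using MvPolynomial.induction_on with
    | C a =>
      rw [show (C a : PolyC) = algebraMap ℂ PolyC a from rfl, AlgHom.commutes,
        (invField A).map_algebraMap, map_zero]
      exact Polynomial.derivative_C
    | add p q hp hq => simp only [map_add, hp, hq]
    | mul_X p ij hp =>
      have hX : Polynomial.derivative (θ (X ij)) = θ (invField A (X ij)) := by
        rw [hθ, aeval_X, derivative_expPoly hA]
        simp [invField, constMat, genMat, Matrix.mul_apply]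
      simp only [map_mul, Derivation.leibniz, smul_eq_mul, map_add, Polynomial.derivative_mul, hX,
        hp]
      ring
  have hzero : ∀ G, (θ G).eval 0 = evalAt 1 G := by
    intro G
    have : ((Polynomial.aeval (0 : ℂ)).comp θ) = evalAt 1 := by
      ext ij
      simp only [hθ, AlgHom.comp_apply, aeval_X, evalAt, expPoly, Matrix.of_apply, map_sum]
      rw [Finset.sum_range_succ']
      simp [Polynomial.aeval_monomial]
    have h2 := DFunLike.congr_fun this G
    rwa [AlgHom.comp_apply, Polynomial.coe_aeval_eq_eval] at h2
  -- The field preserves the vanishing ideal, so every derivative of `θ G` is again a restriction of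
  -- an element of the ideal and vanishes at `t = 0`. In characteristic zero the polynomial `θ F` is
  -- therefore zero.
  have hiter : ∀ (k : ℕ) (G : PolyC), G ∈ vanIdeal H →
      (Polynomial.derivative^[k] (θ G)).eval 0 = 0 := by
    intro k
    induction k with
    | zero =>
      intro G hG
      rw [Function.iterate_zero_apply, hzero, ← map_one cmat]
      exact hG 1 H.one_mem
    | succ k ih =>
      intro G hG
      rw [Function.iterate_succ_apply, hder]
      exact ih _ (hAH G hG)
  ext k
  have := hiter k F hF
  rw [← Polynomial.coeff_zero_eq_eval_zero, Polynomial.coeff_iterate_derivative] at this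
  simpa [Nat.descFactorial_self, Nat.factorial_ne_zero] using this

theorem evalAt_exp_eq_zero {A : Matrix Idx Idx ℂ} {n : ℕ} (hA : A ^ (n + 1) = 0)
    (hAH : A ∈ lieAlg H) {F : PolyC} (hF : F ∈ vanIdeal H) :
    evalAt (∑ k ∈ Finset.range (n + 1), (k.factorial : ℂ)⁻¹ • A ^ k) F = 0 := by
  have : (Polynomial.aeval (1 : ℂ)).comp (aeval (fun ij => expPoly A n ij.1 ij.2)) =
      evalAt (∑ k ∈ Finset.range (n + 1), (k.factorial : ℂ)⁻¹ • A ^ k) := by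
    ext ij
    simp [evalAt, expPoly, Polynomial.eval_finsetSum, Matrix.sum_apply]
  rw [← this, AlgHom.comp_apply, aeval_expPoly_eq_zero hA hAH hF, map_zero]

/-! ### Replicas of tangent vectors are tangent -/

open Module.End

/-- By the Leibniz rule `D - (μ + ν)` sends `a * b` to `(D - μ) a * b + a * (D - ν) b`; enough
iterations exhaust one factor or the other. -/
theorem derivation_mul_mem_maxGenEigenspace (D : Derivation ℂ PolyC PolyC) {μ ν : ℂ} {a b : PolyC}
    (ha : a ∈ maxGenEigenspace (D : PolyC →ₗ[ℂ] PolyC) μ)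
    (hb : b ∈ maxGenEigenspace (D : PolyC →ₗ[ℂ] PolyC) ν) :
    a * b ∈ maxGenEigenspace (D : PolyC →ₗ[ℂ] PolyC) (μ + ν) := by
  let T : ℂ → Module.End ℂ PolyC := fun μ => (D : PolyC →ₗ[ℂ] PolyC) - μ • 1
  have hT : ∀ a b : PolyC, T (μ + ν) (a * b) = T μ a * b + a * T ν b := by
    intro a b
    simp only [T, LinearMap.sub_apply, LinearMap.smul_apply, Module.End.one_apply,
      Derivation.coeFn_coe, Derivation.leibniz, smul_eq_mul, MvPolynomial.smul_eq_C_mul, C_add]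
    ring
  have key : ∀ (m k l : ℕ) (a b : PolyC), k + l ≤ m → (T μ ^ k) a = 0 → (T ν ^ l) b = 0 →
      (T (μ + ν) ^ m) (a * b) = 0 := by
    intro m
    induction m with
    | zero =>
      intro k l a b hkl ha hb
      have hk : k = 0 := by omega
      subst hk
      have : a = 0 := by simpa using ha
      simp [this]
    | succ m ih =>
      intro k l a b hkl ha hb
      rw [pow_succ, Module.End.mul_apply, hT, map_add]
      have h1 : (T (μ + ν) ^ m) (T μ a * b) = 0 := by
        rcases k with _ | k
        · have : a = 0 := by simpa using ha
          simp [this]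
        · refine ih k l _ _ (by omega) ?_ hb
          rwa [pow_succ, Module.End.mul_apply] at ha
      have h2 : (T (μ + ν) ^ m) (a * T ν b) = 0 := by
        rcases l with _ | l
        · have : b = 0 := by simpa using hb
          simp [this]
        · refine ih k l _ _ (by omega) ha ?_
          rwa [pow_succ, Module.End.mul_apply] at hb
      rw [h1, h2, add_zero]
  obtain ⟨k, hk⟩ := (mem_maxGenEigenspace _ _ _).1 ha
  obtain ⟨l, hl⟩ := (mem_maxGenEigenspace _ _ _).1 hb
  exact (mem_maxGenEigenspace _ _ _).2 ⟨k + l, key (k + l) k l a b le_rfl hk hl⟩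

/-- The `i`-th row of the generic matrix, paired with a vector. -/
noncomputable def rowForm (i : Idx) : (Idx → ℂ) →ₗ[ℂ] PolyC :=
  ∑ j, (LinearMap.toSpanSingleton ℂ PolyC (X (i, j))) ∘ₗ LinearMap.proj j

theorem rowForm_apply (i : Idx) (w : Idx → ℂ) : rowForm i w = ∑ j, w j • (X (i, j) : PolyC) := by
  simp [rowForm]

theorem invField_rowForm (A : Matrix Idx Idx ℂ) (i : Idx) (w : Idx → ℂ) :
    invField A (rowForm i w) = rowForm i (A.mulVec w) := by
  simp only [rowForm_apply, map_sum, Derivation.map_smul, invField, mkDerivation_X,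
    Matrix.mul_apply, genMat, constMat, Matrix.of_apply, Matrix.map_apply, Matrix.mulVec,
    dotProduct, Finset.smul_sum, Finset.sum_smul]
  rw [Finset.sum_comm]
  refine Finset.sum_congr rfl fun k _ => Finset.sum_congr rfl fun l _ => ?_
  rw [MvPolynomial.smul_eq_C_mul, MvPolynomial.smul_eq_C_mul, C_mul]
  ring

/-- The joint pieces are multiplicative, `G μ * G ν ⊆ G (μ + ν)`, because conjugation is additive.
They contain the constants, and they span the linear forms because `A` acts on each row of the
generic matrix; hence they span all polynomials. -/
theorem IsConjReplica.invField {A A' : Matrix Idx Idx ℂ}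
    (h : IsConjReplica (Matrix.toLin' A) (Matrix.toLin' A')) :
    (⨆ ν, maxGenEigenspace (SpFour.invField A : PolyC →ₗ[ℂ] PolyC) ν ⊓
      LinearMap.ker ((SpFour.invField A' : PolyC →ₗ[ℂ] PolyC) - (starRingEnd ℂ ν) • 1)) = ⊤ := by
  set G : ℂ → Submodule ℂ PolyC :=
    fun ν => maxGenEigenspace (SpFour.invField A : PolyC →ₗ[ℂ] PolyC) ν ⊓
      LinearMap.ker ((SpFour.invField A' : PolyC →ₗ[ℂ] PolyC) - (starRingEnd ℂ ν) • 1) with hG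
  have hker : ∀ ν F, F ∈ LinearMap.ker ((SpFour.invField A' : PolyC →ₗ[ℂ] PolyC) -
      (starRingEnd ℂ ν) • 1) ↔ SpFour.invField A' F = (starRingEnd ℂ ν) • F := by
    intro ν F
    simp [sub_eq_zero]
  have hmul : ∀ {μ ν : ℂ} {a b : PolyC}, a ∈ G μ → b ∈ G ν → a * b ∈ G (μ + ν) := by
    rintro μ ν a b ⟨ha, ha'⟩ ⟨hb, hb'⟩
    refine ⟨derivation_mul_mem_maxGenEigenspace _ ha hb, ?_⟩
    rw [SetLike.mem_coe, hker] at ha' hb' ⊢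
    rw [Derivation.leibniz, ha', hb', map_add, add_smul, smul_eq_mul, smul_eq_mul,
      mul_smul_comm, mul_smul_comm, mul_comm b a, add_comm]
  have hone : ∀ c : ℂ, (C c : PolyC) ∈ G 0 := by
    intro c
    refine ⟨(mem_maxGenEigenspace _ _ _).2 ⟨1, ?_⟩, ?_⟩
    · simp only [zero_smul, sub_zero, pow_one]
      exact (SpFour.invField A).map_algebraMap c
    · rw [SetLike.mem_coe, hker, map_zero, zero_smul]
      exact (SpFour.invField A').map_algebraMap c
  have hrow : ∀ (i : Idx) (w : Idx → ℂ), rowForm i w ∈ ⨆ ν, G ν := by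
    intro i w
    have hle : ⨆ ν, maxGenEigenspace (Matrix.toLin' A) ν ≤
        (⨆ ν, G ν).comap (rowForm i) := by
      refine iSup_le fun ν w hw => ?_
      refine Submodule.mem_iSup_of_mem ν ⟨?_, ?_⟩
      · obtain ⟨k, hk⟩ := (mem_maxGenEigenspace _ _ _).1 hw
        refine (mem_maxGenEigenspace _ _ _).2 ⟨k, ?_⟩
        have hpow : ∀ (k : ℕ) (w : Idx → ℂ),
            (((SpFour.invField A : PolyC →ₗ[ℂ] PolyC) - ν • (1 : Module.End ℂ PolyC)) ^ k)
              (rowForm i w) = rowForm i (((Matrix.toLin' A - ν • 1) ^ k) w) := by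
          intro k
          induction k with
          | zero => intro w; simp
          | succ k ih =>
            intro w
            rw [pow_succ, pow_succ, Module.End.mul_apply, Module.End.mul_apply, ← ih]
            congr 1
            simp only [LinearMap.sub_apply, LinearMap.smul_apply, Module.End.one_apply,
              Derivation.coeFn_coe, map_sub, map_smul, Matrix.toLin'_apply, invField_rowForm]
        rw [hpow, hk, map_zero]
      · rw [SetLike.mem_coe, hker, invField_rowForm, ← map_smul]
        congr 1
        exact h ν w hw
    rw [iSup_maxGenEigenspace_eq_top] at hle
    exact hle Submodule.mem_top
  rw [eq_top_iff]
  rintro F -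
  induction F using MvPolynomial.induction_on with
  | C a => exact Submodule.mem_iSup_of_mem 0 (hone a)
  | add p q hp hq => exact add_mem hp hq
  | mul_X p ij hp =>
    have hX : (X ij : PolyC) ∈ ⨆ ν, G ν := by
      have := hrow ij.1 (Pi.single ij.2 1)
      rw [rowForm_apply] at this
      simpa [Pi.single_apply] using this
    refine Submodule.iSup_induction G (motive := fun p => p * X ij ∈ ⨆ ν, G ν) hp ?_ ?_ ?_
    · intro μ a ha
      refine Submodule.iSup_induction G (motive := fun b => a * b ∈ ⨆ ν, G ν) hX ?_ ?_ ?_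
      · intro ν b hb
        exact Submodule.mem_iSup_of_mem _ (hmul ha hb)
      · simp
      · intro b c hb hc
        rw [mul_add]
        exact add_mem hb hc
    · simp
    · intro a b ha hb
      rw [add_mul]
      exact add_mem ha hb

/-- Chevalley's observation: the vanishing ideal is stable under the field of `A`, and stable
subspaces are inherited by replicas. -/
theorem replica_mem_lieAlg {A A' : Matrix Idx Idx ℂ}
    (h : IsConjReplica (Matrix.toLin' A) (Matrix.toLin' A')) (hA : A ∈ lieAlg H) :
    A' ∈ lieAlg H := by
  have htop := h.invField
  have hrep := IsConjReplica.of_iSup_eq_top htop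
  have htop' : ⨆ ν, maxGenEigenspace (invField A : PolyC →ₗ[ℂ] PolyC) ν = ⊤ := by
    rw [eq_top_iff, ← htop]
    exact iSup_mono fun ν => inf_le_left
  intro F hF
  exact hrep.apply_mem htop' (p := (vanIdeal H).restrictScalars ℂ) (fun F hF => hA F hF) F hF

end SpFour

/-! ### Polynomials constant along the Lie algebra take finitely many values on the group. -/

namespace SpFour

open scoped IntermediateField.algebraAdjoinAdjoin TensorProduct in
/-- In characteristic zero, a transcendental element is not killed by all derivations. -/
theorem exists_derivation_apply_ne_zero {K L : Type*} [Field K] [CharZero K] [Field L]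
    [Algebra K L] {f : L} (hf : Transcendental K f) : ∃ δ : Derivation K L L, δ f ≠ 0 := by
  classical
  have hind : AlgebraicIndepOn K id ({f} : Set L) :=
    (algebraicIndependent_unique_type_iff (ι := ({f} : Set L))).2 (by
      simpa [Set.default_coe_singleton] using hf)
  -- Put `f` into a transcendence basis and differentiate with respect to it. `L` is formally étale
  -- over the polynomial ring `S`: a localization followed by a separable algebraic extension.
  obtain ⟨t, hft, ht⟩ := exists_isTranscendenceBasis_superset hind
  have hfmem : f ∈ t := hft rfl
  let v : t → L := fun x => x
  let S := Algebra.adjoin K (Set.range v)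
  let E := IntermediateField.adjoin K (Set.range v)
  have h1 : Algebra.FormallyEtale S E := .of_isLocalization (nonZeroDivisors _)
  have halg : Algebra.IsAlgebraic E L := ht.isAlgebraic_field
  have : CharZero E := charZero_of_injective_algebraMap (algebraMap K E).injective
  have hsep : Algebra.IsSeparable E L := inferInstance
  have h2 : Algebra.FormallyEtale E L := Algebra.FormallyEtale.of_isSeparable _ L
  have h3 : Algebra.FormallyEtale S L := .comp _ E _
  let e : MvPolynomial t K ≃ₐ[K] S := ht.1.aevalEquiv
  let i : t := ⟨f, hfmem⟩
  let d : Derivation K S L := Derivation.mk'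
    ((Algebra.linearMap S L).restrictScalars K ∘ₗ e.toLinearMap ∘ₗ
      (MvPolynomial.pderiv (R := K) i : MvPolynomial t K →ₗ[K] MvPolynomial t K) ∘ₗ
      e.symm.toLinearMap) (by
    intro a b
    simp only [LinearMap.comp_apply, AlgEquiv.toLinearMap_apply, LinearMap.restrictScalars_apply,
      Algebra.linearMap_apply, Derivation.coeFn_coe, map_mul, Derivation.leibniz, smul_eq_mul,
      map_add, AlgEquiv.apply_symm_apply, Algebra.smul_def])
  -- Formal étaleness gives `L ⊗ Ω[S⁄K] ≃ Ω[L⁄K]`, through which the derivation `d` extends to `L`.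
  let ψ : L ⊗[S] Ω[S⁄K] →ₗ[L] L := d.liftKaehlerDifferential.liftBaseChange L
  let eK := KaehlerDifferential.tensorKaehlerEquivOfFormallyEtale K S L
  let δ : Derivation K L L := (ψ ∘ₗ eK.symm.toLinearMap).compDer (KaehlerDifferential.D K L)
  refine ⟨δ, ?_⟩
  have hδ : ∀ s : S, δ (algebraMap S L s) = d s := by
    intro s
    change ψ (eK.symm (KaehlerDifferential.D K L (algebraMap S L s))) = d s
    rw [KaehlerDifferential.tensorKaehlerEquivOfFormallyEtale_symm_D_algebraMap]
    simp [ψ]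
  have hX : algebraMap S L (e (MvPolynomial.X i)) = f := by
    rw [AlgebraicIndependent.algebraMap_aevalEquiv, MvPolynomial.aeval_X]
  rw [← hX, hδ]
  change algebraMap S L (e (MvPolynomial.pderiv i (e.symm (e (MvPolynomial.X i))))) ≠ 0
  rw [AlgEquiv.symm_apply_apply, MvPolynomial.pderiv_X_self, map_one, map_one]
  exact one_ne_zero

open MvPolynomial

variable {H : Subgroup Sp4}

theorem vanIdeal_isRadical : (vanIdeal H).IsRadical := by
  rintro F ⟨n, hn⟩ g hg
  have := hn g hg
  rw [map_pow] at this
  exact eq_zero_of_pow_eq_zero this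

/-- The value of `D F` at a point depends only on the values of `D` on the coordinates there. -/
theorem evalAt_derivation_congr {D D' : Derivation ℂ PolyC PolyC} {B : Matrix Idx Idx ℂ}
    (h : ∀ ij, evalAt B (D (X ij)) = evalAt B (D' (X ij))) (F : PolyC) :
    evalAt B (D F) = evalAt B (D' F) := by
  induction F using MvPolynomial.induction_on with
  | C a => rw [show D (C a) = 0 from D.map_algebraMap a, show D' (C a) = 0 from D'.map_algebraMap a]
  | add p q hp hq => simp only [map_add, hp, hq]
  | mul_X p ij hp => simp only [Derivation.leibniz, smul_eq_mul, map_add, map_mul, hp, h]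

/-- A vector field that kills the vanishing ideal of `H` at a point of `H` is there given by an
element of the Lie algebra. -/
theorem mem_lieAlg_of_tangent {g : Sp4} (hg : g ∈ H) {D : Derivation ℂ PolyC PolyC}
    (hD : ∀ F ∈ vanIdeal H, evalAt (cmat g) (D F) = 0) :
    ∃ A ∈ lieAlg H, ∀ F, evalAt (cmat g) (invField A F) = evalAt (cmat g) (D F) := by
  let v : Matrix Idx Idx ℂ := Matrix.of fun i j => evalAt (cmat g) (D (X (i, j)))
  have hA : ∀ F, evalAt (cmat g) (invField (cmat g⁻¹ * v) F) = evalAt (cmat g) (D F) := by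
    intro F
    refine evalAt_derivation_congr (fun ij => ?_) F
    rw [invField, mkDerivation_X]
    change ((genMat * constMat (cmat g⁻¹ * v)).map (evalAt (cmat g))) ij.1 ij.2 = _
    rw [map_evalAt_mul, map_evalAt_genMat, map_evalAt_constMat, ← mul_assoc, cmat_mul_inv, one_mul]
    rfl
  refine ⟨cmat g⁻¹ * v, mem_lieAlg_iff.2 fun F hF => ?_, hA⟩
  have h1 : evalAt 1 (invField (cmat g⁻¹ * v) F) = evalAt (cmat g)
      (invField (cmat g⁻¹ * v) (substMat (constMat (cmat g⁻¹) * genMat) F)) := by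
    rw [invField_substMat_left, evalAt_substMat, map_evalAt_mul, map_evalAt_genMat,
      map_evalAt_constMat, cmat_inv_mul]
  rw [h1, hA]
  exact hD _ (substMat_left_mem_vanIdeal (H.inv_mem hg) hF)

/-- A polynomial that is locally constant on `H` is algebraic modulo each minimal prime of the
vanishing ideal. -/
theorem exists_aeval_mem_minimalPrime {f : PolyC}
    (hf : ∀ A ∈ lieAlg H, invField A f ∈ vanIdeal H) {P : Ideal PolyC}
    (hP : P ∈ (vanIdeal H).minimalPrimes) :
    ∃ p : Polynomial ℂ, p ≠ 0 ∧ Polynomial.aeval f p ∈ P := by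
  classical
  have hprime : P.IsPrime := hP.1.1
  by_contra! hcon
  let R := PolyC ⧸ P
  let L := FractionRing R
  let q : PolyC →ₐ[ℂ] L := (IsScalarTower.toAlgHom ℂ R L).comp (Ideal.Quotient.mkₐ ℂ P)
  have hq0 : ∀ F, q F = 0 ↔ F ∈ P := by
    intro F
    change algebraMap R L (Ideal.Quotient.mk P F) = 0 ↔ _
    rw [← Ideal.Quotient.eq_zero_iff_mem]
    exact map_eq_zero_iff _ (IsFractionRing.injective R L)
  have htr : Transcendental ℂ (q f) := by
    rw [transcendental_iff]
    intro p hp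
    by_contra hne
    refine hcon p hne ((hq0 _).1 ?_)
    rw [← Polynomial.aeval_algHom_apply, hp]
  -- If `f` is transcendental modulo `P`, some derivation of the function field moves it. Clearing
  -- denominators by `b` lifts it to a polynomial vector field `D` preserving `P` with `D f ∉ P`.
  obtain ⟨δ, hδ⟩ := exists_derivation_apply_ne_zero htr
  obtain ⟨b, hb⟩ := IsLocalization.exist_integer_multiples_of_finite (nonZeroDivisors R)
    (fun ij : Idx × Idx => δ (q (X ij)))
  choose r hr using hb
  choose d hd using fun ij => Ideal.Quotient.mk_surjective (r ij)
  let D : Derivation ℂ PolyC PolyC := mkDerivation ℂ d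
  have hb0 : algebraMap R L b ≠ 0 := by
    rw [Ne, map_eq_zero_iff _ (IsFractionRing.injective R L)]
    exact nonZeroDivisors.ne_zero b.2
  have hD : ∀ F, q (D F) = algebraMap R L b * δ (q F) := by
    intro F
    induction F using MvPolynomial.induction_on with
    | C a =>
      rw [show D (C a) = 0 from D.map_algebraMap a, map_zero,
        show q (C a) = algebraMap ℂ L a from q.commutes a, δ.map_algebraMap, mul_zero]
    | add p p' hp hp' => simp only [map_add, hp, hp', mul_add]
    | mul_X p ij hp =>
      have hX : q (D (X ij)) = algebraMap R L b * δ (q (X ij)) := by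
        rw [← Algebra.smul_def]
        refine Eq.trans ?_ (hr ij)
        simp only [D, mkDerivation_X]
        change algebraMap R L (Ideal.Quotient.mk P (d ij)) = _
        rw [hd]
      simp only [Derivation.leibniz, smul_eq_mul, map_add, map_mul, hp, hX]
      ring
  have hDP : ∀ F ∈ P, D F ∈ P := by
    intro F hF
    rw [← hq0, hD, (hq0 F).2 hF, map_zero, mul_zero]
  have hDf : D f ∉ P := by
    rw [← hq0, hD]
    exact mul_ne_zero hb0 hδ
  have hfin : (vanIdeal H).minimalPrimes.Finite :=
    (vanIdeal H).finite_minimalPrimes_of_isNoetherianRing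
  have hmemI : ∀ F, (∀ Q ∈ (vanIdeal H).minimalPrimes, F ∈ Q) → F ∈ vanIdeal H := by
    intro F hF
    rw [← vanIdeal_isRadical.radical, ← Ideal.sInf_minimalPrimes]
    exact (Submodule.mem_sInf).2 hF
  -- The factor `e` cuts off the other components: `e * D F` lies in every minimal prime when `F` is
  -- in the vanishing ideal, while `e` is nonzero modulo `P`.
  obtain ⟨e, heP, he⟩ : ∃ e, e ∉ P ∧ ∀ Q ∈ (vanIdeal H).minimalPrimes, Q ≠ P → e ∈ Q := by
    by_contra! hno
    have hle : (hfin.toFinset.erase P).inf id ≤ P := by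
      intro e he
      by_contra heP
      obtain ⟨Q, hQ, hQP, heQ⟩ := hno e heP
      refine heQ ?_
      have : (hfin.toFinset.erase P).inf id ≤ Q :=
        Finset.inf_le (f := id) (Finset.mem_erase.2 ⟨hQP, hfin.mem_toFinset.2 hQ⟩)
      exact this he
    obtain ⟨Q, hQ, hQP⟩ := (Ideal.IsPrime.inf_le' hprime).1 hle
    rw [Finset.mem_erase, hfin.mem_toFinset] at hQ
    exact hQ.1 (le_antisymm hQP (hP.2 hQ.2.1 hQP))
  have hne : e * D f ∉ vanIdeal H := fun h => by
    rcases hprime.mem_or_mem (hP.1.2 h) with h | h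
    · exact heP h
    · exact hDf h
  rw [mem_vanIdeal] at hne
  push Not at hne
  obtain ⟨g, hg, hgne⟩ := hne
  rw [map_mul] at hgne
  -- At a point `g` where `e * D f` does not vanish, `D` is tangent to `H`, hence given by some `A`
  -- in the Lie algebra. Then the derivative of `f` along `A` is nonzero at `g`, a contradiction.
  obtain ⟨A, hA, hAD⟩ := mem_lieAlg_of_tangent hg (D := D) (by
    intro F hF
    have : e * D F ∈ vanIdeal H := by
      refine hmemI _ fun Q hQ => ?_
      by_cases hQP : Q = P
      · rw [hQP]
        exact P.mul_mem_left _ (hDP F (hP.1.2 hF))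
      · exact Q.mul_mem_right _ (he Q hQ hQP)
    have := this g hg
    rw [map_mul] at this
    exact (mul_eq_zero.1 this).resolve_left (left_ne_zero_of_mul hgne))
  exact right_ne_zero_of_mul hgne ((hAD f).symm.trans (hf A hA g hg))

/-- A polynomial that is constant along the Lie algebra takes only finitely many values. -/
theorem finite_image_of_invField_mem {f : PolyC}
    (hf : ∀ A ∈ lieAlg H, invField A f ∈ vanIdeal H) :
    ((fun g => evalAt (cmat g) f) '' (H : Set Sp4)).Finite := by
  classical
  have hfin : (vanIdeal H).minimalPrimes.Finite :=
    (vanIdeal H).finite_minimalPrimes_of_isNoetherianRing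
  choose! p hp hpP using fun P hP => exists_aeval_mem_minimalPrime hf (P := P) hP
  -- One annihilating polynomial per minimal prime; the value of their product at `f` lies in every
  -- minimal prime, so on `H` the values of `f` are roots of `r`.
  let r := ∏ P ∈ hfin.toFinset, p P
  have hr : r ≠ 0 := Finset.prod_ne_zero_iff.2 fun P hP => hp P (hfin.mem_toFinset.1 hP)
  have hrI : Polynomial.aeval f r ∈ vanIdeal H := by
    rw [← vanIdeal_isRadical.radical, ← Ideal.sInf_minimalPrimes]
    refine (Submodule.mem_sInf).2 fun P hP => ?_
    simp only [r, map_prod]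
    rw [← Finset.mul_prod_erase _ _ (hfin.mem_toFinset.2 hP)]
    exact Ideal.mul_mem_right _ P (hpP P hP)
  refine (r.rootSet_finite ℂ).subset ?_
  rintro _ ⟨g, hg, rfl⟩
  rw [Polynomial.mem_rootSet]
  refine ⟨hr, ?_⟩
  rw [Polynomial.aeval_algHom_apply]
  exact hrI g hg

end SpFour

/-! ### Reductivity converted into a Cartan criterion for the Lie algebra. -/

namespace SpFour

/-! ### Zariski closed unipotent groups are connected -/

theorem mem_symplecticGroup_iff_mul_symplAdj {R : Type*} [CommRing R] {A : Matrix Idx Idx R} :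
    A ∈ Matrix.symplecticGroup (Fin 2) R ↔ A * symplAdj A = 1 := by
  have hJ : Matrix.J (Fin 2) R * Matrix.J (Fin 2) R = -1 := Matrix.J_squared _ _
  rw [SymplecticGroup.mem_iff, symplAdj]
  have h1 : A * (-Matrix.J (Fin 2) R * A.transpose * Matrix.J (Fin 2) R) =
      -(A * Matrix.J (Fin 2) R * A.transpose * Matrix.J (Fin 2) R) := by
    simp only [neg_mul, mul_neg, mul_assoc]
  rw [h1]
  constructor
  · intro h
    rw [h, hJ, neg_neg]
  · intro h
    have h2 := congrArg (· * Matrix.J (Fin 2) R) h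
    simp only [neg_mul, one_mul] at h2
    rwa [mul_assoc, hJ, mul_neg, mul_one, neg_neg] at h2

theorem polynomial_eq_zero_of_eval_nat {P : Polynomial ℝ} (h : ∀ k : ℕ, P.eval (k : ℝ) = 0) :
    P = 0 := by
  refine Polynomial.eq_zero_of_infinite_isRoot P ?_
  refine Set.Infinite.mono (s := Set.range (fun k : ℕ => (k : ℝ))) ?_
    (Set.infinite_range_of_injective Nat.cast_injective)
  rintro _ ⟨k, rfl⟩
  exact h k

/-- The powers of a unipotent element are interpolated by a polynomial one-parameter family. -/
theorem exists_unipotent_path (n : Sp4) (hn : IsNilpotent ((n : Matrix Idx Idx ℝ) - 1)) :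
    ∃ γ : ℝ → Sp4, (∀ k : ℕ, γ k = n ^ k) ∧ ∀ p : MvPolynomial (Idx × Idx) ℝ,
      ∃ P : Polynomial ℝ, ∀ t, P.eval t = MvPolynomial.aeval (coords (γ t)) p := by
  obtain ⟨m, hm⟩ := hn
  set u := (n : Matrix Idx Idx ℝ) - 1 with hu
  -- The binomial series `(1 + u) ^ t = ∑ (t choose l) u ^ l`, finite since `u ^ m = 0`. Its entries
  -- are polynomials in `t`, so identities valid for natural exponents hold for all real `t`.
  let Γ : Matrix Idx Idx (Polynomial ℝ) := Matrix.of fun i j => ∑ k ∈ Finset.range m,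
    Polynomial.C ((k.factorial : ℝ)⁻¹ * (u ^ k) i j) * descPochhammer ℝ k
  let ev : ℝ → Matrix Idx Idx ℝ := fun t => Γ.map (Polynomial.evalRingHom t)
  have hev : ∀ k : ℕ, ev k = (n : Matrix Idx Idx ℝ) ^ k := by
    intro k
    have h1 : ev k = ∑ l ∈ Finset.range m, (k.choose l : ℝ) • u ^ l := by
      ext i j
      simp only [ev, Γ, Matrix.map_apply, Matrix.of_apply, Polynomial.coe_evalRingHom,
        Polynomial.eval_finsetSum, Polynomial.eval_mul, Polynomial.eval_C, Matrix.sum_apply,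
        Matrix.smul_apply, smul_eq_mul]
      refine Finset.sum_congr rfl fun l _ => ?_
      rw [descPochhammer_eval_eq_descFactorial, Nat.descFactorial_eq_factorial_mul_choose]
      have hl : (l.factorial : ℝ) ≠ 0 := Nat.cast_ne_zero.2 (Nat.factorial_ne_zero l)
      push_cast
      field_simp
    have h2 : (n : Matrix Idx Idx ℝ) ^ k =
        ∑ l ∈ Finset.range (k + 1), (k.choose l : ℝ) • u ^ l := by
      have : (n : Matrix Idx Idx ℝ) = u + 1 := by rw [hu, sub_add_cancel]
      rw [this, (Commute.one_right u).add_pow]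
      refine Finset.sum_congr rfl fun l _ => ?_
      rw [one_pow, mul_one, ← nsmul_eq_mul', ← Nat.cast_smul_eq_nsmul ℝ]
    rw [h1, h2]
    have h3 : ∀ a, m ≤ a → ∑ l ∈ Finset.range m, (k.choose l : ℝ) • u ^ l =
        ∑ l ∈ Finset.range a, (k.choose l : ℝ) • u ^ l := by
      intro a ha
      refine Finset.sum_subset (Finset.range_mono ha) fun l _ hl => ?_
      rw [pow_eq_zero_of_le (by simpa using hl) hm, smul_zero]
    have h4 : ∀ a, k + 1 ≤ a → ∑ l ∈ Finset.range (k + 1), (k.choose l : ℝ) • u ^ l =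
        ∑ l ∈ Finset.range a, (k.choose l : ℝ) • u ^ l := by
      intro a ha
      refine Finset.sum_subset (Finset.range_mono ha) fun l _ hl => ?_
      rw [Nat.choose_eq_zero_of_lt (by simpa using hl), Nat.cast_zero, zero_smul]
    rw [h3 (max m (k + 1)) (le_max_left _ _), h4 (max m (k + 1)) (le_max_right _ _)]
  have hΓ : Γ * symplAdj Γ = 1 := by
    ext1 i j
    rw [← sub_eq_zero]
    refine polynomial_eq_zero_of_eval_nat fun k => ?_
    have hk : ev k * symplAdj (ev k) = 1 := by
      rw [hev, ← SubmonoidClass.coe_pow]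
      exact mem_symplecticGroup_iff_mul_symplAdj.1 (n ^ k).2
    have h5 : (Γ * symplAdj Γ).map (Polynomial.evalRingHom (k : ℝ)) = 1 := by
      rw [map_mul_matrix, symplAdj_map]
      exact hk
    have h6 := congrFun (congrFun h5 i) j
    rw [Matrix.map_apply, Polynomial.coe_evalRingHom] at h6
    rw [Polynomial.eval_sub, h6, Matrix.one_apply, Matrix.one_apply]
    split_ifs <;> simp
  have hmem : ∀ t, ev t ∈ Matrix.symplecticGroup (Fin 2) ℝ := by
    intro t
    rw [mem_symplecticGroup_iff_mul_symplAdj, ← symplAdj_map, ← map_mul_matrix, hΓ]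
    exact Matrix.map_one _ (map_zero _) (map_one _)
  refine ⟨fun t => ⟨ev t, hmem t⟩, fun k => Subtype.ext (hev k), fun p => ?_⟩
  refine ⟨MvPolynomial.aeval (fun ij => Γ ij.1 ij.2) p, fun t => ?_⟩
  have : (Polynomial.aeval t).comp (MvPolynomial.aeval (fun ij : Idx × Idx => Γ ij.1 ij.2)) =
      MvPolynomial.aeval (R := ℝ) (coords ⟨ev t, hmem t⟩) := by
    ext ij
    simp [coords, ev, Polynomial.coe_aeval_eq_eval]
  have h7 := DFunLike.congr_fun this p
  rwa [AlgHom.comp_apply, Polynomial.coe_aeval_eq_eval] at h7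

theorem zariskiClosure_mono {S T : Set Sp4} (h : S ⊆ T) : zariskiClosure S ⊆ zariskiClosure T :=
  fun _ hg => mem_zariskiClosure.2 fun p hp => mem_zariskiClosure.1 hg p fun s hs => hp s (h hs)

theorem zariskiClosure_zariskiClosure (S : Set Sp4) :
    zariskiClosure (zariskiClosure S) ⊆ zariskiClosure S :=
  fun _ hg => mem_zariskiClosure.2 fun p hp => mem_zariskiClosure.1 hg p fun _ hs =>
    mem_zariskiClosure.1 hs p hp

theorem isZariskiClosed_of_zariskiClosure_subset {S : Set Sp4} (h : zariskiClosure S ⊆ S) :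
    IsZariskiClosed S :=
  ⟨_, Set.Subset.antisymm (subset_zariskiClosure S) h⟩

/-- Each element of `N` is joined to `1` by a polynomial curve inside `N`. If `1` is off one closed
piece, some equation of that piece is not identically zero on the curve; as `ℝ[t]` is a domain, the
equations of the other piece vanish all along it. -/
theorem isZariskiConnected_of_isUnipotent {N : Subgroup Sp4}
    (hN : zariskiClosure (N : Set Sp4) ⊆ N) (hu : IsUnipotent N) :
    IsZariskiConnected (N : Set Sp4) := by
  refine ⟨⟨1, N.one_mem⟩, ?_⟩
  rintro A B ⟨I, rfl⟩ ⟨J, rfl⟩ hAB hdisj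
  have key : ∀ n ∈ N, ∃ γ : ℝ → Sp4, γ 0 = 1 ∧ γ 1 = n ∧ (∀ t, γ t ∈ N) ∧
      ∀ p : MvPolynomial (Idx × Idx) ℝ,
      ∃ P : Polynomial ℝ, ∀ t, P.eval t = MvPolynomial.aeval (coords (γ t)) p := by
    intro n hn
    obtain ⟨γ, hγ, hP⟩ := exists_unipotent_path n (hu n hn)
    refine ⟨γ, by simpa using hγ 0, by simpa using hγ 1, fun t => hN ?_, hP⟩
    refine mem_zariskiClosure.2 fun p hp => ?_
    obtain ⟨P, hP⟩ := hP p
    have : P = 0 := polynomial_eq_zero_of_eval_nat fun k => by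
      rw [hP, hγ]
      exact hp _ (N.pow_mem hn k)
    rw [← hP, this, Polynomial.eval_zero]
  have half : ∀ I J : Ideal (MvPolynomial (Idx × Idx) ℝ),
      (N : Set Sp4) ⊆ coords ⁻¹' MvPolynomial.zeroLocus ℝ I ∪
        coords ⁻¹' MvPolynomial.zeroLocus ℝ J →
      (1 : Sp4) ∉ coords ⁻¹' MvPolynomial.zeroLocus ℝ J →
      (N : Set Sp4) ⊆ coords ⁻¹' MvPolynomial.zeroLocus ℝ I := by
    intro I J hIJ h1 n hn
    obtain ⟨γ, h0, hγ1, hγ, hP⟩ := key n hn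
    rw [Set.mem_preimage, MvPolynomial.mem_zeroLocus_iff] at h1
    push Not at h1
    obtain ⟨p, hp, hp1⟩ := h1
    obtain ⟨P, hP'⟩ := hP p
    have hP0 : P ≠ 0 := by
      rintro rfl
      have := hP' 0
      rw [h0, Polynomial.eval_zero] at this
      exact hp1 this.symm
    rw [Set.mem_preimage, MvPolynomial.mem_zeroLocus_iff]
    intro q hq
    obtain ⟨Q, hQ⟩ := hP q
    have hQP : P * Q = 0 := by
      refine Polynomial.funext fun t => ?_
      rw [Polynomial.eval_mul, Polynomial.eval_zero, hP', hQ]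
      rcases hIJ (hγ t) with h | h
      · rw [Set.mem_preimage, MvPolynomial.mem_zeroLocus_iff] at h
        rw [h q hq, mul_zero]
      · rw [Set.mem_preimage, MvPolynomial.mem_zeroLocus_iff] at h
        rw [h p hp, zero_mul]
    have hQ0 : Q = 0 := (mul_eq_zero.1 hQP).resolve_left hP0
    rw [← hγ1, ← hQ, hQ0, Polynomial.eval_zero]
  by_cases h1 : (1 : Sp4) ∈ coords ⁻¹' MvPolynomial.zeroLocus ℝ J
  · right
    refine half J I (by rwa [Set.union_comm]) fun h2 => ?_
    have : (1 : Sp4) ∈ (N : Set Sp4) ∩ (coords ⁻¹' MvPolynomial.zeroLocus ℝ I ∩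
      coords ⁻¹' MvPolynomial.zeroLocus ℝ J) := ⟨N.one_mem, h2, h1⟩
    rw [hdisj] at this
    exact this
  · exact Or.inl (half I J hAB h1)

/-! ### The unipotent radical cut out by the trace form -/

variable {H : Subgroup Sp4}

/-- The elements `g` of `H` such that `g - 1` is orthogonal to `H` for the trace form. -/
def traceKernel (H : Subgroup Sp4) : Subgroup Sp4 where
  carrier := {g | g ∈ H ∧ ∀ b ∈ H, ((g : Matrix Idx Idx ℝ) * (b : Matrix Idx Idx ℝ)).trace =
    (b : Matrix Idx Idx ℝ).trace}
  mul_mem' := by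
    rintro a b ⟨ha, ha'⟩ ⟨hb, hb'⟩
    refine ⟨H.mul_mem ha hb, fun c hc => ?_⟩
    have := ha' (b * c) (H.mul_mem hb hc)
    rw [Submonoid.coe_mul] at this ⊢
    rw [mul_assoc, this, hb' c hc]
  one_mem' := ⟨H.one_mem, fun b _ => by rw [Submonoid.coe_one, one_mul]⟩
  inv_mem' := by
    rintro a ⟨ha, ha'⟩
    refine ⟨H.inv_mem ha, fun c hc => ?_⟩
    have := ha' (a⁻¹ * c) (H.mul_mem (H.inv_mem ha) hc)
    rw [← Submonoid.coe_mul, mul_inv_cancel_left] at this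
    rw [← Submonoid.coe_mul, this]

/-- Powers stay in the kernel, so each has the trace of the identity; expanding, all positive powers
of `n - 1` have trace zero. -/
theorem traceKernel_isUnipotent : IsUnipotent (traceKernel H) := by
  intro n hn
  refine isNilpotent_matrix_of_trace_pow_eq_zero _ fun k => ?_
  have hpow : ∀ k : ℕ, ((n : Matrix Idx Idx ℝ) ^ k).trace = (1 : Matrix Idx Idx ℝ).trace := by
    intro k
    have := ((traceKernel H).pow_mem hn k).2 1 H.one_mem
    simpa using this
  have hall : ∀ (k l : ℕ), (((n : Matrix Idx Idx ℝ) - 1) ^ (k + 1) *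
      (n : Matrix Idx Idx ℝ) ^ l).trace = 0 := by
    intro k
    induction k with
    | zero =>
      intro l
      rw [zero_add, pow_one, sub_mul, one_mul, ← pow_succ', Matrix.trace_sub, hpow, hpow, sub_self]
    | succ k ih =>
      intro l
      rw [pow_succ, mul_assoc, sub_mul, one_mul, ← pow_succ', mul_sub, Matrix.trace_sub, ih, ih,
        sub_self]
  simpa using hall k 0

theorem zariskiClosure_traceKernel_subset (hH : zariskiClosure (H : Set Sp4) ⊆ H) :
    zariskiClosure (traceKernel H : Set Sp4) ⊆ traceKernel H := by
  intro g hg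
  refine ⟨hH (zariskiClosure_mono (fun n hn => hn.1) hg), fun b hb => ?_⟩
  let p : MvPolynomial (Idx × Idx) ℝ := ∑ i, ∑ j,
    MvPolynomial.X (i, j) * MvPolynomial.C ((b : Matrix Idx Idx ℝ) j i) -
      MvPolynomial.C ((b : Matrix Idx Idx ℝ).trace)
  have hp : ∀ x : Sp4, MvPolynomial.aeval (coords x) p =
      ((x : Matrix Idx Idx ℝ) * (b : Matrix Idx Idx ℝ)).trace -
        (b : Matrix Idx Idx ℝ).trace := by
    intro x
    simp only [p, map_sub, map_sum, map_mul, MvPolynomial.aeval_X, MvPolynomial.aeval_C, coords,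
      Algebra.algebraMap_self, RingHom.id_apply]
    simp only [Matrix.trace, Matrix.diag, Matrix.mul_apply]
  have := mem_zariskiClosure.1 hg p fun n hn => by rw [hp, hn.2 b hb, sub_self]
  rwa [hp, sub_eq_zero] at this

/-- The passage from the group-theoretic definition of reductivity to the trace form, on which the
later uses of reductivity rest. Normality comes from conjugation invariance of the trace. -/
theorem traceKernel_eq_bot (hH : zariskiClosure (H : Set Sp4) ⊆ H) (hred : IsReductive H) :
    traceKernel H = ⊥ := by
  refine hred _ (fun n hn => hn.1) ⟨?_⟩
    (isZariskiClosed_of_zariskiClosure_subset (zariskiClosure_traceKernel_subset hH))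
    (isZariskiConnected_of_isUnipotent (zariskiClosure_traceKernel_subset hH)
      traceKernel_isUnipotent) traceKernel_isUnipotent
  rintro ⟨n, hnH⟩ hn ⟨g, hg⟩
  rw [Subgroup.mem_subgroupOf] at hn ⊢
  refine ⟨H.mul_mem (H.mul_mem hg hnH) (H.inv_mem hg), fun b hb => ?_⟩
  have := hn.2 (g⁻¹ * b * g) (H.mul_mem (H.mul_mem (H.inv_mem hg) hb) hg)
  change ((g * n * g⁻¹ : Sp4) * b : Matrix Idx Idx ℝ).trace = _
  change ((n : Matrix Idx Idx ℝ) * (g⁻¹ * b * g : Sp4) : Matrix Idx Idx ℝ).trace = _ at this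
  simp only [Submonoid.coe_mul] at this ⊢
  have h1 : (g : Matrix Idx Idx ℝ) * ((g⁻¹ : Sp4) : Matrix Idx Idx ℝ) = 1 := by
    rw [← Submonoid.coe_mul, mul_inv_cancel, Submonoid.coe_one]
  have h2 : ((g⁻¹ : Sp4) : Matrix Idx Idx ℝ) * (b : Matrix Idx Idx ℝ) * g =
      ((g⁻¹ : Sp4) : Matrix Idx Idx ℝ) * (b * g) := mul_assoc _ _ _
  rw [h2, Matrix.trace_mul_comm ((g⁻¹ : Sp4) : Matrix Idx Idx ℝ), mul_assoc, h1, mul_one] at this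
  rw [← this, Matrix.trace_mul_comm]
  conv_rhs => rw [Matrix.trace_mul_comm]
  conv_lhs => rw [← mul_assoc, ← mul_assoc, Matrix.trace_mul_comm]
  simp only [mul_assoc]

/-! ### The trace form on the Lie algebra of a reductive group -/

/-- The linear span of `H`. -/
noncomputable def spanC (H : Subgroup Sp4) : Submodule ℂ (Matrix Idx Idx ℂ) :=
  Submodule.span ℂ (cmat '' (H : Set Sp4))

theorem mul_mem_spanC {A B : Matrix Idx Idx ℂ} (hA : A ∈ spanC H) (hB : B ∈ spanC H) :
    A * B ∈ spanC H := by
  have := Submodule.mul_mem_mul hA hB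
  rw [spanC, Submodule.span_mul_span] at this
  refine Submodule.span_mono ?_ this
  rintro _ ⟨_, ⟨a, ha, rfl⟩, _, ⟨b, hb, rfl⟩, rfl⟩
  exact ⟨a * b, H.mul_mem ha hb, map_mul _ _ _⟩

theorem cmat_mem_spanC {g : Sp4} (hg : g ∈ H) : cmat g ∈ spanC H :=
  Submodule.subset_span ⟨g, hg, rfl⟩

theorem pow_mem_spanC {A : Matrix Idx Idx ℂ} (hA : A ∈ spanC H) (k : ℕ) : A ^ k ∈ spanC H := by
  induction k with
  | zero => rw [pow_zero, ← map_one cmat]; exact cmat_mem_spanC H.one_mem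
  | succ k ih => rw [pow_succ]; exact mul_mem_spanC ih hA

theorem trace_mul_eq_zero_of_mem_spanC {A B : Matrix Idx Idx ℂ}
    (hA : ∀ g ∈ H, (A * cmat g).trace = 0) (hB : B ∈ spanC H) : (A * B).trace = 0 := by
  induction hB using Submodule.span_induction with
  | mem x hx => obtain ⟨g, hg, rfl⟩ := hx; exact hA g hg
  | zero => simp
  | add x y _ _ hx hy => rw [mul_add, Matrix.trace_add, hx, hy, add_zero]
  | smul c x _ hx => rw [mul_smul_comm, Matrix.trace_smul, hx, smul_zero]

/-- A real matrix in the Lie algebra that is orthogonal to `H` for the trace form vanishes. -/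
theorem real_eq_zero_of_trace_eq_zero (hH : zariskiClosure (H : Set Sp4) ⊆ H)
    (hred : IsReductive H) {A : Matrix Idx Idx ℝ} (hA : A.map Complex.ofRealHom ∈ lieAlg H)
    (htr : ∀ g ∈ H, (A.map Complex.ofRealHom * cmat g).trace = 0) : A = 0 := by
  set Z := A.map Complex.ofRealHom with hZ
  have hspan : Z ∈ spanC H := mem_span_of_mem_lieAlg hA
  -- `Z` lies in the linear span of `H`, which is closed under products, so `Z` is trace-orthogonal
  -- to its own powers. Its exponential is then a polynomial in `Z`.
  have hnil : IsNilpotent Z := isNilpotent_matrix_of_trace_pow_eq_zero _ fun k => by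
    rw [pow_succ']
    exact trace_mul_eq_zero_of_mem_spanC htr (pow_mem_spanC hspan k)
  obtain ⟨n, hn⟩ := hnil
  have hn1 : Z ^ (n + 1) = 0 := by rw [pow_succ, hn, zero_mul]
  let E : Matrix Idx Idx ℝ := ∑ k ∈ Finset.range (n + 1), (k.factorial : ℝ)⁻¹ • A ^ k
  have hE : E.map Complex.ofRealHom =
      ∑ k ∈ Finset.range (n + 1), (k.factorial : ℂ)⁻¹ • Z ^ k := by
    rw [← RingHom.mapMatrix_apply, map_sum]
    refine Finset.sum_congr rfl fun k _ => ?_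
    rw [hZ, ← RingHom.mapMatrix_apply, ← map_pow]
    ext i j
    simp
  have hvan : ∀ F ∈ vanIdeal H, evalAt (E.map Complex.ofRealHom) F = 0 := by
    intro F hF
    rw [hE]
    exact evalAt_exp_eq_zero hn1 hA hF
  have hinj : Function.Injective (fun B : Matrix Idx Idx ℝ => B.map Complex.ofRealHom) :=
    Matrix.map_injective Complex.ofRealHom.injective
  have hEsp : E ∈ Matrix.symplecticGroup (Fin 2) ℝ := by
    rw [mem_symplecticGroup_iff_mul_symplAdj]
    refine hinj ?_
    change (E * symplAdj E).map Complex.ofRealHom = (1 : Matrix Idx Idx ℝ).map Complex.ofRealHom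
    rw [map_mul_matrix, symplAdj_map, Matrix.map_one _ (map_zero _) (map_one _), ← sub_eq_zero]
    refine (Submodule.mem_bot ℂ).1 (mem_of_forall_dual fun ℓ _ => ?_)
    have := hvan (functionalPoly ℓ (genMat * symplAdj genMat) - MvPolynomial.C (ℓ 1)) (by
      intro g hg
      rw [map_sub, evalAt_functionalPoly, map_evalAt_mul, map_evalAt_symplAdj, map_evalAt_genMat,
        ← cmat_inv, cmat_mul_inv, evalAt_C, sub_self])
    rwa [map_sub, evalAt_functionalPoly, map_evalAt_mul, map_evalAt_symplAdj, map_evalAt_genMat,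
      evalAt_C, ← map_sub] at this
  let e : Sp4 := ⟨E, hEsp⟩
  have heC : cmat e = E.map Complex.ofRealHom := rfl
  have hev : ∀ (x : Sp4) (p : MvPolynomial (Idx × Idx) ℝ),
      evalAt (cmat x) (MvPolynomial.map Complex.ofRealHom p) =
        ((MvPolynomial.aeval (coords x) p : ℝ) : ℂ) := by
    intro x p
    rw [evalAt, MvPolynomial.aeval_def, MvPolynomial.eval₂_map, MvPolynomial.aeval_def,
      ← Complex.ofRealHom_eq_coe, MvPolynomial.hom_eval₂]
    rfl
  have heH : e ∈ H := by
    refine hH (mem_zariskiClosure.2 fun p hp => ?_)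
    have := hvan (MvPolynomial.map Complex.ofRealHom p) (fun g hg => by
      rw [hev, hp g hg, Complex.ofReal_zero])
    rwa [← heC, hev, Complex.ofReal_eq_zero] at this
  have hpowtr : ∀ k, ∀ b ∈ H, (Z ^ (k + 1) * cmat b).trace = 0 := by
    intro k b hb
    rw [pow_succ', mul_assoc]
    exact trace_mul_eq_zero_of_mem_spanC htr
      (mul_mem_spanC (pow_mem_spanC hspan k) (cmat_mem_spanC hb))
  -- Every positive power of `Z` is orthogonal to `H`, so `exp Z` and `1` pair equally with `H`;
  -- reductivity forces `exp Z = 1`.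
  have heN : e ∈ traceKernel H := by
    refine ⟨heH, fun b hb => ?_⟩
    have h1 : (cmat e * cmat b).trace = (cmat b).trace := by
      rw [heC, hE, Finset.sum_mul, Matrix.trace_sum, Finset.sum_range_succ']
      rw [Finset.sum_eq_zero fun k _ => by
        rw [smul_mul_assoc, Matrix.trace_smul, hpowtr k b hb, smul_zero]]
      simp
    have h2 : ∀ x : Sp4, (cmat x).trace = (((x : Matrix Idx Idx ℝ).trace : ℝ) : ℂ) := by
      intro x
      simp [Matrix.trace, cmat]
    rw [← map_mul, h2, h2, Complex.ofReal_inj] at h1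
    exact h1
  rw [traceKernel_eq_bot hH hred, Subgroup.mem_bot] at heN
  have hE1 : ∑ k ∈ Finset.range n, ((k + 1).factorial : ℂ)⁻¹ • Z ^ (k + 1) = 0 := by
    have h1 : cmat e = 1 := by rw [heN, map_one]
    rw [heC, hE, Finset.sum_range_succ'] at h1
    simpa using h1
  -- Multiplying `Z + Z² / 2 + ⋯ = 0` by `Z ^ l` leaves only `Z ^ (l + 1)`, so the nilpotency order
  -- descends until `Z = 0`.
  have hstep : ∀ l, Z ^ (l + 2) = 0 → Z ^ (l + 1) = 0 := by
    intro l hl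
    have h1 := congrArg (Z ^ l * ·) hE1
    simp only [mul_zero, Finset.mul_sum, mul_smul_comm, ← pow_add] at h1
    rcases n with _ | n
    · rw [pow_zero] at hn
      rw [← one_mul (Z ^ (l + 1)), hn, zero_mul]
    · rw [Finset.sum_range_succ', Finset.sum_eq_zero fun k _ => by
        rw [show l + (k + 1 + 1) = k + (l + 2) by ring, pow_add, hl, mul_zero, smul_zero]] at h1
      simpa using h1
  have hdown : ∀ l, Z ^ (l + 1) = 0 → Z = 0 := by
    intro l
    induction l with
    | zero => intro h; simpa using h
    | succ l ih => intro h; exact ih (hstep l h)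
  refine hinj ?_
  change Z = (0 : Matrix Idx Idx ℝ).map Complex.ofRealHom
  rw [hdown n hn1]
  exact (Matrix.map_zero _ (map_zero _)).symm

/-- The Lie algebra and the orthogonality condition are stable under complex conjugation, so the
real case applies to the real parts of `A` and of `I • A`. -/
theorem eq_zero_of_trace_eq_zero (hH : zariskiClosure (H : Set Sp4) ⊆ H)
    (hred : IsReductive H) {A : Matrix Idx Idx ℂ} (hA : A ∈ lieAlg H)
    (htr : ∀ g ∈ H, (A * cmat g).trace = 0) : A = 0 := by
  have hre : ∀ B : Matrix Idx Idx ℂ, B ∈ lieAlg H → (∀ g ∈ H, (B * cmat g).trace = 0) →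
      B.map Complex.re = 0 := by
    intro B hB hBtr
    have hsum : (B.map Complex.re).map Complex.ofRealHom =
        (2 : ℂ)⁻¹ • (B + B.map (starRingEnd ℂ)) := by
      ext i j
      simp only [Matrix.map_apply, Matrix.smul_apply, Matrix.add_apply, smul_eq_mul,
        Complex.add_conj, Complex.ofRealHom_eq_coe]
      push_cast
      ring
    refine real_eq_zero_of_trace_eq_zero hH hred ?_ ?_
    · rw [hsum]
      exact Submodule.smul_mem _ _ (add_mem hB (conj_entries_mem_lieAlg hB))
    · intro g hg
      have h1 : (B.map (starRingEnd ℂ) * cmat g).trace = starRingEnd ℂ (B * cmat g).trace := by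
        conv_lhs => rw [← cmat_map_conj g, ← map_mul_matrix]
        simp only [Matrix.trace, Matrix.diag, Matrix.map_apply, map_sum]
      rw [hsum, smul_mul_assoc, Matrix.trace_smul, add_mul, Matrix.trace_add, h1, hBtr g hg,
        map_zero, add_zero, smul_zero]
  have h1 := hre A hA htr
  have h2 := hre (Complex.I • A) (Submodule.smul_mem _ _ hA) (fun g hg => by
    rw [smul_mul_assoc, Matrix.trace_smul, htr g hg, smul_zero])
  ext i j
  have h3 := congrFun (congrFun h1 i) j
  have h4 := congrFun (congrFun h2 i) j
  simp at h3 h4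
  exact Complex.ext h3 h4

/-- `U` is stable under conjugation by `H`. -/
def ConjStable (H : Subgroup Sp4) (U : Submodule ℂ (Matrix Idx Idx ℂ)) : Prop :=
  ∀ g ∈ H, ∀ Y ∈ U, cmat g * Y * cmat g⁻¹ ∈ U

theorem conj_list_prod (g : Sp4) (l : List (Matrix Idx Idx ℂ)) :
    cmat g * l.prod * cmat g⁻¹ = (l.map fun Y => cmat g * Y * cmat g⁻¹).prod := by
  induction l with
  | nil => simp [cmat_mul_inv]
  | cons a l ih =>
    rw [List.map_cons, List.prod_cons, List.prod_cons, ← ih]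
    have : ∀ a b : Matrix Idx Idx ℂ, cmat g * (a * b) * cmat g⁻¹ =
        cmat g * a * (cmat g⁻¹ * cmat g) * b * cmat g⁻¹ := by
      intro a b
      rw [cmat_inv_mul, mul_one]
      simp only [mul_assoc]
    rw [this]
    simp only [mul_assoc]

theorem ConjStable.commutator_mem {U : Submodule ℂ (Matrix Idx Idx ℂ)} (hU : ConjStable H U)
    {A Y : Matrix Idx Idx ℂ} (hA : A ∈ lieAlg H) (hY : Y ∈ U) : A * Y - Y * A ∈ U :=
  commutator_mem_of_conj_sub_mem hA fun g hg => sub_mem (hU g hg Y hY) hY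

/-- By Engel's theorem long products of elements of `U` vanish. As `U` is stable under conjugation,
`(A g) ^ m` is such a product times `g ^ m`, so `A g` is nilpotent and has trace zero for every `g ∈
H`. -/
theorem eq_bot_of_isNilpotent (hH : zariskiClosure (H : Set Sp4) ⊆ H)
    (hred : IsReductive H) {U : Submodule ℂ (Matrix Idx Idx ℂ)} (hU : U ≤ lieAlg H)
    (hconj : ConjStable H U) (hnil : ∀ A ∈ U, IsNilpotent A) : U = ⊥ := by
  obtain ⟨m, hm⟩ := exists_matrix_list_prod_eq_zero U
    (fun x hx y hy => hconj.commutator_mem (hU hx) hy) hnil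
  rw [eq_bot_iff]
  intro A hA
  refine (Submodule.mem_bot ℂ).2 (eq_zero_of_trace_eq_zero hH hred (hU hA) fun g hg => ?_)
  refine trace_eq_zero_of_isNilpotent ⟨m, ?_⟩
  -- The factors are the conjugates of `A` by successive powers of `g`: `(A g) ^ k = A · (g A g⁻¹) ⋯
  -- · g ^ k`.
  have key : ∀ k : ℕ, ∃ l : List (Matrix Idx Idx ℂ), l.length = k ∧ (∀ Y ∈ l, Y ∈ U) ∧
      (A * cmat g) ^ k = l.prod * cmat g ^ k := by
    intro k
    induction k with
    | zero => exact ⟨[], rfl, by simp, by simp⟩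
    | succ k ih =>
      obtain ⟨l, hl, hlU, hprod⟩ := ih
      refine ⟨A :: l.map fun Y => cmat g * Y * cmat g⁻¹, by simp [hl], ?_, ?_⟩
      · intro Y hY
        rcases List.mem_cons.1 hY with rfl | hY
        · exact hA
        · obtain ⟨Y', hY', rfl⟩ := List.mem_map.1 hY
          exact hconj g hg Y' (hlU Y' hY')
      · rw [pow_succ', hprod, List.prod_cons, ← conj_list_prod, pow_succ']
        calc A * cmat g * (l.prod * cmat g ^ k)
            = A * (cmat g * l.prod * 1 * cmat g ^ k) := by simp only [mul_assoc, mul_one]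
          _ = _ := by rw [← cmat_inv_mul g]; simp only [mul_assoc]
  obtain ⟨l, hl, hlU, hprod⟩ := key m
  rw [hprod, hm l hl hlU, zero_mul]

/-- The Cartan criterion in the form used below: `tr(AA') = 0` makes `A` nilpotent, and a
conjugation-stable space of nilpotents in the Lie algebra is zero. The replicas `A'` need not lie in
`U`. -/
theorem eq_bot_of_trace_replica (hH : zariskiClosure (H : Set Sp4) ⊆ H)
    (hred : IsReductive H) {U : Submodule ℂ (Matrix Idx Idx ℂ)} (hU : U ≤ lieAlg H)
    (hconj : ConjStable H U)
    (htr : ∀ A ∈ U, ∀ A', IsConjReplica (Matrix.toLin' A) (Matrix.toLin' A') →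
      (A * A').trace = 0) : U = ⊥ := by
  refine eq_bot_of_isNilpotent hH hred hU hconj fun A hA => ?_
  obtain ⟨f, hf⟩ := exists_isConjReplica (Matrix.toLin' A)
  have hf' : f = Matrix.toLin' (LinearMap.toMatrix' f) := (Matrix.toLin'_toMatrix' f).symm
  rw [hf'] at hf
  have h1 := htr A hA _ hf
  have : IsNilpotent (Matrix.toLinAlgEquiv' A) := by
    refine hf.isNilpotent_of_trace_mul ?_
    rw [← Matrix.trace_toLin'_eq, Matrix.toLin'_mul] at h1
    exact h1
  exact (IsNilpotent.map_iff (Matrix.toLinAlgEquiv' (R := ℂ) (n := Idx)).injective).1 this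

end SpFour

/-! ### Invariant decompositions of the Lie algebra, and fixed points when it acts trivially. -/

namespace SpFour

variable {H : Subgroup Sp4}

/-! ### Conjugation and the trace form -/

/-- Conjugation by `g` on complex matrices. -/
noncomputable def conjC (g : Sp4) : Matrix Idx Idx ℂ →ₐ[ℂ] Matrix Idx Idx ℂ where
  toFun Y := cmat g * Y * cmat g⁻¹
  map_one' := by rw [mul_one, cmat_mul_inv]
  map_mul' A B := by
    rw [show cmat g * A * cmat g⁻¹ * (cmat g * B * cmat g⁻¹) =
      cmat g * A * (cmat g⁻¹ * cmat g) * B * cmat g⁻¹ by simp only [mul_assoc], cmat_inv_mul,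
      mul_one]
    simp only [mul_assoc]
  map_zero' := by rw [mul_zero, zero_mul]
  map_add' A B := by rw [mul_add, add_mul]
  commutes' c := by
    rw [Algebra.algebraMap_eq_smul_one, mul_smul_comm, smul_mul_assoc, mul_one, cmat_mul_inv]

theorem conjC_apply (g : Sp4) (Y : Matrix Idx Idx ℂ) : conjC g Y = cmat g * Y * cmat g⁻¹ := rfl

theorem conjC_conjC (g h : Sp4) (Y : Matrix Idx Idx ℂ) : conjC g (conjC h Y) = conjC (g * h) Y := by
  rw [conjC_apply, conjC_apply, conjC_apply, mul_inv_rev, map_mul, map_mul]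
  simp only [mul_assoc]

theorem conjC_one (Y : Matrix Idx Idx ℂ) : conjC 1 Y = Y := by simp [conjC_apply]

theorem conjC_conjC_inv (g : Sp4) (Y : Matrix Idx Idx ℂ) : conjC g (conjC g⁻¹ Y) = Y := by
  rw [conjC_conjC, mul_inv_cancel, conjC_one]

theorem conjC_inv_conjC (g : Sp4) (Y : Matrix Idx Idx ℂ) : conjC g⁻¹ (conjC g Y) = Y := by
  rw [conjC_conjC, inv_mul_cancel, conjC_one]

theorem trace_conjC (g : Sp4) (Y : Matrix Idx Idx ℂ) : (conjC g Y).trace = Y.trace := by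
  rw [conjC_apply, Matrix.trace_mul_comm, ← mul_assoc, cmat_inv_mul, one_mul]

theorem trace_conjC_mul (g : Sp4) (A B : Matrix Idx Idx ℂ) :
    (A * conjC g B).trace = (conjC g⁻¹ A * B).trace := by
  rw [← trace_conjC g⁻¹ (A * conjC g B), map_mul, conjC_inv_conjC]

/-- The trace form on complex matrices. -/
noncomputable def trForm : LinearMap.BilinForm ℂ (Matrix Idx Idx ℂ) :=
  (LinearMap.mul ℂ (Matrix Idx Idx ℂ)).compr₂ (Matrix.traceLinearMap Idx ℂ ℂ)

theorem trForm_apply (A B : Matrix Idx Idx ℂ) : trForm A B = (A * B).trace := rfl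

theorem trForm_isRefl : trForm.IsRefl := fun A B h => by
  rw [trForm_apply, Matrix.trace_mul_comm]
  exact h

theorem mem_orthogonal_trForm {U : Submodule ℂ (Matrix Idx Idx ℂ)} {A : Matrix Idx Idx ℂ} :
    A ∈ trForm.orthogonal U ↔ ∀ B ∈ U, (B * A).trace = 0 := Iff.rfl

theorem ConjStable.conjC_mem {U : Submodule ℂ (Matrix Idx Idx ℂ)} (hU : ConjStable H U) {g : Sp4}
    (hg : g ∈ H) {Y : Matrix Idx Idx ℂ} (hY : Y ∈ U) : conjC g Y ∈ U := hU g hg Y hY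

theorem ConjStable.inf {U U' : Submodule ℂ (Matrix Idx Idx ℂ)} (hU : ConjStable H U)
    (hU' : ConjStable H U') : ConjStable H (U ⊓ U') :=
  fun g hg Y hY => ⟨hU g hg Y hY.1, hU' g hg Y hY.2⟩

theorem ConjStable.orthogonal {U : Submodule ℂ (Matrix Idx Idx ℂ)} (hU : ConjStable H U) :
    ConjStable H (trForm.orthogonal U) := by
  intro g hg Y hY
  rw [mem_orthogonal_trForm] at hY ⊢
  intro B hB
  rw [← conjC_apply, trace_conjC_mul]
  exact hY _ (hU.conjC_mem (H.inv_mem hg) hB)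

theorem conjStable_lieAlg : ConjStable H (lieAlg H) := fun _ hg _ hY => conj_mem_lieAlg hY hg

/-- The elements of the Lie algebra of `H` that commute with `M`. -/
noncomputable def lieCentralizer (H : Subgroup Sp4) (M : Submodule ℂ (Matrix Idx Idx ℂ)) :
    Submodule ℂ (Matrix Idx Idx ℂ) where
  carrier := {A | A ∈ lieAlg H ∧ ∀ m ∈ M, A * m - m * A = 0}
  add_mem' := by
    rintro A B ⟨hA, hA'⟩ ⟨hB, hB'⟩
    refine ⟨add_mem hA hB, fun m hm => ?_⟩
    rw [add_mul, mul_add, add_sub_add_comm, hA' m hm, hB' m hm, add_zero]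
  zero_mem' := ⟨zero_mem _, fun m _ => by rw [zero_mul, mul_zero, sub_zero]⟩
  smul_mem' := by
    rintro c A ⟨hA, hA'⟩
    refine ⟨Submodule.smul_mem _ c hA, fun m hm => ?_⟩
    rw [smul_mul_assoc, mul_smul_comm, ← smul_sub, hA' m hm, smul_zero]

variable {M : Submodule ℂ (Matrix Idx Idx ℂ)}

theorem conjStable_lieCentralizer (hM : ConjStable H M) : ConjStable H (lieCentralizer H M) := by
  rintro g hg A ⟨hA, hA'⟩
  refine ⟨conj_mem_lieAlg hA hg, fun m hm => ?_⟩
  have := hA' _ (hM.conjC_mem (H.inv_mem hg) hm)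
  have h2 := congrArg (conjC g) this
  rw [map_sub, map_mul, map_mul, conjC_conjC_inv, map_zero] at h2
  exact h2

theorem replica_mem_lieCentralizer {A A' : Matrix Idx Idx ℂ}
    (h : IsConjReplica (Matrix.toLin' A) (Matrix.toLin' A')) (hA : A ∈ lieCentralizer H M) :
    A' ∈ lieCentralizer H M :=
  ⟨replica_mem_lieAlg h hA.1, fun m hm => h.adMat.apply_eq_zero (k := 1) (hA.2 m hm)⟩

/-- An element `A` of the radical of the trace form on `U` is orthogonal to its own replica, which
also lies in `U`, so the Cartan criterion applies. -/
theorem disjoint_orthogonal_of_replica_mem (hH : zariskiClosure (H : Set Sp4) ⊆ H)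
    (hred : IsReductive H) {U : Submodule ℂ (Matrix Idx Idx ℂ)} (hU : U ≤ lieAlg H)
    (hconj : ConjStable H U)
    (hrep : ∀ A ∈ U, ∀ A', IsConjReplica (Matrix.toLin' A) (Matrix.toLin' A') → A' ∈ U) :
    Disjoint U (trForm.orthogonal U) := by
  rw [disjoint_iff]
  refine eq_bot_of_trace_replica hH hred (inf_le_left.trans hU) (hconj.inf hconj.orthogonal) ?_
  intro A hA A' hAA'
  rw [Matrix.trace_mul_comm]
  exact hA.2 A' (hrep A hA.1 A' hAA')

theorem exists_add_of_mem_lieAlg (hH : zariskiClosure (H : Set Sp4) ⊆ H)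
    (hred : IsReductive H) {U : Submodule ℂ (Matrix Idx Idx ℂ)} (hU : U ≤ lieAlg H)
    (hconj : ConjStable H U)
    (hrep : ∀ A ∈ U, ∀ A', IsConjReplica (Matrix.toLin' A) (Matrix.toLin' A') → A' ∈ U)
    {A : Matrix Idx Idx ℂ} (hA : A ∈ lieAlg H) :
    ∃ B ∈ U, ∃ C ∈ lieAlg H ⊓ trForm.orthogonal U, A = B + C := by
  have hc := (LinearMap.BilinForm.isCompl_orthogonal_iff_disjoint trForm_isRefl).2
    (disjoint_orthogonal_of_replica_mem hH hred hU hconj hrep)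
  obtain ⟨B, hB, C, hC, hBC⟩ := Submodule.mem_sup.1
    (hc.sup_eq_top ▸ Submodule.mem_top : A ∈ U ⊔ trForm.orthogonal U)
  refine ⟨B, hB, C, ⟨?_, hC⟩, hBC.symm⟩
  rw [eq_sub_of_add_eq' hBC]
  exact sub_mem hA (hU hB)

/-! ### Fixed points when the Lie algebra acts trivially -/

theorem conjStable_sup_span (hM : ConjStable H M) {q : Matrix Idx Idx ℂ}
    (hq : ∀ g ∈ H, conjC g q - q ∈ M) : ConjStable H (M ⊔ Submodule.span ℂ {q}) := by
  intro g hg Y hY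
  obtain ⟨m, hm, x, hx, rfl⟩ := Submodule.mem_sup.1 hY
  obtain ⟨c, rfl⟩ := Submodule.mem_span_singleton.1 hx
  rw [← conjC_apply, map_add, map_smul]
  refine add_mem (Submodule.mem_sup_left (hM.conjC_mem hg hm)) (Submodule.smul_mem _ c ?_)
  rw [← sub_add_cancel (conjC g q) q]
  exact add_mem (Submodule.mem_sup_left (hq g hg))
    (Submodule.mem_sup_right (Submodule.mem_span_singleton_self q))

/-- The Lie algebra kills `M` and sends `q` into `M`, so commutation with `A` is nilpotent of order
two on `M + ℂ q` and its replica kills that space. Thus every replica centralizes it, and the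
orthogonal complement of the centralizer in the Lie algebra vanishes by the Cartan criterion. -/
theorem lieAlg_le_lieCentralizer_sup_span (hH : zariskiClosure (H : Set Sp4) ⊆ H)
    (hred : IsReductive H) (hM : ConjStable H M) {q : Matrix Idx Idx ℂ}
    (hq : ∀ g ∈ H, conjC g q - q ∈ M) (hle : lieAlg H ≤ lieCentralizer H M) :
    lieAlg H ≤ lieCentralizer H (M ⊔ Submodule.span ℂ {q}) := by
  set U := lieCentralizer H (M ⊔ Submodule.span ℂ {q}) with hUdef
  have hconj : ConjStable H U := conjStable_lieCentralizer (conjStable_sup_span hM hq)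
  have hU : U ≤ lieAlg H := fun A hA => hA.1
  have hbot : lieAlg H ⊓ trForm.orthogonal U = ⊥ := by
    refine eq_bot_of_trace_replica hH hred inf_le_left (conjStable_lieAlg.inf hconj.orthogonal) ?_
    intro A hA A' hAA'
    rw [Matrix.trace_mul_comm]
    refine hA.2 A' ⟨replica_mem_lieAlg hAA' hA.1, fun y hy => ?_⟩
    refine hAA'.adMat.apply_eq_zero (k := 2) ?_
    obtain ⟨m, hm, x, hx, rfl⟩ := Submodule.mem_sup.1 hy
    obtain ⟨c, rfl⟩ := Submodule.mem_span_singleton.1 hx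
    have h1 : adMat A m = 0 := (hle hA.1).2 m hm
    have h2 : adMat A (adMat A q) = 0 :=
      (hle hA.1).2 _ (commutator_mem_of_conj_sub_mem hA.1 hq)
    rw [pow_two, Module.End.mul_apply, map_add, h1, zero_add, map_smul, map_smul, h2, smul_zero]
  intro A hA
  obtain ⟨B, hB, C, hC, rfl⟩ := exists_add_of_mem_lieAlg hH hred hU hconj
    (fun A hA A' h => replica_mem_lieCentralizer h hA) hA
  rw [hbot, Submodule.mem_bot] at hC
  rwa [hC, add_zero]

/-- The derivative of `X q X⁻¹` along `A` is `X (A q - q A) X⁻¹ = 0`, so each entry is a polynomial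
constant along the Lie algebra and takes finitely many values on `H`. -/
theorem finite_orbit_of_commute {q : Matrix Idx Idx ℂ} (hq : ∀ A ∈ lieAlg H, A * q - q * A = 0) :
    ((fun g => conjC g q) '' (H : Set Sp4)).Finite := by
  have hfin : ∀ ij : Idx × Idx,
      ((fun g => (conjC g q) ij.1 ij.2) '' (H : Set Sp4)).Finite := by
    intro ij
    have := finite_image_of_invField_mem (H := H)
      (f := (genMat * constMat q * symplAdj genMat) ij.1 ij.2) (by
        intro A hA
        have h1 : (genMat * constMat q * symplAdj genMat).map (invField A) = 0 := by
          rw [map_derivation_mul, map_derivation_mul, map_derivation_symplAdj,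
            map_derivation_constMat, map_invField_genMat, mul_zero, add_zero, symplAdj_mul,
            show symplAdj (constMat A) = constMat (symplAdj A) from
              (symplAdj_map MvPolynomial.C A).symm, symplAdj_eq_neg_of_mem_lieAlg hA,
            show constMat (-A) = -constMat A from Matrix.ext fun i j => by simp [constMat]]
          have h2 : constMat A * constMat q = constMat q * constMat A := by
            rw [← constMat_mul, ← constMat_mul, sub_eq_zero.1 (hq A hA)]
          calc _ = genMat * (constMat A * constMat q) * symplAdj genMat -
              genMat * (constMat q * constMat A) * symplAdj genMat := by
                simp only [mul_assoc, neg_mul, mul_neg, sub_eq_add_neg]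
            _ = 0 := by rw [h2, sub_self]
        have h3 := congrFun (congrFun h1 ij.1) ij.2
        rw [Matrix.map_apply] at h3
        rw [h3]
        exact zero_mem _)
    refine this.subset ?_
    rintro _ ⟨g, hg, rfl⟩
    refine ⟨g, hg, ?_⟩
    have h4 : (genMat * constMat q * symplAdj genMat).map (evalAt (cmat g)) = conjC g q := by
      rw [map_evalAt_mul, map_evalAt_mul, map_evalAt_symplAdj, map_evalAt_genMat,
        map_evalAt_constMat, ← cmat_inv, conjC_apply]
    exact congrFun (congrFun h4 ij.1) ij.2
  have hpi := Set.Finite.pi' (ι := Idx × Idx) hfin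
  refine Set.Finite.of_finite_image (f := fun (A : Matrix Idx Idx ℂ) (ij : Idx × Idx) =>
    A ij.1 ij.2) (hpi.subset ?_) ?_
  · rintro _ ⟨_, ⟨g, hg, rfl⟩, rfl⟩ ij
    exact ⟨g, hg, rfl⟩
  · intro A _ B _ hAB
    ext i j
    exact congrFun hAB (i, j)

/-- The barycentre of the orbit is fixed, and it differs from `q` by an average of elements of `M`.
-/
theorem exists_fixed_of_finite_orbit {q : Matrix Idx Idx ℂ}
    (hq : ∀ g ∈ H, conjC g q - q ∈ M)
    (hfin : ((fun g => conjC g q) '' (H : Set Sp4)).Finite) :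
    ∃ m ∈ M, ∀ g ∈ H, conjC g (q + m) = q + m := by
  classical
  set s := hfin.toFinset with hs
  have hmem : ∀ {Y}, Y ∈ s ↔ ∃ g ∈ H, conjC g q = Y := by
    intro Y
    rw [hs, Set.Finite.mem_toFinset]
    rfl
  have hs0 : (s.card : ℂ) ≠ 0 := by
    refine Nat.cast_ne_zero.2 (Finset.card_ne_zero.2 ⟨q, hmem.2 ⟨1, H.one_mem, conjC_one q⟩⟩)
  refine ⟨(s.card : ℂ)⁻¹ • ∑ Y ∈ s, (Y - q), Submodule.smul_mem _ _ (sum_mem ?_), ?_⟩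
  · intro Y hY
    obtain ⟨g, hg, rfl⟩ := hmem.1 hY
    exact hq g hg
  · have hav : q + (s.card : ℂ)⁻¹ • ∑ Y ∈ s, (Y - q) = (s.card : ℂ)⁻¹ • ∑ Y ∈ s, Y := by
      rw [Finset.sum_sub_distrib, Finset.sum_const, smul_sub, ← Nat.cast_smul_eq_nsmul ℂ,
        smul_smul, inv_mul_cancel₀ hs0, one_smul, add_sub_cancel]
    intro g hg
    rw [hav, map_smul, map_sum]
    congr 1
    refine Finset.sum_bij' (fun Y _ => conjC g Y) (fun Y _ => conjC g⁻¹ Y) ?_ ?_ ?_ ?_ ?_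
    · intro Y hY
      obtain ⟨h, hh, rfl⟩ := hmem.1 hY
      exact hmem.2 ⟨g * h, H.mul_mem hg hh, (conjC_conjC g h q).symm⟩
    · intro Y hY
      obtain ⟨h, hh, rfl⟩ := hmem.1 hY
      exact hmem.2 ⟨g⁻¹ * h, H.mul_mem (H.inv_mem hg) hh, (conjC_conjC g⁻¹ h q).symm⟩
    · intro Y _
      exact conjC_inv_conjC g Y
    · intro Y _
      exact conjC_conjC_inv g Y
    · intro Y _
      rfl

/-! ### The Casimir operator -/

/-- The trace of a symmetric invariant expression in dual bases is preserved by isometries. -/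
theorem sum_dualBasis_isometry {K V W ι : Type*} [Field K] [AddCommGroup V] [Module K V]
    [AddCommGroup W] [Module K W] [Fintype ι] [DecidableEq ι]
    {B : LinearMap.BilinForm K V} (hB : B.Nondegenerate) (hsymm : B.IsSymm)
    (b : Module.Basis ι K V) (F : V →ₗ[K] V →ₗ[K] W) (φ ψ : V →ₗ[K] V)
    (hφψ : ∀ x, φ (ψ x) = x) (hψ : ∀ x y, B x (φ y) = B (ψ x) y) :
    ∑ i, F (φ (b i)) (φ (B.dualBasis hB b i)) = ∑ i, F (b i) (B.dualBasis hB b i) := by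
  have hexp : ∀ x, x = ∑ j, B (B.dualBasis hB b j) x • b j := by
    intro x
    have h1 : ∀ j, b.repr x j = B (B.dualBasis hB b j) x := fun j => by
      have := LinearMap.BilinForm.dualBasis_repr_apply hB (B.dualBasis hB b) x j
      rwa [LinearMap.BilinForm.dualBasis_dualBasis hB hsymm, hsymm.eq] at this
    simp only [← h1, b.sum_repr]
  have hexp' : ∀ x, x = ∑ j, B x (b j) • B.dualBasis hB b j := by
    intro x
    conv_lhs => rw [← (B.dualBasis hB b).sum_repr x]
    simp only [LinearMap.BilinForm.dualBasis_repr_apply]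
  calc ∑ i, F (φ (b i)) (φ (B.dualBasis hB b i))
      = ∑ i, ∑ j, B (B.dualBasis hB b j) (φ (b i)) • F (b j) (φ (B.dualBasis hB b i)) := by
        refine Finset.sum_congr rfl fun i _ => ?_
        conv_lhs => rw [hexp (φ (b i))]
        simp only [map_sum, map_smul, LinearMap.sum_apply, LinearMap.smul_apply]
    _ = ∑ j, ∑ i, B (B.dualBasis hB b j) (φ (b i)) • F (b j) (φ (B.dualBasis hB b i)) :=
        Finset.sum_comm
    _ = ∑ j, F (b j) (B.dualBasis hB b j) := by
        refine Finset.sum_congr rfl fun j _ => ?_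
        conv_rhs => rw [← hφψ (B.dualBasis hB b j), hexp' (ψ (B.dualBasis hB b j))]
        simp only [map_sum, map_smul, hψ]

end SpFour

/-! ### The Casimir operator, vanishing of first cohomology, and invariant complements. -/

namespace SpFour

variable {H : Subgroup Sp4} {M : Submodule ℂ (Matrix Idx Idx ℂ)}

/-- A linear projection onto `M`. -/
noncomputable def projOn (M : Submodule ℂ (Matrix Idx Idx ℂ)) : Matrix Idx Idx ℂ →ₗ[ℂ] M :=
  Classical.choose (M.subtype.exists_leftInverse_of_injective M.ker_subtype)

theorem projOn_apply (m : M) : projOn M (m : Matrix Idx Idx ℂ) = m :=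
  LinearMap.congr_fun
    (Classical.choose_spec (M.subtype.exists_leftInverse_of_injective M.ker_subtype)) m

/-- `adMat` as a linear map. -/
noncomputable def adLin : Matrix Idx Idx ℂ →ₗ[ℂ] Module.End ℂ (Matrix Idx Idx ℂ) where
  toFun := adMat
  map_add' A B := LinearMap.ext fun Y => by
    rw [LinearMap.add_apply, adMat_apply, adMat_apply, adMat_apply, add_mul, mul_add,
      add_sub_add_comm]
  map_smul' c A := LinearMap.ext fun Y => by
    rw [RingHom.id_apply, LinearMap.smul_apply, adMat_apply, adMat_apply, smul_mul_assoc,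
      mul_smul_comm, smul_sub]

theorem adLin_apply (A Y : Matrix Idx Idx ℂ) : adLin A Y = A * Y - Y * A := rfl

theorem adLin_conjC (g : Sp4) (A Y : Matrix Idx Idx ℂ) :
    adLin (conjC g A) (conjC g Y) = conjC g (adLin A Y) := by
  rw [adLin_apply, adLin_apply, map_sub, map_mul, map_mul]

/-- The action of a matrix on `M` by commutators, followed by a projection onto `M`. -/
noncomputable def adOn (M : Submodule ℂ (Matrix Idx Idx ℂ)) :
    Matrix Idx Idx ℂ →ₗ[ℂ] Module.End ℂ M where
  toFun A := projOn M ∘ₗ adLin A ∘ₗ M.subtype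
  map_add' A B := by rw [map_add, LinearMap.add_comp, LinearMap.comp_add]
  map_smul' c A := by rw [map_smul, LinearMap.smul_comp, LinearMap.comp_smul, RingHom.id_apply]

/-- The projection onto `M` only serves to define `adOn` on all matrices; on the Lie algebra
commutators already preserve `M`. -/
theorem coe_adOn (hM : ConjStable H M) {A : Matrix Idx Idx ℂ} (hA : A ∈ lieAlg H) (m : M) :
    (adOn M A m : Matrix Idx Idx ℂ) = adLin A m :=
  congrArg Subtype.val (projOn_apply ⟨adLin A m, hM.commutator_mem hA m.2⟩)

/-- The trace form of the commutator action on `M`. -/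
noncomputable def adForm (M : Submodule ℂ (Matrix Idx Idx ℂ)) :
    LinearMap.BilinForm ℂ (Matrix Idx Idx ℂ) :=
  ((LinearMap.mul ℂ (Module.End ℂ M)).compr₂ (LinearMap.trace ℂ M)).compl₁₂ (adOn M) (adOn M)

theorem adForm_apply (A B : Matrix Idx Idx ℂ) :
    adForm M A B = LinearMap.trace ℂ M (adOn M A * adOn M B) := rfl

theorem adForm_isSymm : (adForm M).IsSymm :=
  ⟨fun A B => by rw [adForm_apply, adForm_apply, LinearMap.trace_mul_comm]⟩

theorem adForm_conjC (hM : ConjStable H M) {g : Sp4} (hg : g ∈ H) {A B : Matrix Idx Idx ℂ}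
    (hA : A ∈ lieAlg H) (hB : B ∈ lieAlg H) :
    adForm M (conjC g A) (conjC g B) = adForm M A B := by
  let c : ∀ g ∈ H, Module.End ℂ M := fun g hg =>
    (conjC g).toLinearMap.restrict fun _ hY => hM.conjC_mem hg hY
  have hc : ∀ (g) (hg : g ∈ H) (m : M), (c g hg m : Matrix Idx Idx ℂ) = conjC g m :=
    fun _ _ _ => rfl
  have hcomm : ∀ X ∈ lieAlg H, adOn M (conjC g X) * c g hg = c g hg * adOn M X := by
    intro X hX
    refine LinearMap.ext fun m => Subtype.ext ?_
    rw [Module.End.mul_apply, Module.End.mul_apply, coe_adOn hM (conjStable_lieAlg.conjC_mem hg hX),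
      hc g hg, hc g hg,
      coe_adOn hM hX, adLin_conjC]
  have hinv : c g hg * c g⁻¹ (H.inv_mem hg) = 1 :=
    LinearMap.ext fun m => Subtype.ext (conjC_conjC_inv g m)
  have hinv' : c g⁻¹ (H.inv_mem hg) * c g hg = 1 :=
    LinearMap.ext fun m => Subtype.ext (conjC_inv_conjC g m)
  rw [adForm_apply, adForm_apply]
  calc LinearMap.trace ℂ M (adOn M (conjC g A) * adOn M (conjC g B))
      = LinearMap.trace ℂ M (adOn M (conjC g A) * (adOn M (conjC g B) * c g hg) *
          c g⁻¹ (H.inv_mem hg)) := by rw [mul_assoc, mul_assoc, hinv, mul_one]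
    _ = LinearMap.trace ℂ M (c g hg * (adOn M A * adOn M B) * c g⁻¹ (H.inv_mem hg)) := by
        rw [hcomm B hB, ← mul_assoc, hcomm A hA]
        simp only [mul_assoc]
    _ = _ := by rw [LinearMap.trace_mul_comm, ← mul_assoc, hinv', one_mul]

/-- The orthogonal complement in the Lie algebra of the centralizer of `M`. -/
noncomputable def lieComplement (H : Subgroup Sp4) (M : Submodule ℂ (Matrix Idx Idx ℂ)) :
    Submodule ℂ (Matrix Idx Idx ℂ) :=
  lieAlg H ⊓ trForm.orthogonal (lieCentralizer H M)

theorem conjStable_lieComplement (hM : ConjStable H M) : ConjStable H (lieComplement H M) :=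
  conjStable_lieAlg.inf (conjStable_lieCentralizer hM).orthogonal

theorem adOn_eq_zero (hM : ConjStable H M) {A : Matrix Idx Idx ℂ} (hA : A ∈ lieCentralizer H M) :
    adOn M A = 0 :=
  LinearMap.ext fun m => Subtype.ext (by rw [coe_adOn hM hA.1]; exact hA.2 m m.2)

theorem exists_add_lieComplement (hH : zariskiClosure (H : Set Sp4) ⊆ H) (hred : IsReductive H)
    (hM : ConjStable H M) {A : Matrix Idx Idx ℂ} (hA : A ∈ lieAlg H) :
    ∃ B ∈ lieCentralizer H M, ∃ C ∈ lieComplement H M, A = B + C :=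
  exists_add_of_mem_lieAlg hH hred (U := lieCentralizer H M) (fun _ h => h.1)
    (conjStable_lieCentralizer hM) (fun _ hA _ h => replica_mem_lieCentralizer h hA) hA

/-- Let `X` be in the radical and split its replica as `X' = B + C`, with `B` centralizing `M` and
`C` in the complement. `B` acts by zero on `M` and `C` pairs to zero with `X`, so the trace of `ad X
* ad X'` on `M` vanishes and `ad X' = 0` there. Hence `X'` centralizes `M`, is orthogonal to `X`,
and the Cartan criterion applies. -/
theorem eq_zero_of_adForm_eq_zero (hH : zariskiClosure (H : Set Sp4) ⊆ H) (hred : IsReductive H)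
    (hM : ConjStable H M) {A : Matrix Idx Idx ℂ} (hA : A ∈ lieComplement H M)
    (h0 : ∀ B ∈ lieComplement H M, adForm M A B = 0) : A = 0 := by
  let U : Submodule ℂ (Matrix Idx Idx ℂ) :=
    lieComplement H M ⊓ (adForm M).orthogonal (lieComplement H M)
  have hU : U = ⊥ := by
    refine eq_bot_of_trace_replica hH hred (fun _ h => h.1.1) ?_ ?_
    · intro g hg Y hY
      refine ⟨conjStable_lieComplement hM g hg Y hY.1, fun B hB => ?_⟩
      have h1 := hY.2 _ ((conjStable_lieComplement hM).conjC_mem (H.inv_mem hg) hB)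
      change adForm M (conjC g⁻¹ B) Y = 0 at h1
      change adForm M B (conjC g Y) = 0
      rw [ ← conjC_conjC_inv g B, adForm_conjC hM hg
        (conjStable_lieAlg.conjC_mem (H.inv_mem hg) hB.1) hY.1.1]
      exact h1
    · intro X hX X' hXX'
      have hX' := replica_mem_lieAlg hXX' hX.1.1
      obtain ⟨B, hB, C, hC, hBC⟩ := exists_add_lieComplement hH hred hM hX'
      have h1 : LinearMap.trace ℂ M (adOn M X * adOn M X') = 0 := by
        have h2 := hX.2 C hC
        change adForm M C X = 0 at h2
        rw [adForm_isSymm.eq, adForm_apply] at h2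
        rw [hBC, map_add, adOn_eq_zero hM hB, zero_add, h2]
      have hrep : IsConjReplica (adOn M X) (adOn M X') := by
        have h3 := hXX'.adMat.restrict (p := M) (fun m hm => hM.commutator_mem hX.1.1 hm)
          (fun m hm => hM.commutator_mem hX' hm)
        convert h3 using 1
        · exact LinearMap.ext fun m => Subtype.ext (coe_adOn hM hX.1.1 m)
        · exact LinearMap.ext fun m => Subtype.ext (coe_adOn hM hX' m)
      have h4 := hrep.eq_zero_of_trace_mul h1
      have h5 : X' ∈ lieCentralizer H M := ⟨hX', fun m hm => by
        rw [← adLin_apply, ← coe_adOn hM hX' ⟨m, hm⟩, h4]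
        rfl⟩
      rw [Matrix.trace_mul_comm]
      exact hX.1.2 X' h5
  have : A ∈ U := ⟨hA, fun B hB => by
    change adForm M B A = 0
    rw [adForm_isSymm.eq]
    exact h0 B hB⟩
  rwa [hU, Submodule.mem_bot] at this

theorem adForm_restrict_nondegenerate (hH : zariskiClosure (H : Set Sp4) ⊆ H)
    (hred : IsReductive H) (hM : ConjStable H M) :
    ((adForm M).restrict (lieComplement H M)).Nondegenerate := by
  constructor
  · intro A hA
    exact Subtype.ext (eq_zero_of_adForm_eq_zero hH hred hM A.2 fun B hB => hA ⟨B, hB⟩)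
  · intro A hA
    refine Subtype.ext (eq_zero_of_adForm_eq_zero hH hred hM A.2 fun B hB => ?_)
    rw [adForm_isSymm.eq]
    exact hA ⟨B, hB⟩

/-- The Casimir operator of the complement of the centralizer of `M`. -/
theorem exists_casimir (hH : zariskiClosure (H : Set Sp4) ⊆ H) (hred : IsReductive H)
    (hM : ConjStable H M) (hne : ¬ lieAlg H ≤ lieCentralizer H M) :
    ∃ (Ω : Module.End ℂ (Matrix Idx Idx ℂ)) (ω : Module.End ℂ M),
      (∀ m : M, (ω m : Matrix Idx Idx ℂ) = Ω m) ∧ LinearMap.trace ℂ M ω ≠ 0 ∧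
      (∀ g ∈ H, ∀ Y, conjC g (Ω Y) = Ω (conjC g Y)) ∧
      ∀ q, (∀ g ∈ H, conjC g q - q ∈ M) → Ω q ∈ M := by
  classical
  set U := lieComplement H M with hUdef
  let B := (adForm M).restrict U
  have hB : B.Nondegenerate := adForm_restrict_nondegenerate hH hred hM
  have hsymm : B.IsSymm := ⟨fun x y => adForm_isSymm.eq (x : Matrix Idx Idx ℂ) y⟩
  have hU : ConjStable H U := conjStable_lieComplement hM
  have hUbot : U ≠ ⊥ := by
    intro h
    refine hne fun A hA => ?_
    obtain ⟨X, hX, C, hC, rfl⟩ := exists_add_lieComplement hH hred hM hA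
    rw [← hUdef, h, Submodule.mem_bot] at hC
    rwa [hC, add_zero]
  let b := Module.finBasis ℂ U
  let d := B.dualBasis hB b
  let F : U →ₗ[ℂ] U →ₗ[ℂ] Module.End ℂ (Matrix Idx Idx ℂ) :=
    (LinearMap.mul ℂ (Module.End ℂ (Matrix Idx Idx ℂ))).compl₁₂ (adLin ∘ₗ U.subtype)
      (adLin ∘ₗ U.subtype)
  have hF : ∀ (x y : U) (Y : Matrix Idx Idx ℂ), F x y Y =
      adLin (x : Matrix Idx Idx ℂ) (adLin (y : Matrix Idx Idx ℂ) Y) := fun _ _ _ => rfl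
  refine ⟨∑ i, F (b i) (d i), ∑ i, adOn M (b i) * adOn M (d i), ?_, ?_, ?_, ?_⟩
  · intro m
    rw [LinearMap.sum_apply, LinearMap.sum_apply, AddSubmonoidClass.coe_finsetSum]
    refine Finset.sum_congr rfl fun i _ => ?_
    rw [Module.End.mul_apply, coe_adOn hM (b i).2.1, coe_adOn hM (d i).2.1, hF]
  · rw [map_sum]
    -- The bases are dual for `adForm`, so each term contributes `1` and the total trace is the
    -- dimension of `U`, which is nonzero.
    have : ∀ i, LinearMap.trace ℂ M (adOn M (b i) * adOn M (d i)) = 1 := by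
      intro i
      have h1 := LinearMap.BilinForm.apply_dualBasis_right hB hsymm b i i
      rw [if_pos rfl] at h1
      exact h1
    rw [Finset.sum_congr rfl fun i _ => this i, Finset.sum_const, Finset.card_univ,
      Fintype.card_fin, nsmul_eq_mul, mul_one, Nat.cast_ne_zero]
    exact fun h => hUbot (Submodule.finrank_eq_zero.1 h)
  · intro g hg Y
    let φ : ∀ g ∈ H, U →ₗ[ℂ] U := fun g hg =>
      (conjC g).toLinearMap.restrict fun _ hY => hU.conjC_mem hg hY
    have hφ : ∀ (g) (hg : g ∈ H) (x : U), (φ g hg x : Matrix Idx Idx ℂ) = conjC g x :=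
      fun _ _ _ => rfl
    have key := sum_dualBasis_isometry hB hsymm b F (φ g hg) (φ g⁻¹ (H.inv_mem hg))
      (fun x => Subtype.ext (conjC_conjC_inv g x)) (fun x y => by
        change adForm M x (conjC g y) = adForm M (conjC g⁻¹ x) y
        rw [← adForm_conjC hM hg (conjStable_lieAlg.conjC_mem (H.inv_mem hg) x.2.1) y.2.1,
          conjC_conjC_inv])
    have h1 := LinearMap.congr_fun key (conjC g Y)
    rw [← h1, LinearMap.sum_apply, LinearMap.sum_apply, map_sum]
    refine Finset.sum_congr rfl fun i _ => ?_
    rw [hF, hF, hφ g hg, hφ g hg, adLin_conjC, adLin_conjC]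
  · intro q hq
    rw [LinearMap.sum_apply]
    refine sum_mem fun i _ => ?_
    rw [hF]
    exact hM.commutator_mem (b i).2.1 (commutator_mem_of_conj_sub_mem (d i).2.1 hq)

/-- Vanishing of the first cohomology of a reductive group with values in `M`. -/
theorem exists_fixed_of_isReductive (hH : zariskiClosure (H : Set Sp4) ⊆ H)
    (hred : IsReductive H) (n : ℕ) : ∀ M : Submodule ℂ (Matrix Idx Idx ℂ),
      Module.finrank ℂ M = n → ConjStable H M →
      ∀ q, (∀ g ∈ H, conjC g q - q ∈ M) → ∃ m ∈ M, ∀ g ∈ H, conjC g (q + m) = q + m := by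
  induction n using Nat.strong_induction_on with
  | _ n ih =>
  intro M hn hM q hq
  by_cases hle : lieAlg H ≤ lieCentralizer H M
  -- Trivial infinitesimal action on `M` extends to `q`, so the orbit of `q` is finite.
  · refine exists_fixed_of_finite_orbit hq (finite_orbit_of_commute fun A hA => ?_)
    exact (lieAlg_le_lieCentralizer_sup_span hH hred hM hq hle hA).2 q
      (Submodule.mem_sup_right (Submodule.mem_span_singleton_self q))
  obtain ⟨Ω, f, hf, htr, hcomm, hΩq⟩ := exists_casimir hH hred hM hle
  have hpow : ∀ (k : ℕ) (m : M), ((f ^ k) m : Matrix Idx Idx ℂ) = (Ω ^ k) m := by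
    intro k
    induction k with
    | zero => intro m; rfl
    | succ k ih =>
      intro m
      rw [pow_succ, pow_succ, Module.End.mul_apply, Module.End.mul_apply, ih, hf]
  have hcommpow : ∀ (k : ℕ), ∀ g ∈ H, ∀ Y, conjC g ((Ω ^ k) Y) = (Ω ^ k) (conjC g Y) := by
    intro k g hg
    induction k with
    | zero => intro Y; rfl
    | succ k ih =>
      intro Y
      rw [pow_succ, Module.End.mul_apply, Module.End.mul_apply, ih, hcomm g hg]
  -- Fitting decomposition of `M` under the Casimir operator. The generalized kernel `M'` is a
  -- proper subspace because a nilpotent operator would have trace zero; the induction runs on it.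
  obtain ⟨N, hN⟩ := Filter.eventually_atTop.1
    (f.eventually_isCompl_ker_pow_range_pow.and f.eventually_iSup_ker_pow_eq)
  obtain ⟨hcompl, hker⟩ := hN (N + 1) (Nat.le_succ N)
  have hstab : ∀ m, (f ^ (N + 2)) m = 0 → (f ^ (N + 1)) m = 0 := by
    intro m hm
    have : m ∈ ⨆ k, LinearMap.ker (f ^ k) :=
      Submodule.mem_iSup_of_mem (N + 2) (LinearMap.mem_ker.2 hm)
    rwa [hker] at this
  let M' : Submodule ℂ (Matrix Idx Idx ℂ) := M ⊓ LinearMap.ker (Ω ^ (N + 1))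
  have hM' : ConjStable H M' := fun g hg Y hY =>
    ⟨hM g hg Y hY.1, by
      change (Ω ^ (N + 1)) (conjC g Y) = 0
      rw [← hcommpow _ g hg, LinearMap.mem_ker.1 hY.2, map_zero]⟩
  have hlt : M' < M := by
    refine lt_of_le_of_ne inf_le_left fun h => htr ?_
    refine (LinearMap.isNilpotent_trace_of_isNilpotent (R := ℂ) ⟨N + 1, ?_⟩).eq_zero
    refine LinearMap.ext fun m => Subtype.ext ?_
    rw [hpow]
    have : (m : Matrix Idx Idx ℂ) ∈ M' := h.symm ▸ m.2
    exact LinearMap.mem_ker.1 this.2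
  obtain ⟨x, hx, y, hy, hxy⟩ := Submodule.mem_sup.1
    (hcompl.sup_eq_top ▸ Submodule.mem_top : (⟨Ω q, hΩq q hq⟩ : M) ∈
      LinearMap.ker (f ^ (N + 1)) ⊔ LinearMap.range (f ^ (N + 1)))
  obtain ⟨w, rfl⟩ := hy
  -- Since `f m = f ^ (N + 1) w` is the range component of `Ω q`, subtracting `m` from `q` leaves `Ω
  -- (q - m)` in the generalized kernel. The cocycle of `q - m` therefore takes values in `M'`.
  set m := (f ^ N) w with hm
  have hΩ : Ω (q - m) = x := by
    have h1 := congrArg Subtype.val hxy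
    rw [pow_succ', Module.End.mul_apply, ← hm, Submodule.coe_add, hf] at h1
    rw [map_sub, sub_eq_iff_eq_add]
    exact h1.symm
  have hq' : ∀ g ∈ H, conjC g (q - m) - (q - m) ∈ M' := by
    intro g hg
    have h1 : conjC g (q - m) - (q - m) ∈ M := by
      rw [map_sub, sub_sub_sub_comm]
      exact sub_mem (hq g hg) (sub_mem (hM.conjC_mem hg m.2) m.2)
    refine ⟨h1, ?_⟩
    have h2 : (Ω ^ (N + 2)) (conjC g (q - m) - (q - m)) = 0 := by
      have h3 : (Ω ^ (N + 2)) (q - m) = 0 := by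
        rw [pow_succ, Module.End.mul_apply, hΩ, ← hpow, LinearMap.mem_ker.1 hx,
          Submodule.coe_zero]
      rw [map_sub, ← hcommpow _ g hg, h3, map_zero, sub_zero]
    have h4 := hstab ⟨_, h1⟩ (Subtype.ext (by rw [hpow]; exact h2))
    have h5 := congrArg Subtype.val h4
    rw [hpow] at h5
    exact h5
  obtain ⟨m', hm', hfix⟩ := ih (Module.finrank ℂ M')
    (hn ▸ Submodule.finrank_lt_finrank_of_lt hlt) M' rfl hM' _ hq'
  refine ⟨m' - m, sub_mem hm'.1 m.2, fun g hg => ?_⟩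
  have := hfix g hg
  rwa [show q + (m' - (m : Matrix Idx Idx ℂ)) = q - m + m' by abel]

/-! ### Invariant complements -/

theorem conjC_map_ofReal (g : Sp4) (A : Matrix Idx Idx ℝ) :
    conjC g (A.map Complex.ofRealHom) =
      ((g : Matrix Idx Idx ℝ) * A * ((g⁻¹ : Sp4) : Matrix Idx Idx ℝ)).map Complex.ofRealHom := by
  rw [map_mul_matrix, map_mul_matrix]
  rfl

theorem eq_map_re_add_map_im (Y : Matrix Idx Idx ℂ) :
    Y = (Y.map Complex.re).map Complex.ofRealHom +
      Complex.I • (Y.map Complex.im).map Complex.ofRealHom := by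
  ext i j
  simp only [Matrix.add_apply, Matrix.smul_apply, Matrix.map_apply, smul_eq_mul,
    Complex.ofRealHom_eq_coe]
  rw [mul_comm, Complex.re_add_im]

theorem map_re_ofReal_add (A B : Matrix Idx Idx ℝ) :
    (A.map Complex.ofRealHom + Complex.I • B.map Complex.ofRealHom).map Complex.re = A := by
  ext i j
  simp

theorem map_im_ofReal_add (A B : Matrix Idx Idx ℝ) :
    (A.map Complex.ofRealHom + Complex.I • B.map Complex.ofRealHom).map Complex.im = B := by
  ext i j
  simp

theorem conjC_map_re_im (g : Sp4) (Y : Matrix Idx Idx ℂ) :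
    (conjC g Y).map Complex.re =
      (g : Matrix Idx Idx ℝ) * Y.map Complex.re * ((g⁻¹ : Sp4) : Matrix Idx Idx ℝ) ∧
    (conjC g Y).map Complex.im =
      (g : Matrix Idx Idx ℝ) * Y.map Complex.im * ((g⁻¹ : Sp4) : Matrix Idx Idx ℝ) := by
  have h : conjC g Y = ((g : Matrix Idx Idx ℝ) * Y.map Complex.re *
      ((g⁻¹ : Sp4) : Matrix Idx Idx ℝ)).map Complex.ofRealHom + Complex.I •
      ((g : Matrix Idx Idx ℝ) * Y.map Complex.im *
        ((g⁻¹ : Sp4) : Matrix Idx Idx ℝ)).map Complex.ofRealHom := by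
    conv_lhs => rw [eq_map_re_add_map_im Y]
    rw [map_add, map_smul, conjC_map_ofReal, conjC_map_ofReal]
  rw [h]
  exact ⟨map_re_ofReal_add _ _, map_im_ofReal_add _ _⟩

/-- The matrices whose range lies in `K` and that vanish on `K`. -/
def homIntoKilling (K : Submodule ℝ (Idx → ℝ)) : Submodule ℝ (Matrix Idx Idx ℝ) where
  carrier := {A | (∀ v, A.mulVec v ∈ K) ∧ ∀ v ∈ K, A.mulVec v = 0}
  add_mem' := by
    rintro A B ⟨hA, hA'⟩ ⟨hB, hB'⟩
    refine ⟨fun v => ?_, fun v hv => ?_⟩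
    · rw [Matrix.add_mulVec]
      exact add_mem (hA v) (hB v)
    · rw [Matrix.add_mulVec, hA' v hv, hB' v hv, add_zero]
  zero_mem' := ⟨fun v => by rw [Matrix.zero_mulVec]; exact zero_mem K,
    fun v _ => Matrix.zero_mulVec v⟩
  smul_mem' := by
    rintro c A ⟨hA, hA'⟩
    refine ⟨fun v => ?_, fun v hv => ?_⟩
    · rw [Matrix.smul_mulVec]
      exact Submodule.smul_mem _ _ (hA v)
    · rw [Matrix.smul_mulVec, hA' v hv, smul_zero]

/-- The complexification of a real space of matrices. -/
def complexify (U : Submodule ℝ (Matrix Idx Idx ℝ)) : Submodule ℂ (Matrix Idx Idx ℂ) where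
  carrier := {Y | Y.map Complex.re ∈ U ∧ Y.map Complex.im ∈ U}
  add_mem' := by
    rintro A B ⟨hA, hA'⟩ ⟨hB, hB'⟩
    exact ⟨by rw [Matrix.map_add _ Complex.add_re]; exact add_mem hA hB,
      by rw [Matrix.map_add _ Complex.add_im]; exact add_mem hA' hB'⟩
  zero_mem' := ⟨by rw [Matrix.map_zero _ Complex.zero_re]; exact zero_mem U,
    by rw [Matrix.map_zero _ Complex.zero_im]; exact zero_mem U⟩
  smul_mem' := by
    rintro c A ⟨hA, hA'⟩
    have h1 : (c • A).map Complex.re = c.re • A.map Complex.re - c.im • A.map Complex.im :=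
      Matrix.ext fun i j => Complex.mul_re _ _
    have h2 : (c • A).map Complex.im = c.re • A.map Complex.im + c.im • A.map Complex.re :=
      Matrix.ext fun i j => Complex.mul_im _ _
    exact ⟨by rw [h1]; exact sub_mem (U.smul_mem _ hA) (U.smul_mem _ hA'),
      by rw [h2]; exact add_mem (U.smul_mem _ hA') (U.smul_mem _ hA)⟩

/-- Subspaces preserved by a reductive group have invariant complements. -/
theorem exists_isCompl_of_isReductive (hH : zariskiClosure (H : Set Sp4) ⊆ H)
    (hred : IsReductive H) (K : Submodule ℝ (Idx → ℝ))
    (hK : ∀ g ∈ H, ∀ v ∈ K, (g : Matrix Idx Idx ℝ).mulVec v ∈ K) :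
    ∃ K' : Submodule ℝ (Idx → ℝ), IsCompl K K' ∧
      ∀ g ∈ H, ∀ v ∈ K', (g : Matrix Idx Idx ℝ).mulVec v ∈ K' := by
  obtain ⟨p, hp⟩ := K.subtype.exists_leftInverse_of_injective K.ker_subtype
  -- Any projection onto `K`. Its conjugates by `H` are also projections onto `K`, and two such
  -- differ by a map into `K` that kills `K`.
  let E : Matrix Idx Idx ℝ := LinearMap.toMatrix' (K.subtype ∘ₗ p)
  have hEv : ∀ v, E.mulVec v = p v := fun v => LinearMap.toMatrix'_mulVec _ v
  have hEK : ∀ v ∈ K, E.mulVec v = v := fun v hv => by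
    rw [hEv]
    exact congrArg Subtype.val (LinearMap.congr_fun hp ⟨v, hv⟩)
  have hgg : ∀ (g : Sp4) (v : Idx → ℝ),
      (g : Matrix Idx Idx ℝ).mulVec (((g⁻¹ : Sp4) : Matrix Idx Idx ℝ).mulVec v) = v := by
    intro g v
    rw [Matrix.mulVec_mulVec, ← Submonoid.coe_mul, mul_inv_cancel, Submonoid.coe_one,
      Matrix.one_mulVec]
  let M := complexify (homIntoKilling K)
  have hM : ConjStable H M := by
    have key : ∀ g ∈ H, ∀ A ∈ homIntoKilling K,
        (g : Matrix Idx Idx ℝ) * A * ((g⁻¹ : Sp4) : Matrix Idx Idx ℝ) ∈ homIntoKilling K := by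
      rintro g hg A ⟨hA, hA'⟩
      refine ⟨fun v => ?_, fun v hv => ?_⟩
      · rw [← Matrix.mulVec_mulVec, ← Matrix.mulVec_mulVec]
        exact hK g hg _ (hA _)
      · rw [← Matrix.mulVec_mulVec, ← Matrix.mulVec_mulVec, hA' _ (hK _ (H.inv_mem hg) v hv),
          Matrix.mulVec_zero]
    rintro g hg Y ⟨hY, hY'⟩
    rw [← conjC_apply]
    exact ⟨by rw [(conjC_map_re_im g Y).1]; exact key g hg _ hY,
      by rw [(conjC_map_re_im g Y).2]; exact key g hg _ hY'⟩
  have hq : ∀ g ∈ H, conjC g (E.map Complex.ofRealHom) - E.map Complex.ofRealHom ∈ M := by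
    intro g hg
    have h1 : conjC g (E.map Complex.ofRealHom) - E.map Complex.ofRealHom =
        ((g : Matrix Idx Idx ℝ) * E * ((g⁻¹ : Sp4) : Matrix Idx Idx ℝ) - E).map
          Complex.ofRealHom + Complex.I • (0 : Matrix Idx Idx ℝ).map Complex.ofRealHom := by
      rw [conjC_map_ofReal, Matrix.map_zero _ (map_zero _), smul_zero, add_zero,
        Matrix.map_sub _ (map_sub _)]
    rw [h1]
    refine ⟨?_, by rw [map_im_ofReal_add]; exact zero_mem _⟩
    rw [map_re_ofReal_add]
    refine ⟨fun v => ?_, fun v hv => ?_⟩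
    · rw [Matrix.sub_mulVec, ← Matrix.mulVec_mulVec, ← Matrix.mulVec_mulVec, hEv, hEv]
      exact sub_mem (hK g hg _ (p _).2) (p _).2
    · rw [Matrix.sub_mulVec, ← Matrix.mulVec_mulVec, ← Matrix.mulVec_mulVec,
        hEK _ (hK _ (H.inv_mem hg) v hv), hgg, hEK v hv, sub_self]
  obtain ⟨m, hm, hfix⟩ := exists_fixed_of_isReductive hH hred _ M rfl hM _ hq
  -- The correction `m` is complex, but `E` and `H` are real, so its real part already gives an
  -- `H`-invariant projection onto `K`; the kernel is the complement.
  let P : Matrix Idx Idx ℝ := E + m.map Complex.re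
  have hPm : (E.map Complex.ofRealHom + m).map Complex.re = P := by
    ext i j
    simp [P]
  have hPK : ∀ v, P.mulVec v ∈ K := fun v => by
    rw [Matrix.add_mulVec, hEv]
    exact add_mem (p v).2 (hm.1.1 v)
  have hPv : ∀ v ∈ K, P.mulVec v = v := fun v hv => by
    rw [Matrix.add_mulVec, hEK v hv, hm.1.2 v hv, add_zero]
  have hcomm : ∀ g ∈ H, (g : Matrix Idx Idx ℝ) * P * ((g⁻¹ : Sp4) : Matrix Idx Idx ℝ) = P := by
    intro g hg
    rw [← hPm, ← (conjC_map_re_im g _).1, hfix g hg]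
  refine ⟨LinearMap.ker P.mulVecLin, ?_, ?_⟩
  · constructor
    · rw [Submodule.disjoint_def]
      intro v hv hv'
      rw [← hPv v hv]
      exact hv'
    · rw [codisjoint_iff, eq_top_iff]
      intro v _
      rw [← add_sub_cancel (P.mulVec v) v]
      refine Submodule.add_mem_sup (hPK v) ?_
      rw [LinearMap.mem_ker, Matrix.mulVecLin_apply, Matrix.mulVec_sub, hPv _ (hPK v), sub_self]
  · intro g hg v hv
    rw [LinearMap.mem_ker, Matrix.mulVecLin_apply] at hv ⊢
    have h1 : P * (g : Matrix Idx Idx ℝ) = g * P := by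
      conv_lhs => rw [← hcomm g hg]
      rw [mul_assoc, ← Submonoid.coe_mul, inv_mul_cancel, Submonoid.coe_one, mul_one]
    rw [Matrix.mulVec_mulVec, h1, ← Matrix.mulVec_mulVec, hv, Matrix.mulVec_zero]

/-- Invariance of a subspace passes to the Zariski closure. -/
theorem mulVec_mem_of_mem_zariskiClosure {S : Set Sp4} {K : Submodule ℝ (Idx → ℝ)}
    (hK : ∀ g ∈ S, ∀ v ∈ K, (g : Matrix Idx Idx ℝ).mulVec v ∈ K) {g : Sp4}
    (hg : g ∈ zariskiClosure S) {v : Idx → ℝ} (hv : v ∈ K) :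
    (g : Matrix Idx Idx ℝ).mulVec v ∈ K := by
  refine mem_of_forall_dual fun ℓ hℓ => ?_
  let p : MvPolynomial (Idx × Idx) ℝ := ∑ i, ∑ j,
    MvPolynomial.X (i, j) * MvPolynomial.C (v j * ℓ (Pi.single i 1))
  have hp : ∀ x : Sp4, MvPolynomial.aeval (coords x) p =
      ℓ ((x : Matrix Idx Idx ℝ).mulVec v) := by
    intro x
    simp only [p, map_sum, map_mul, MvPolynomial.aeval_X, MvPolynomial.aeval_C, coords,
      Algebra.algebraMap_self, RingHom.id_apply]
    rw [LinearMap.pi_apply_eq_sum_univ ℓ]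
    refine Finset.sum_congr rfl fun i _ => ?_
    rw [Matrix.mulVec, dotProduct, Finset.sum_smul]
    refine Finset.sum_congr rfl fun j _ => ?_
    rw [smul_eq_mul, mul_assoc]
    congr 3
    funext k
    simp [Pi.single_apply, eq_comm]
  have := mem_zariskiClosure.1 hg p fun s hs => by
    rw [hp]
    exact hℓ (hK s hs v hv)
  rwa [hp] at this

theorem exists_isCompl_of_isReductiveRep {π : Type*} [Group π] {ρ : π →* Sp4}
    (hρ : IsReductiveRep ρ) {K : Submodule ℝ (Idx → ℝ)} (hK : IsInvariant ρ K) :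
    ∃ K' : Submodule ℝ (Idx → ℝ), IsCompl K K' ∧ IsInvariant ρ K' := by
  obtain ⟨K', hc, h⟩ := exists_isCompl_of_isReductive (H := zariskiClosureSubgroup ρ.range)
    (zariskiClosure_zariskiClosure _) hρ K (fun g hg v hv =>
      mulVec_mem_of_mem_zariskiClosure (S := (ρ.range : Set Sp4)) (by
        rintro _ ⟨x, rfl⟩ v hv
        exact hK x v hv) hg hv)
  exact ⟨K', hc, fun x v hv => h _ (subset_zariskiClosure _ ⟨x, rfl⟩) v hv⟩

end SpFour

/-! ### From complete reducibility to closed orbits. -/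

namespace SpFour

open Filter Topology

/-! ### The algebra generated by a completely reducible representation -/

section Algebra

variable {π : Type*} [Group π] (ρ : π →* Sp4)

/-- The algebra of matrices generated by the image of `ρ`. -/
def repAlgebra : Subalgebra ℝ (Matrix Idx Idx ℝ) :=
  Algebra.adjoin ℝ (Set.range fun x => (ρ x : Matrix Idx Idx ℝ))

variable {ρ}

theorem coe_mem_repAlgebra (x : π) : (ρ x : Matrix Idx Idx ℝ) ∈ repAlgebra ρ :=
  Algebra.subset_adjoin ⟨x, rfl⟩

theorem coe_inv_eq_symplAdj (g : Sp4) :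
    ((g⁻¹ : Sp4) : Matrix Idx Idx ℝ) = symplAdj (g : Matrix Idx Idx ℝ) := by
  rw [SymplecticGroup.coe_inv, symplAdj]

/-- The adjoint with respect to the symplectic form, as a linear map. -/
def symplAdjLin : Matrix Idx Idx ℝ →ₗ[ℝ] Matrix Idx Idx ℝ where
  toFun := symplAdj
  map_add' A B := by
    simp only [symplAdj, Matrix.transpose_add, mul_add, add_mul]
  map_smul' c A := by
    simp only [symplAdj, Matrix.transpose_smul, mul_smul_comm, smul_mul_assoc, RingHom.id_apply]

theorem symplAdjLin_apply (A : Matrix Idx Idx ℝ) : symplAdjLin A = symplAdj A := rfl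

theorem symplAdj_symplAdj (A : Matrix Idx Idx ℝ) : symplAdj (symplAdj A) = A := by
  have hJ : Matrix.J (Fin 2) ℝ * Matrix.J (Fin 2) ℝ = -1 := Matrix.J_squared _ _
  simp only [symplAdj, Matrix.transpose_mul, Matrix.transpose_neg, Matrix.J_transpose,
    Matrix.transpose_transpose, neg_neg, mul_neg, neg_mul]
  rw [show Matrix.J (Fin 2) ℝ * (Matrix.J (Fin 2) ℝ * (A * Matrix.J (Fin 2) ℝ)) *
    Matrix.J (Fin 2) ℝ = (Matrix.J (Fin 2) ℝ * Matrix.J (Fin 2) ℝ) * A *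
      (Matrix.J (Fin 2) ℝ * Matrix.J (Fin 2) ℝ) by simp only [mul_assoc], hJ]
  simp

theorem symplAdj_mem_repAlgebra {A : Matrix Idx Idx ℝ} (hA : A ∈ repAlgebra ρ) :
    symplAdj A ∈ repAlgebra ρ := by
  induction hA using Algebra.adjoin_induction with
  | mem a ha =>
    obtain ⟨x, rfl⟩ := ha
    dsimp only
    rw [← coe_inv_eq_symplAdj, ← map_inv]
    exact coe_mem_repAlgebra x⁻¹
  | algebraMap r =>
    rw [Algebra.algebraMap_eq_smul_one, ← symplAdjLin_apply, map_smul, symplAdjLin_apply,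
      symplAdj_one]
    exact Subalgebra.smul_mem _ (one_mem _) r
  | add a b _ _ ha hb =>
    rw [← symplAdjLin_apply, map_add]
    exact add_mem ha hb
  | mul a b _ _ ha hb =>
    rw [symplAdj_mul]
    exact mul_mem hb ha

/-- The radical `J` of the trace form is a two-sided ideal of nilpotents, so its common kernel `K`
is invariant. An invariant complement of `K`, if nonzero, would by Engel's theorem contain a nonzero
vector killed by `J`; so `K` is everything and `J = 0`. -/
theorem eq_zero_of_trace_mul_repAlgebra
    (hcomp : ∀ K : Submodule ℝ (Idx → ℝ), IsInvariant ρ K →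
      ∃ K' : Submodule ℝ (Idx → ℝ), IsCompl K K' ∧ IsInvariant ρ K')
    {A : Matrix Idx Idx ℝ} (hA : A ∈ repAlgebra ρ)
    (h : ∀ B ∈ repAlgebra ρ, (A * B).trace = 0) : A = 0 := by
  let J : Submodule ℝ (Matrix Idx Idx ℝ) :=
    { carrier := {A | A ∈ repAlgebra ρ ∧ ∀ B ∈ repAlgebra ρ, (A * B).trace = 0}
      add_mem' := by
        rintro A A' ⟨hA, h⟩ ⟨hA', h'⟩
        refine ⟨add_mem hA hA', fun B hB => ?_⟩
        rw [add_mul, Matrix.trace_add, h B hB, h' B hB, add_zero]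
      zero_mem' := ⟨zero_mem _, fun B _ => by rw [zero_mul, Matrix.trace_zero]⟩
      smul_mem' := by
        rintro c A ⟨hA, h⟩
        refine ⟨Subalgebra.smul_mem _ hA c, fun B hB => ?_⟩
        rw [smul_mul_assoc, Matrix.trace_smul, h B hB, smul_zero] }
  have hright : ∀ A ∈ J, ∀ B ∈ repAlgebra ρ, A * B ∈ J := by
    rintro A ⟨hA, h⟩ B hB
    refine ⟨mul_mem hA hB, fun C hC => ?_⟩
    rw [mul_assoc]
    exact h _ (mul_mem hB hC)
  have hleft : ∀ A ∈ J, ∀ B ∈ repAlgebra ρ, B * A ∈ J := by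
    rintro A ⟨hA, h⟩ B hB
    refine ⟨mul_mem hB hA, fun C hC => ?_⟩
    rw [mul_assoc, Matrix.trace_mul_comm, mul_assoc]
    exact h _ (mul_mem hC hB)
  have hnil : ∀ A ∈ J, IsNilpotent A := by
    rintro A ⟨hA, h⟩
    refine isNilpotent_matrix_of_trace_pow_eq_zero A fun k => ?_
    rw [pow_succ']
    exact h _ (pow_mem hA k)
  have hlie : ∀ A ∈ J, ∀ B ∈ J, A * B - B * A ∈ J := fun A hA B hB =>
    sub_mem (hright A hA B hB.1) (hright B hB A hA.1)
  let K : Submodule ℝ (Idx → ℝ) :=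
    { carrier := {v | ∀ A ∈ J, A.mulVec v = 0}
      add_mem' := fun {v w} hv hw A hA => by rw [Matrix.mulVec_add, hv A hA, hw A hA, add_zero]
      zero_mem' := fun A _ => Matrix.mulVec_zero A
      smul_mem' := fun c v hv A hA => by rw [Matrix.mulVec_smul, hv A hA, smul_zero] }
  obtain ⟨K', hc, hK'⟩ := hcomp K fun x v hv A hA => by
    rw [Matrix.mulVec_mulVec]
    exact hv _ (hright A hA _ (coe_mem_repAlgebra x))
  have hinv : ∀ A ∈ repAlgebra ρ, ∀ v ∈ K', A.mulVec v ∈ K' := by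
    intro A hA
    induction hA using Algebra.adjoin_induction with
    | mem a ha =>
      obtain ⟨x, rfl⟩ := ha
      exact hK' x
    | algebraMap r =>
      intro v hv
      rw [Algebra.algebraMap_eq_smul_one, Matrix.smul_mulVec, Matrix.one_mulVec]
      exact K'.smul_mem r hv
    | add a b _ _ ha hb =>
      intro v hv
      rw [Matrix.add_mulVec]
      exact add_mem (ha v hv) (hb v hv)
    | mul a b _ _ ha hb =>
      intro v hv
      rw [← Matrix.mulVec_mulVec]
      exact ha _ (hb v hv)
  have hbot : K' = ⊥ := by
    by_contra hne
    obtain ⟨w, hw, hw0, hJw⟩ := exists_mem_forall_mulVec_eq_zero J hlie hnil K' hne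
      fun A hA => hinv A hA.1
    exact hw0 (Submodule.disjoint_def.1 hc.disjoint w hJw hw)
  have htop : K = ⊤ := by simpa [hbot] using hc.sup_eq_top
  refine Matrix.toLin'.injective (LinearMap.ext fun v => ?_)
  have hv : v ∈ K := htop ▸ Submodule.mem_top
  simpa using hv A ⟨hA, h⟩

/-- The trace form on the algebra generated by `ρ`. -/
noncomputable def repForm (ρ : π →* Sp4) : LinearMap.BilinForm ℝ (repAlgebra ρ) :=
  (LinearMap.mul ℝ (repAlgebra ρ)).compr₂
    (Matrix.traceLinearMap Idx ℝ ℝ ∘ₗ (repAlgebra ρ).val.toLinearMap)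

theorem repForm_apply (a b : repAlgebra ρ) :
    repForm ρ a b = ((a : Matrix Idx Idx ℝ) * (b : Matrix Idx Idx ℝ)).trace := rfl

theorem repForm_isSymm : (repForm ρ).IsSymm :=
  ⟨fun a b => by rw [repForm_apply, repForm_apply, Matrix.trace_mul_comm]⟩

theorem repForm_nondegenerate
    (hcomp : ∀ K : Submodule ℝ (Idx → ℝ), IsInvariant ρ K →
      ∃ K' : Submodule ℝ (Idx → ℝ), IsCompl K K' ∧ IsInvariant ρ K') :
    (repForm ρ).Nondegenerate := by
  have h : ∀ a : repAlgebra ρ, (∀ b, repForm ρ a b = 0) → a = 0 := fun a ha =>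
    Subtype.ext (eq_zero_of_trace_mul_repAlgebra hcomp a.2 fun B hB => ha ⟨B, hB⟩)
  exact ⟨h, fun a ha => h a fun b => by rw [repForm_isSymm.eq]; exact ha b⟩

variable {ι : Type*} [Fintype ι] [DecidableEq ι]

theorem basis_repr_eq_dualBasis (hB : (repForm ρ).Nondegenerate)
    (b : Module.Basis ι ℝ (repAlgebra ρ)) (x : repAlgebra ρ) (j : ι) :
    b.repr x j = repForm ρ ((repForm ρ).dualBasis hB b j) x := by
  have := LinearMap.BilinForm.dualBasis_repr_apply hB ((repForm ρ).dualBasis hB b) x j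
  rwa [LinearMap.BilinForm.dualBasis_dualBasis hB repForm_isSymm, repForm_isSymm.eq] at this

/-- `∑ c bᵢ ⊗ dᵢ = ∑ bᵢ ⊗ dᵢ c`, since the trace form is associative. This identity makes sums over
dual bases into intertwiners. -/
theorem sum_mul_dualBasis (hB : (repForm ρ).Nondegenerate)
    (b : Module.Basis ι ℝ (repAlgebra ρ)) {W : Type*} [AddCommGroup W] [Module ℝ W]
    (F : repAlgebra ρ →ₗ[ℝ] repAlgebra ρ →ₗ[ℝ] W) (c : repAlgebra ρ) :
    ∑ i, F (c * b i) ((repForm ρ).dualBasis hB b i) =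
      ∑ i, F (b i) ((repForm ρ).dualBasis hB b i * c) := by
  set d := (repForm ρ).dualBasis hB b with hd
  calc ∑ i, F (c * b i) (d i)
      = ∑ i, ∑ j, repForm ρ (d j) (c * b i) • F (b j) (d i) := by
        refine Finset.sum_congr rfl fun i _ => ?_
        conv_lhs => rw [← b.sum_repr (c * b i)]
        simp only [map_sum, map_smul, LinearMap.sum_apply, LinearMap.smul_apply,
          basis_repr_eq_dualBasis hB, hd]
    _ = ∑ j, ∑ i, repForm ρ (d j) (c * b i) • F (b j) (d i) := Finset.sum_comm
    _ = ∑ j, F (b j) (d j * c) := by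
        refine Finset.sum_congr rfl fun j _ => ?_
        conv_rhs => rw [← d.sum_repr (d j * c)]
        simp only [map_sum, map_smul, hd, LinearMap.BilinForm.dualBasis_repr_apply]
        refine Finset.sum_congr rfl fun i _ => ?_
        congr 1
        rw [repForm_apply, repForm_apply, Subalgebra.coe_mul, Subalgebra.coe_mul, mul_assoc]

/-- The Casimir element of the trace form is invertible. -/
theorem exists_mul_casimir_eq_one (hB : (repForm ρ).Nondegenerate)
    (b : Module.Basis ι ℝ (repAlgebra ρ)) :
    ∃ w : repAlgebra ρ, (∑ i, b i * (repForm ρ).dualBasis hB b i) * w = 1 ∧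
      ∀ a, a * w = w * a := by
  set d := (repForm ρ).dualBasis hB b with hd
  set z := ∑ i, b i * d i with hz
  have hcen : ∀ c, c * z = z * c := by
    intro c
    have := sum_mul_dualBasis hB b (LinearMap.mul ℝ (repAlgebra ρ)) c
    simp only [LinearMap.mul_apply', mul_assoc] at this
    rw [hz, Finset.mul_sum, Finset.sum_mul, this]
    simp only [mul_assoc, hd]
  -- In dual bases the trace of left multiplication by `c` is `∑ tr(dᵢ c bᵢ) = tr(c z)`, as `z = ∑
  -- bᵢ dᵢ`.
  have htr : ∀ c : repAlgebra ρ,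
      LinearMap.trace ℝ (repAlgebra ρ) (LinearMap.mulLeft ℝ c) =
        ((c * z : repAlgebra ρ) : Matrix Idx Idx ℝ).trace := by
    intro c
    rw [LinearMap.trace_eq_matrix_trace ℝ b, Matrix.trace]
    simp only [Matrix.diag_apply, LinearMap.toMatrix_apply, LinearMap.mulLeft_apply,
      basis_repr_eq_dualBasis hB]
    rw [hz, Finset.mul_sum, AddSubmonoidClass.coe_finsetSum, Matrix.trace_sum]
    refine Finset.sum_congr rfl fun i _ => ?_
    rw [repForm_apply, Matrix.trace_mul_comm, ← mul_assoc]
    rfl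
  -- If `c z = 0`, left multiplication by `c` has powers of trace zero, so `c` is nilpotent. As `z`
  -- is central the same holds for every `c a`, so `c` is in the radical of the trace form.
  have hinj : ∀ c : repAlgebra ρ, c * z = 0 → c = 0 := by
    have hnil : ∀ c : repAlgebra ρ, c * z = 0 → IsNilpotent c := by
      intro c hc
      have h1 : IsNilpotent (LinearMap.mulLeft ℝ c) := by
        refine isNilpotent_of_trace_pow_eq_zero _ fun k => ?_
        rw [LinearMap.pow_mulLeft, htr, pow_succ, mul_assoc, hc, mul_zero]
        exact Matrix.trace_zero _ _
      obtain ⟨n, hn⟩ := h1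
      refine ⟨n, ?_⟩
      rw [LinearMap.pow_mulLeft] at hn
      simpa using LinearMap.congr_fun hn 1
    intro c hc
    refine hB.1 c fun a => ?_
    have h1 : c * a * z = 0 := by rw [mul_assoc, hcen, ← mul_assoc, hc, zero_mul]
    have h2 := (hnil _ h1).map (repAlgebra ρ).val
    exact trace_eq_zero_of_isNilpotent h2
  have hker : LinearMap.ker (LinearMap.mulLeft ℝ z) = ⊥ := by
    rw [LinearMap.ker_eq_bot']
    intro c hc
    refine hinj c ?_
    rw [hcen]
    exact hc
  obtain ⟨w, hw⟩ := (LinearMap.injective_iff_surjective.1 (LinearMap.ker_eq_bot.1 hker)) 1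
  have hw : z * w = 1 := hw
  have hw' : w * z = 1 := by rw [hcen, hw]
  refine ⟨w, hw, fun a => ?_⟩
  calc a * w = w * z * (a * w) := by rw [hw', one_mul]
    _ = w * (z * a) * w := by simp only [mul_assoc]
    _ = w * a * (z * w) := by rw [← hcen a]; simp only [mul_assoc]
    _ = w * a := by rw [hw, mul_one]

end Algebra

/-! ### Square roots of selfadjoint matrices near the identity -/

/-- Half of the trace of a matrix that is selfadjoint for the symplectic form. -/
def pfTrace (P : Matrix Idx Idx ℝ) : ℝ := P (.inl 0) (.inl 0) + P (.inl 1) (.inl 1)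

/-- The Pfaffian determinant of a matrix that is selfadjoint for the symplectic form. -/
def pfDet (P : Matrix Idx Idx ℝ) : ℝ :=
  P (.inl 0) (.inl 0) * P (.inl 1) (.inl 1) - P (.inl 0) (.inl 1) * P (.inl 1) (.inl 0) +
    P (.inl 0) (.inr 1) * P (.inr 0) (.inl 1)

/-- A matrix selfadjoint for a symplectic form on `ℝ⁴` has a characteristic polynomial that is the
square of a quadratic, and it already satisfies that quadratic. The identity is checked in `2 × 2`
blocks. -/
theorem mul_self_eq_of_symplAdj_eq {P : Matrix Idx Idx ℝ} (hP : symplAdj P = P) :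
    P * P = pfTrace P • P - pfDet P • (1 : Matrix Idx Idx ℝ) := by
  obtain ⟨A, B, C, D, rfl⟩ : ∃ A B C D : Matrix (Fin 2) (Fin 2) ℝ, P = Matrix.fromBlocks A B C D :=
    ⟨_, _, _, _, (Matrix.fromBlocks_toBlocks P).symm⟩
  simp only [symplAdj, Matrix.J, Matrix.fromBlocks_transpose, Matrix.fromBlocks_neg,
    Matrix.fromBlocks_multiply, Matrix.fromBlocks_inj, neg_zero, neg_neg, Matrix.zero_mul,
    Matrix.mul_zero, Matrix.one_mul, Matrix.mul_one, Matrix.neg_mul, Matrix.mul_neg, zero_add,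
    add_zero] at hP
  obtain ⟨hA, hB, hC, -⟩ := hP
  have hD : D = A.transpose := by rw [← hA, Matrix.transpose_transpose]
  have hB0 := fun i j => congrFun (congrFun hB i) j
  have hC0 := fun i j => congrFun (congrFun hC i) j
  simp only [Matrix.neg_apply, Matrix.transpose_apply] at hB0 hC0
  have b00 : B 0 0 = 0 := by linarith [hB0 0 0]
  have b11 : B 1 1 = 0 := by linarith [hB0 1 1]
  have b10 : B 1 0 = -B 0 1 := by linarith [hB0 0 1]
  have c00 : C 0 0 = 0 := by linarith [hC0 0 0]
  have c11 : C 1 1 = 0 := by linarith [hC0 1 1]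
  have c10 : C 1 0 = -C 0 1 := by linarith [hC0 0 1]
  subst hD
  rw [eq_sub_iff_add_eq, Matrix.fromBlocks_multiply, ← Matrix.fromBlocks_one,
    Matrix.fromBlocks_smul, Matrix.fromBlocks_smul, Matrix.fromBlocks_add, Matrix.fromBlocks_inj]
  refine ⟨?_, ?_, ?_, ?_⟩ <;> ext i j <;> fin_cases i <;> fin_cases j <;>
    simp [Matrix.mul_apply, Fin.sum_univ_two, pfTrace, pfDet, b00, b11, b10, c00, c11, c10] <;>
    ring

theorem exists_sq_eq {P : Matrix Idx Idx ℝ} (hP : symplAdj P = P) (ht : 0 < pfTrace P)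
    (hd : 0 < pfDet P) :
    ∃ α β : ℝ, (α • (1 : Matrix Idx Idx ℝ) + β • P) * (α • (1 : Matrix Idx Idx ℝ) + β • P) = P := by
  set t := pfTrace P
  set d := pfDet P
  have hu : 0 < t + 2 * √d := by positivity
  -- From `P² = tP - d` one gets `(P + √d)² = (t + 2√d) P`; divide by `t + 2√d`.
  refine ⟨√d / √(t + 2 * √d), 1 / √(t + 2 * √d), ?_⟩
  have h1 : √(t + 2 * √d) * √(t + 2 * √d) = t + 2 * √d := Real.mul_self_sqrt hu.le
  have h2 : √d * √d = d := Real.mul_self_sqrt hd.le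
  have h3 : √(t + 2 * √d) ≠ 0 := (Real.sqrt_pos.2 hu).ne'
  set r := √(t + 2 * √d)
  set e := √d
  have hP2 : P * P = t • P - d • (1 : Matrix Idx Idx ℝ) := mul_self_eq_of_symplAdj_eq hP
  have h4 : ((e / r) • (1 : Matrix Idx Idx ℝ) + (1 / r) • P) *
      ((e / r) • (1 : Matrix Idx Idx ℝ) + (1 / r) • P) =
      ((e / r) * (e / r) - (1 / r) * (1 / r) * d) • (1 : Matrix Idx Idx ℝ) +
      (2 * (e / r) * (1 / r) + (1 / r) * (1 / r) * t) • P := by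
    simp only [add_mul, mul_add, smul_mul_smul_comm, one_mul, mul_one, hP2]
    module
  rw [h4]
  have h5 : (e / r) * (e / r) - (1 / r) * (1 / r) * d = 0 := by
    rw [← h2]
    field_simp
    ring
  have h6 : 2 * (e / r) * (1 / r) + (1 / r) * (1 / r) * t = 1 := by
    field_simp
    rw [pow_two, h1]
    ring
  rw [h5, h6, zero_smul, one_smul, zero_add]

/-- A matrix close to the symplectic group is a product of a symplectic matrix and a matrix that is
selfadjoint for the symplectic form. -/
theorem exists_symplectic_polar {S : Matrix Idx Idx ℝ} (hS : IsUnit S)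
    (ht : 0 < pfTrace (symplAdj S * S)) (hd : 0 < pfDet (symplAdj S * S)) :
    ∃ (s : Sp4) (R : Matrix Idx Idx ℝ), S = s * R ∧ IsUnit R ∧
      ∀ Y, Commute (symplAdj S * S) Y → Commute R Y := by
  set P := symplAdj S * S with hPdef
  have hP : symplAdj P = P := by rw [hPdef, symplAdj_mul, symplAdj_symplAdj]
  obtain ⟨α, β, hR⟩ := exists_sq_eq hP ht hd
  -- `R` is a square root of `symplAdj S * S` and a polynomial in it, hence selfadjoint and
  -- commuting with whatever commutes with `P`. The symplectic factor is `S R⁻¹`.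
  set R := α • (1 : Matrix Idx Idx ℝ) + β • P with hRdef
  have hPu : IsUnit P := by
    refine IsUnit.mul ?_ hS
    obtain ⟨u, rfl⟩ := hS
    refine ⟨⟨symplAdj u, symplAdj (u⁻¹ : (Matrix Idx Idx ℝ)ˣ), ?_, ?_⟩, rfl⟩
    · rw [← symplAdj_mul, Units.inv_mul, symplAdj_one]
    · rw [← symplAdj_mul, Units.mul_inv, symplAdj_one]
  have hRu : IsUnit R := by
    rw [← hR] at hPu
    exact isUnit_of_mul_isUnit_left hPu
  have hRadj : symplAdj R = R := by
    rw [hRdef, ← symplAdjLin_apply, map_add, map_smul, map_smul, symplAdjLin_apply,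
      symplAdjLin_apply, hP, symplAdj_one]
  obtain ⟨u, hu⟩ := hRu
  have huadj : symplAdj ((u⁻¹ : (Matrix Idx Idx ℝ)ˣ) : Matrix Idx Idx ℝ) =
      (u⁻¹ : (Matrix Idx Idx ℝ)ˣ) := by
    refine u.isUnit.mul_right_cancel ?_
    rw [Units.inv_mul]
    conv_lhs => rw [hu, ← hRadj, ← hu, ← symplAdj_mul, Units.mul_inv, symplAdj_one]
  have hs : S * (u⁻¹ : (Matrix Idx Idx ℝ)ˣ) ∈ Matrix.symplecticGroup (Fin 2) ℝ := by
    rw [mem_symplecticGroup_iff_mul_symplAdj]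
    refine mul_eq_one_comm.1 ?_
    rw [symplAdj_mul, huadj]
    calc ((u⁻¹ : (Matrix Idx Idx ℝ)ˣ) : Matrix Idx Idx ℝ) * symplAdj S *
          (S * (u⁻¹ : (Matrix Idx Idx ℝ)ˣ))
        = (u⁻¹ : (Matrix Idx Idx ℝ)ˣ) * P * (u⁻¹ : (Matrix Idx Idx ℝ)ˣ) := by
          rw [hPdef]; simp only [mul_assoc]
      _ = ((u⁻¹ : (Matrix Idx Idx ℝ)ˣ) : Matrix Idx Idx ℝ) * u *
          (u * (u⁻¹ : (Matrix Idx Idx ℝ)ˣ)) := by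
          rw [← hR, ← hu]; simp only [mul_assoc]
      _ = 1 := by rw [Units.inv_mul, Units.mul_inv, one_mul]
  refine ⟨⟨_, hs⟩, u, ?_, u.isUnit, fun Y hY => ?_⟩
  · change S = S * (u⁻¹ : (Matrix Idx Idx ℝ)ˣ) * u
    rw [mul_assoc, Units.inv_mul, mul_one]
  · rw [hu]
    exact ((Commute.one_left Y).smul_left α).add_left (hY.smul_left β)

/-! ### Completely reducible representations have closed orbits -/

/-- Conjugation by `g` on real matrices. -/
def conjR (g : Sp4) : Matrix Idx Idx ℝ →ₐ[ℝ] Matrix Idx Idx ℝ where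
  toFun Y := (g : Matrix Idx Idx ℝ) * Y * ((g⁻¹ : Sp4) : Matrix Idx Idx ℝ)
  map_one' := by rw [mul_one, ← Submonoid.coe_mul, mul_inv_cancel, Submonoid.coe_one]
  map_mul' A B := by
    have h : ((g⁻¹ : Sp4) : Matrix Idx Idx ℝ) * (g : Matrix Idx Idx ℝ) = 1 := by
      rw [← Submonoid.coe_mul, inv_mul_cancel, Submonoid.coe_one]
    rw [show (g : Matrix Idx Idx ℝ) * A * ((g⁻¹ : Sp4) : Matrix Idx Idx ℝ) *
      ((g : Matrix Idx Idx ℝ) * B * ((g⁻¹ : Sp4) : Matrix Idx Idx ℝ)) =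
      g * A * (((g⁻¹ : Sp4) : Matrix Idx Idx ℝ) * (g : Matrix Idx Idx ℝ)) * B *
        ((g⁻¹ : Sp4) : Matrix Idx Idx ℝ) by simp only [mul_assoc], h, mul_one]
    simp only [mul_assoc]
  map_zero' := by rw [mul_zero, zero_mul]
  map_add' A B := by rw [mul_add, add_mul]
  commutes' c := by
    rw [Algebra.algebraMap_eq_smul_one, mul_smul_comm, smul_mul_assoc, mul_one,
      ← Submonoid.coe_mul, mul_inv_cancel, Submonoid.coe_one]

theorem conjR_apply (g : Sp4) (Y : Matrix Idx Idx ℝ) :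
    conjR g Y = (g : Matrix Idx Idx ℝ) * Y * ((g⁻¹ : Sp4) : Matrix Idx Idx ℝ) := rfl

theorem conjR_mul (g h : Sp4) (Y : Matrix Idx Idx ℝ) : conjR (g * h) Y = conjR g (conjR h Y) := by
  rw [conjR_apply, conjR_apply, conjR_apply, mul_inv_rev, Submonoid.coe_mul, Submonoid.coe_mul]
  simp only [mul_assoc]

theorem conjR_symplAdj (g : Sp4) (Y : Matrix Idx Idx ℝ) :
    conjR g (symplAdj Y) = symplAdj (conjR g Y) := by
  rw [conjR_apply, conjR_apply, symplAdj_mul, symplAdj_mul, coe_inv_eq_symplAdj,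
    symplAdj_symplAdj, mul_assoc]

theorem continuous_symplAdj : Continuous (symplAdj : Matrix Idx Idx ℝ → Matrix Idx Idx ℝ) := by
  unfold symplAdj
  fun_prop

variable {π : Type*} [Group π] {ρ : π →* Sp4}

/-- Limits pass to products and sums, and to inverses because the inverse of a symplectic matrix is
its adjoint, a continuous function of it. The `g n` themselves need not converge. -/
theorem exists_tendsto_conjR {k : ℕ} {γ : Fin k → π} (hγ : Subgroup.closure (Set.range γ) = ⊤)
    {g : ℕ → Sp4} {y : Fin k → Matrix Idx Idx ℝ}
    (hy : ∀ i, Tendsto (fun n => conjR (g n) (ρ (γ i) : Matrix Idx Idx ℝ)) atTop (𝓝 (y i))) :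
    ∀ A ∈ repAlgebra ρ, ∃ L, Tendsto (fun n => conjR (g n) A) atTop (𝓝 L) := by
  have hadj : ∀ A L, Tendsto (fun n => conjR (g n) A) atTop (𝓝 L) →
      Tendsto (fun n => conjR (g n) (symplAdj A)) atTop (𝓝 (symplAdj L)) := by
    intro A L h
    simp only [conjR_symplAdj]
    exact (continuous_symplAdj.tendsto L).comp h
  have hπ : ∀ x : π, ∃ L, Tendsto (fun n => conjR (g n) (ρ x : Matrix Idx Idx ℝ)) atTop (𝓝 L) := by
    intro x
    have hx : x ∈ Subgroup.closure (Set.range γ) := hγ ▸ Subgroup.mem_top x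
    induction hx using Subgroup.closure_induction with
    | mem x hx => obtain ⟨i, rfl⟩ := hx; exact ⟨y i, hy i⟩
    | one => exact ⟨1, by simp⟩
    | mul x z _ _ hx hz =>
      obtain ⟨L, hL⟩ := hx
      obtain ⟨L', hL'⟩ := hz
      refine ⟨L * L', ?_⟩
      simp only [map_mul, Submonoid.coe_mul]
      exact hL.mul hL'
    | inv x _ hx =>
      obtain ⟨L, hL⟩ := hx
      refine ⟨symplAdj L, ?_⟩
      rw [map_inv, coe_inv_eq_symplAdj]
      exact hadj _ _ hL
  intro A hA
  induction hA using Algebra.adjoin_induction with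
  | mem a ha => obtain ⟨x, rfl⟩ := ha; exact hπ x
  | algebraMap r => exact ⟨algebraMap ℝ _ r, by simp only [AlgHom.commutes]; exact tendsto_const_nhds⟩
  | add a b _ _ ha hb =>
    obtain ⟨L, hL⟩ := ha
    obtain ⟨L', hL'⟩ := hb
    exact ⟨L + L', by simp only [map_add]; exact hL.add hL'⟩
  | mul a b _ _ ha hb =>
    obtain ⟨L, hL⟩ := ha
    obtain ⟨L', hL'⟩ := hb
    exact ⟨L * L', by simp only [map_mul]; exact hL.mul hL'⟩

/-- The orbit of a completely reducible representation is closed. -/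
theorem isClosed_conjOrbit {k : ℕ} {γ : Fin k → π} (hγ : Subgroup.closure (Set.range γ) = ⊤)
    (hcomp : ∀ K : Submodule ℝ (Idx → ℝ), IsInvariant ρ K →
      ∃ K' : Submodule ℝ (Idx → ℝ), IsCompl K K' ∧ IsInvariant ρ K') :
    IsClosed (conjOrbit (evalGenerators γ ρ)) := by
  classical
  refine isClosed_of_closure_subset fun y hy => ?_
  have : FirstCountableTopology (Matrix Idx Idx ℝ) :=
    inferInstanceAs (FirstCountableTopology (Idx → Idx → ℝ))
  obtain ⟨x, hx, hxy⟩ := mem_closure_iff_seq_limit.1 hy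
  choose g hg using hx
  have hgy : ∀ i, Tendsto (fun n => conjR (g n) (ρ (γ i) : Matrix Idx Idx ℝ)) atTop (𝓝 (y i)) := by
    intro i
    have := (tendsto_pi_nhds.1 hxy) i
    simp only [← hg] at this
    exact this
  choose! Φ₀ hΦ₀ using exists_tendsto_conjR hγ hgy
  -- The pointwise limit of the conjugations is a homomorphism of algebras that respects the
  -- symplectic adjoint.
  let Φ : repAlgebra ρ →ₗ[ℝ] Matrix Idx Idx ℝ :=
    { toFun := fun a => Φ₀ a
      map_add' := fun a b => tendsto_nhds_unique (hΦ₀ _ (a + b).2) (by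
        simp only [Subalgebra.coe_add, map_add]
        exact (hΦ₀ _ a.2).add (hΦ₀ _ b.2))
      map_smul' := fun c a => tendsto_nhds_unique (hΦ₀ _ (c • a).2) (by
        simp only [Subalgebra.coe_smul, map_smul]
        exact (hΦ₀ _ a.2).const_smul c) }
  have hΦ : ∀ a : repAlgebra ρ,
      Tendsto (fun n => conjR (g n) (a : Matrix Idx Idx ℝ)) atTop (𝓝 (Φ a)) := fun a => hΦ₀ _ a.2
  have hΦmul : ∀ a b : repAlgebra ρ, Φ (a * b) = Φ a * Φ b := fun a b =>
    tendsto_nhds_unique (hΦ (a * b)) (by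
      simp only [Subalgebra.coe_mul, map_mul]
      exact (hΦ a).mul (hΦ b))
  have hΦone : Φ 1 = 1 := tendsto_nhds_unique (hΦ 1) (by simp)
  have hΦadj : ∀ a : repAlgebra ρ, Φ ⟨symplAdj a, symplAdj_mem_repAlgebra a.2⟩ = symplAdj (Φ a) :=
    fun a => tendsto_nhds_unique (hΦ _) (by
      simp only [conjR_symplAdj]
      exact (continuous_symplAdj.tendsto _).comp (hΦ a))
  have hB := repForm_nondegenerate hcomp
  let b := Module.finBasis ℝ (repAlgebra ρ)
  set d := (repForm ρ).dualBasis hB b with hd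
  obtain ⟨w, hzw, hwcomm⟩ := exists_mul_casimir_eq_one hB b
  rw [← hd] at hzw
  -- Averaging with the Casimir element intertwines `conjR (g n)` with `Φ`. The factor `Φ w`, with
  -- `w` inverse to the Casimir element, normalizes the limit to `1`.
  let S : ℕ → Matrix Idx Idx ℝ := fun n =>
    (∑ i, conjR (g n) (b i : Matrix Idx Idx ℝ) * Φ (d i)) * Φ w
  have hS1 : Tendsto S atTop (𝓝 1) := by
    have h1 : (∑ i, Φ (b i) * Φ (d i)) * Φ w = 1 := by
      rw [← hΦone, ← hzw, hΦmul, map_sum]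
      simp only [hΦmul]
    rw [← h1]
    exact (tendsto_finsetSum _ fun i _ => (hΦ (b i)).mul tendsto_const_nhds).mul
      tendsto_const_nhds
  have hSint : ∀ n, ∀ a : repAlgebra ρ,
      conjR (g n) (a : Matrix Idx Idx ℝ) * S n = S n * Φ a := by
    intro n a
    have h1 := sum_mul_dualBasis hB b ((LinearMap.mul ℝ (Matrix Idx Idx ℝ)).compl₁₂
      ((conjR (g n)).toLinearMap ∘ₗ (repAlgebra ρ).val.toLinearMap) Φ) a
    simp only [LinearMap.compl₁₂_apply, LinearMap.mul_apply', LinearMap.comp_apply,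
      AlgHom.toLinearMap_apply, Subalgebra.coe_val, map_mul, hΦmul, ← hd,
      ← mul_assoc] at h1
    change _ * ((∑ i, conjR (g n) (b i : Matrix Idx Idx ℝ) * Φ (d i)) * Φ w) =
      (∑ i, conjR (g n) (b i : Matrix Idx Idx ℝ) * Φ (d i)) * Φ w * Φ a
    rw [← Finset.sum_mul] at h1
    rw [mul_assoc _ (Φ w), ← hΦmul, ← hwcomm, hΦmul, ← mul_assoc, ← mul_assoc, ← h1,
      Finset.mul_sum]
    simp only [← mul_assoc]
  clear_value S
  have hP1 : Tendsto (fun n => symplAdj (S n) * S n) atTop (𝓝 1) := by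
    have := ((continuous_symplAdj.tendsto 1).comp hS1).mul hS1
    rwa [symplAdj_one, one_mul] at this
  have hct : Continuous pfTrace := by unfold pfTrace; fun_prop
  have hcd : Continuous pfDet := by unfold pfDet; fun_prop
  have ht : ∀ᶠ n in atTop, 0 < pfTrace (symplAdj (S n) * S n) :=
    ((hct.tendsto 1).comp hP1).eventually (lt_mem_nhds (by simp [pfTrace]))
  have hdt : ∀ᶠ n in atTop, 0 < pfDet (symplAdj (S n) * S n) :=
    ((hcd.tendsto 1).comp hP1).eventually (lt_mem_nhds (by simp [pfDet]))
  have hdet : ∀ᶠ n in atTop, 0 < (S n).det :=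
    (((continuous_id.matrix_det).tendsto (1 : Matrix Idx Idx ℝ)).comp hS1).eventually
      (lt_mem_nhds (by simp))
  obtain ⟨n, hn1, hn2, hn3⟩ := (ht.and (hdt.and hdet)).exists
  obtain ⟨s, R, hSR, hR, hcomm⟩ := exists_symplectic_polar
    ((Matrix.isUnit_iff_isUnit_det _).2 hn3.ne'.isUnit) hn1 hn2
  -- Taking adjoints of the intertwining relation shows that `symplAdj S * S` commutes with the
  -- image of `Φ`, hence so does its square root `R`. The symplectic factor `s` then intertwines as
  -- well.
  have hRΦ : ∀ a, Commute R (Φ a) := by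
    intro a
    refine hcomm _ ?_
    have h1 := congrArg symplAdj (hSint n ⟨symplAdj a, symplAdj_mem_repAlgebra a.2⟩)
    rw [hΦadj, symplAdj_mul, symplAdj_mul, conjR_symplAdj, symplAdj_symplAdj,
      symplAdj_symplAdj] at h1
    rw [Commute, SemiconjBy, mul_assoc, ← hSint, ← mul_assoc, h1, mul_assoc]
  refine ⟨s⁻¹ * g n, funext fun i => ?_⟩
  let a : repAlgebra ρ := ⟨(ρ (γ i) : Matrix Idx Idx ℝ), coe_mem_repAlgebra _⟩
  have hya : y i = Φ a := tendsto_nhds_unique (hgy i) (hΦ a)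
  change conjR (s⁻¹ * g n) (a : Matrix Idx Idx ℝ) = y i
  have h2 : conjR (g n) (a : Matrix Idx Idx ℝ) * s = s * Φ a := by
    refine hR.mul_right_cancel ?_
    rw [mul_assoc, ← hSR, hSint, hSR, mul_assoc, (hRΦ a).eq, mul_assoc]
  rw [hya, conjR_mul, conjR_apply, inv_inv, mul_assoc, h2, ← mul_assoc, ← Submonoid.coe_mul,
    inv_mul_cancel, Submonoid.coe_one, one_mul]

end SpFour

/-! ### From closed orbits to invariant splittings, by minimal vectors. -/

namespace SpFour

open Filter Topology

/-! ### The symplectic form -/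

theorem omega_apply (v w : Idx → ℝ) : omega v w = v ⬝ᵥ (Matrix.J (Fin 2) ℝ).mulVec w :=
  Matrix.toBilin'_apply' _ _ _

theorem omega_mulVec_left (A : Matrix Idx Idx ℝ) (v w : Idx → ℝ) :
    omega (A.mulVec v) w = omega v ((symplAdj A).mulVec w) := by
  have hJ : Matrix.J (Fin 2) ℝ * Matrix.J (Fin 2) ℝ = -1 := Matrix.J_squared _ _
  have h : Matrix.J (Fin 2) ℝ * symplAdj A = A.transpose * Matrix.J (Fin 2) ℝ := by
    rw [symplAdj, ← mul_assoc, ← mul_assoc, mul_neg, hJ, neg_neg, one_mul]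
  rw [omega_apply, omega_apply, Matrix.mulVec_mulVec, h, ← Matrix.mulVec_mulVec,
    Matrix.dotProduct_mulVec v, Matrix.vecMul_transpose]

theorem omega_mulVec_right (A : Matrix Idx Idx ℝ) (v w : Idx → ℝ) :
    omega v (A.mulVec w) = omega ((symplAdj A).mulVec v) w := by
  rw [omega_mulVec_left, symplAdj_symplAdj]

theorem omega_neg_swap (v w : Idx → ℝ) : omega v w = -omega w v := by
  rw [omega_apply, omega_apply, Matrix.dotProduct_mulVec, ← Matrix.mulVec_transpose,
    Matrix.J_transpose, Matrix.neg_mulVec, neg_dotProduct, dotProduct_comm]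

theorem omega_isRefl : omega.IsRefl := fun v w h => by rw [omega_neg_swap, h, neg_zero]

theorem omega_nondegenerate : omega.Nondegenerate :=
  LinearMap.BilinForm.nondegenerate_toBilin'_of_det_ne_zero' _
    (Matrix.isUnit_det_J (Fin 2) ℝ).ne_zero

theorem eq_zero_of_omega_eq_zero {w : Idx → ℝ} (h : ∀ v, omega v w = 0) : w = 0 :=
  omega_nondegenerate.2 w h

theorem orthogonal_orthogonal_omega (V : Submodule ℝ (Idx → ℝ)) :
    omega.orthogonal (omega.orthogonal V) = V :=
  LinearMap.BilinForm.orthogonal_orthogonal omega_nondegenerate omega_isRefl V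

theorem mem_orthogonal_omega {V : Submodule ℝ (Idx → ℝ)} {w : Idx → ℝ} :
    w ∈ omega.orthogonal V ↔ ∀ v ∈ V, omega v w = 0 := Iff.rfl

theorem matrix_eq_zero_of_mulVec {A : Matrix Idx Idx ℝ} (h : ∀ v, A.mulVec v = 0) : A = 0 :=
  Matrix.toLin'.injective (LinearMap.ext fun v => by simpa using h v)

theorem isInvariant_orthogonal {π : Type*} [Group π] {ρ : π →* Sp4} {V : Submodule ℝ (Idx → ℝ)}
    (hV : IsInvariant ρ V) : IsInvariant ρ (omega.orthogonal V) := by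
  intro x w hw
  rw [mem_orthogonal_omega] at hw ⊢
  intro v hv
  rw [omega_mulVec_right, ← coe_inv_eq_symplAdj, ← map_inv]
  exact hw _ (hV x⁻¹ v hv)

/-! ### Splittings from projections -/

/-- Let `Q` be the symplectic adjoint of `P`; then `V = ker Q`. The idempotents satisfy `Q P = 0`
because `V` is coisotropic and `P Q = 0` by hypothesis, which says that the range of `Q` is
isotropic. Take `W = ker P ⊓ ker Q` and `L = range Q`. -/
theorem hasInvariantSplitting_of_projection {π : Type*} [Group π] {ρ : π →* Sp4}
    {V : Submodule ℝ (Idx → ℝ)} (hV : IsCoisotropic V) {P : Matrix Idx Idx ℝ}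
    (hPmem : ∀ v, P.mulVec v ∈ omega.orthogonal V)
    (hPfix : ∀ v ∈ omega.orthogonal V, P.mulVec v = v) (hPQ : P * symplAdj P = 0)
    (hcomm : ∀ x, Commute (ρ x : Matrix Idx Idx ℝ) P) : HasInvariantSplitting ρ V := by
  set K := omega.orthogonal V with hK
  set Q := symplAdj P with hQ
  have hkerQ : ∀ v, v ∈ V ↔ Q.mulVec v = 0 := by
    intro v
    rw [← orthogonal_orthogonal_omega V, ← hK, mem_orthogonal_omega]
    constructor
    · intro h
      refine eq_zero_of_omega_eq_zero fun w => ?_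
      rw [hQ, ← omega_mulVec_left]
      exact h _ (hPmem w)
    · intro h w hw
      rw [← hPfix w hw, omega_mulVec_left, ← hQ, h, map_zero]
  have hPP : P * P = P := by
    rw [← sub_eq_zero]
    refine matrix_eq_zero_of_mulVec fun v => ?_
    rw [Matrix.sub_mulVec, ← Matrix.mulVec_mulVec, hPfix _ (hPmem v), sub_self]
  have hQQ : Q * Q = Q := by rw [hQ, ← symplAdj_mul, hPP]
  have hQP : Q * P = 0 := by
    refine matrix_eq_zero_of_mulVec fun v => ?_
    rw [← Matrix.mulVec_mulVec, ← hkerQ]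
    exact hV (hPmem v)
  have mv : ∀ (A B : Matrix Idx Idx ℝ) (v : Idx → ℝ), A.mulVec (B.mulVec v) = (A * B).mulVec v :=
    fun A B v => Matrix.mulVec_mulVec v A B
  have hcommQ : ∀ x, Commute (ρ x : Matrix Idx Idx ℝ) Q := by
    intro x
    have h := congrArg symplAdj (hcomm x⁻¹).eq
    rw [symplAdj_mul, symplAdj_mul, map_inv, coe_inv_eq_symplAdj, symplAdj_symplAdj] at h
    exact h.symm
  refine ⟨LinearMap.ker P.mulVecLin ⊓ LinearMap.ker Q.mulVecLin, LinearMap.range Q.mulVecLin,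
    ?_, ?_, ?_, ?_, ?_, ?_, ?_, ?_, ?_⟩
  · rw [← disjoint_iff, Submodule.disjoint_def]
    intro v hv hv'
    rw [← hPfix v hv']
    exact hv.1
  · apply le_antisymm
    · refine sup_le (fun v hv => (hkerQ v).2 hv.2) hV
    · intro v hv
      rw [← sub_add_cancel v (P.mulVec v)]
      refine Submodule.add_mem_sup ⟨?_, ?_⟩ (hPmem v)
      · change P.mulVec _ = 0
        rw [Matrix.mulVec_sub, mv, hPP, sub_self]
      · change Q.mulVec _ = 0
        rw [Matrix.mulVec_sub, mv, hQP, (hkerQ v).1 hv, Matrix.zero_mulVec, sub_self]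
  · constructor
    · rw [Submodule.disjoint_def]
      rintro _ hv ⟨v, rfl⟩
      have := (hkerQ _).1 hv
      rwa [Matrix.mulVecLin_apply, mv, hQQ] at this
    · rw [codisjoint_iff, eq_top_iff]
      intro v _
      rw [← sub_add_cancel v (Q.mulVec v)]
      refine Submodule.add_mem_sup ((hkerQ _).2 ?_) ⟨v, rfl⟩
      rw [Matrix.mulVec_sub, mv, hQQ, sub_self]
  · constructor
    · rw [Submodule.disjoint_def]
      rintro y ⟨hy1, hy2⟩ hy
      obtain ⟨_, ⟨l, rfl⟩, k, hk, rfl⟩ := Submodule.mem_sup.1 hy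
      have h1 : P.mulVec (Q.mulVec l + k) = 0 := hy1
      have h2 : Q.mulVec (Q.mulVec l + k) = 0 := hy2
      rw [Matrix.mulVec_add, mv, hPQ, Matrix.zero_mulVec, zero_add, hPfix k hk] at h1
      rw [Matrix.mulVec_add, mv, hQQ, h1, Matrix.mulVec_zero, add_zero] at h2
      rw [Matrix.mulVecLin_apply, h1, h2, add_zero]
    · rw [codisjoint_iff, eq_top_iff]
      intro v _
      rw [← sub_add_cancel v (Q.mulVec v + P.mulVec v)]
      refine Submodule.add_mem_sup ⟨?_, ?_⟩ (Submodule.add_mem_sup ⟨v, rfl⟩ (hPmem v))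
      · change P.mulVec _ = 0
        rw [Matrix.mulVec_sub, Matrix.mulVec_add, mv, mv, hPQ, hPP, Matrix.zero_mulVec, zero_add,
          sub_self]
      · change Q.mulVec _ = 0
        rw [Matrix.mulVec_sub, Matrix.mulVec_add, mv, mv, hQQ, hQP, Matrix.zero_mulVec, add_zero,
          sub_self]
  · rintro w ⟨hw1, hw2⟩ u hu
    obtain ⟨_, ⟨l, rfl⟩, k, hk, rfl⟩ := Submodule.mem_sup.1 hu
    rw [map_add, hk w ((hkerQ w).2 hw2), add_zero, Matrix.mulVecLin_apply, hQ, ← omega_mulVec_left,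
      show P.mulVec w = 0 from hw1, map_zero, LinearMap.zero_apply]
  · rintro _ ⟨l, rfl⟩ _ ⟨l', rfl⟩
    rw [Matrix.mulVecLin_apply, Matrix.mulVecLin_apply, hQ, ← omega_mulVec_left, ← hQ, mv, hPQ,
      Matrix.zero_mulVec, map_zero, LinearMap.zero_apply]
  · rintro x v ⟨hv1, hv2⟩
    refine ⟨?_, ?_⟩
    · change P.mulVec _ = 0
      rw [mv, ← (hcomm x).eq, ← mv, show P.mulVec v = 0 from hv1, Matrix.mulVec_zero]
    · change Q.mulVec _ = 0
      rw [mv, ← (hcommQ x).eq, ← mv, show Q.mulVec v = 0 from hv2, Matrix.mulVec_zero]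
  · rintro x _ ⟨l, rfl⟩
    rw [Matrix.mulVecLin_apply, mv, (hcommQ x).eq, ← mv]
    exact ⟨_, rfl⟩
  · intro x v hv
    rw [← hPfix v hv, mv, (hcomm x).eq, ← mv]
    exact hPmem _

/-! ### The Frobenius norm -/

/-- The square of the Frobenius norm. -/
def frob (A : Matrix Idx Idx ℝ) : ℝ := ∑ i, ∑ j, A i j ^ 2

theorem frob_nonneg (A : Matrix Idx Idx ℝ) : 0 ≤ frob A :=
  Finset.sum_nonneg fun _ _ => Finset.sum_nonneg fun _ _ => sq_nonneg _

theorem frob_eq_zero {A : Matrix Idx Idx ℝ} (h : frob A = 0) : A = 0 := by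
  ext i j
  have h1 := (Finset.sum_eq_zero_iff_of_nonneg fun i _ =>
    Finset.sum_nonneg fun j _ => sq_nonneg (A i j)).1 h i (Finset.mem_univ i)
  have h2 := (Finset.sum_eq_zero_iff_of_nonneg fun j _ => sq_nonneg (A i j)).1 h1 j
    (Finset.mem_univ j)
  simpa using h2

theorem frob_transpose (A : Matrix Idx Idx ℝ) : frob A.transpose = frob A := Finset.sum_comm

theorem frob_smul (c : ℝ) (A : Matrix Idx Idx ℝ) : frob (c • A) = c ^ 2 * frob A := by
  simp only [frob, Matrix.smul_apply, smul_eq_mul, mul_pow, Finset.mul_sum]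

theorem frob_zero : frob 0 = 0 := by simp [frob]

theorem frob_eq_trace (A : Matrix Idx Idx ℝ) : frob A = (A.transpose * A).trace := by
  rw [frob, Finset.sum_comm]
  simp only [Matrix.trace, Matrix.diag_apply, Matrix.mul_apply, Matrix.transpose_apply, pow_two]

/-- Symmetric idempotents summing to `1` decompose the Frobenius norm. -/
theorem frob_eq_add_mul_left {P Q R : Matrix Idx Idx ℝ} (hsum : P + R + Q = 1)
    (hP : P.transpose * P = P) (hQ : Q.transpose * Q = Q) (hR : R.transpose * R = R)
    (A : Matrix Idx Idx ℝ) : frob A = frob (P * A) + frob (R * A) + frob (Q * A) := by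
  have h : ∀ X : Matrix Idx Idx ℝ, X.transpose * X = X →
      frob (X * A) = (A.transpose * X * A).trace := by
    intro X hX
    rw [frob_eq_trace, Matrix.transpose_mul, mul_assoc, ← mul_assoc X.transpose, hX, mul_assoc]
  rw [h P hP, h Q hQ, h R hR, ← Matrix.trace_add, ← Matrix.trace_add, ← add_mul, ← add_mul,
    ← mul_add, ← mul_add, hsum, mul_one, frob_eq_trace]

theorem frob_eq_add_mul_right {P Q R : Matrix Idx Idx ℝ} (hsum : P + R + Q = 1)
    (hPt : P.transpose = P) (hQt : Q.transpose = Q) (hRt : R.transpose = R)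
    (hP : P * P = P) (hQ : Q * Q = Q) (hR : R * R = R)
    (A : Matrix Idx Idx ℝ) : frob A = frob (A * P) + frob (A * R) + frob (A * Q) := by
  have := frob_eq_add_mul_left hsum (by rw [hPt, hP]) (by rw [hQt, hQ]) (by rw [hRt, hR])
    A.transpose
  rw [frob_transpose, ← frob_transpose (P * _), ← frob_transpose (R * _),
    ← frob_transpose (Q * _), Matrix.transpose_mul, Matrix.transpose_mul, Matrix.transpose_mul,
    Matrix.transpose_transpose, hPt, hQt, hRt] at this
  exact this

/-- A closed orbit contains a tuple of minimal Frobenius norm. -/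
theorem exists_minimal_conj {k : ℕ} {x : Fin k → Matrix Idx Idx ℝ} (hx : IsClosed (conjOrbit x)) :
    ∃ g : Sp4, ∀ h : Sp4, ∑ i, frob (conjR g (x i)) ≤ ∑ i, frob (conjR h (x i)) := by
  -- As a plain function space this carries the sup norm, which the Frobenius norm dominates, so
  -- sublevel sets in the closed orbit are compact.
  let X := Fin k → Idx → Idx → ℝ
  let f : X → ℝ := fun y => ∑ i, frob (y i)
  have hf : Continuous f := by
    unfold f frob
    fun_prop
  let O : Set X := conjOrbit x
  have hO : IsClosed O := hx
  have hmem : ∀ h : Sp4, (fun i => conjR h (x i)) ∈ O := fun h => ⟨h, rfl⟩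
  let C : Set X := O ∩ {y | f y ≤ f (fun i => conjR 1 (x i))}
  have hC : IsCompact C := by
    refine Metric.isCompact_of_isClosed_isBounded
      (hO.inter (isClosed_le hf continuous_const)) ?_
    set c := f (fun i => conjR 1 (x i))
    refine (Metric.isBounded_closedBall (x := (0 : X)) (r := √c)).subset ?_
    rintro y ⟨-, hy⟩
    rw [mem_closedBall_zero_iff]
    refine (pi_norm_le_iff_of_nonneg (Real.sqrt_nonneg c)).2 fun i =>
      (pi_norm_le_iff_of_nonneg (Real.sqrt_nonneg c)).2 fun a =>
      (pi_norm_le_iff_of_nonneg (Real.sqrt_nonneg c)).2 fun b => ?_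
    refine Real.abs_le_sqrt (le_trans ?_ hy)
    calc y i a b ^ 2 ≤ ∑ b, y i a b ^ 2 :=
          Finset.single_le_sum (f := fun b => y i a b ^ 2) (fun _ _ => sq_nonneg _)
            (Finset.mem_univ b)
      _ ≤ frob (y i) :=
          Finset.single_le_sum (f := fun a => ∑ b, y i a b ^ 2)
            (fun _ _ => Finset.sum_nonneg fun _ _ => sq_nonneg _) (Finset.mem_univ a)
      _ ≤ f y := Finset.single_le_sum (f := fun i => frob (y i)) (fun _ _ => frob_nonneg _)
            (Finset.mem_univ i)
  obtain ⟨y, ⟨⟨g, rfl⟩, hy⟩, hmin⟩ := hC.exists_isMinOn ⟨_, hmem 1, le_refl (f _)⟩ hf.continuousOn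
  refine ⟨g, fun h => ?_⟩
  by_cases hh : f (fun i => conjR h (x i)) ≤ f (fun i => conjR 1 (x i))
  · exact hmin ⟨hmem h, hh⟩
  · exact le_trans hy (not_le.1 hh).le

/-- The orthogonal projection onto a subspace of `ℝ⁴`. -/
theorem exists_orthogonal_projection (K : Submodule ℝ (Idx → ℝ)) :
    ∃ P : Matrix Idx Idx ℝ, P.transpose = P ∧ (∀ v, P.mulVec v ∈ K) ∧
      ∀ v ∈ K, P.mulVec v = v := by
  let D : LinearMap.BilinForm ℝ (Idx → ℝ) := Matrix.toBilin' 1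
  have hD : ∀ v w, D v w = v ⬝ᵥ w := fun v w => by
    rw [Matrix.toBilin'_apply', Matrix.one_mulVec]
  have hrefl : D.IsRefl := fun v w h => by rw [hD, dotProduct_comm, ← hD, h]
  have hc : IsCompl K (D.orthogonal K) := by
    rw [LinearMap.BilinForm.isCompl_orthogonal_iff_disjoint hrefl, Submodule.disjoint_def]
    intro v hv hv'
    have h1 : D v v = 0 := hv' v hv
    rw [hD] at h1
    exact dotProduct_self_eq_zero.1 h1
  let p := K.subtype ∘ₗ K.projectionOnto _ hc
  let P := LinearMap.toMatrix' p
  have hP : ∀ v, P.mulVec v = p v := fun v => LinearMap.toMatrix'_mulVec p v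
  have hmem : ∀ v, P.mulVec v ∈ K := fun v => by
    rw [hP]
    exact (K.projectionOnto _ hc v).2
  have hfix : ∀ v ∈ K, P.mulVec v = v := fun v hv => by
    rw [hP]
    exact congrArg Subtype.val (Submodule.projectionOnto_apply_left hc ⟨v, hv⟩)
  have horth : ∀ v, ∀ w ∈ K, w ⬝ᵥ (v - P.mulVec v) = 0 := by
    intro v w hw
    obtain ⟨a, ha, b, hb, rfl⟩ := Submodule.mem_sup.1
      (hc.sup_eq_top ▸ Submodule.mem_top : v ∈ K ⊔ D.orthogonal K)
    have hb0 : P.mulVec b = 0 := by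
      rw [hP]
      exact congrArg Subtype.val (Submodule.projectionOnto_apply_right hc ⟨b, hb⟩)
    rw [Matrix.mulVec_add, hfix a ha, hb0, add_zero, add_sub_cancel_left, ← hD]
    exact hb w hw
  refine ⟨P, ?_, hmem, hfix⟩
  have hsym : ∀ v w, v ⬝ᵥ P.mulVec w = P.mulVec v ⬝ᵥ w := by
    intro v w
    have h1 := horth v _ (hmem w)
    have h2 := horth w _ (hmem v)
    rw [dotProduct_sub] at h1 h2
    rw [dotProduct_comm v]
    have h3 := dotProduct_comm (P.mulVec v) (P.mulVec w)
    linarith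
  ext i j
  have := hsym (Pi.single i 1) (Pi.single j 1)
  simpa using this.symm

/-! ### Closed orbits give invariant splittings -/

theorem symplAdj_transpose (A : Matrix Idx Idx ℝ) :
    symplAdj A.transpose = (symplAdj A).transpose := by
  simp only [symplAdj, Matrix.transpose_mul, Matrix.transpose_neg, Matrix.J_transpose,
    Matrix.transpose_transpose, neg_neg, mul_neg, neg_mul, mul_assoc]

/-- At a tuple of minimal Frobenius norm, the orthogonal projection onto an invariant isotropic
subspace commutes with the tuple. -/
theorem exists_commuting_projection_of_minimal {k : ℕ} {b : Fin k → Sp4}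
    (hmin : ∀ h : Sp4, ∑ i, frob (b i : Matrix Idx Idx ℝ) ≤
      ∑ i, frob (conjR h (b i : Matrix Idx Idx ℝ)))
    {K : Submodule ℝ (Idx → ℝ)} (hiso : ∀ v ∈ K, ∀ w ∈ K, omega v w = 0)
    (hb : ∀ i, ∀ v ∈ K, (b i : Matrix Idx Idx ℝ).mulVec v ∈ K)
    (hb' : ∀ i, ∀ v ∈ K, (((b i)⁻¹ : Sp4) : Matrix Idx Idx ℝ).mulVec v ∈ K) :
    ∃ P : Matrix Idx Idx ℝ, (∀ v, P.mulVec v ∈ K) ∧ (∀ v ∈ K, P.mulVec v = v) ∧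
      P * symplAdj P = 0 ∧ ∀ i, Commute (b i : Matrix Idx Idx ℝ) P := by
  obtain ⟨P, hPt, hPmem, hPfix⟩ := exists_orthogonal_projection K
  have hPP : P * P = P := by
    rw [← sub_eq_zero]
    refine matrix_eq_zero_of_mulVec fun v => ?_
    rw [Matrix.sub_mulVec, ← Matrix.mulVec_mulVec, hPfix _ (hPmem v), sub_self]
  set Q := symplAdj P with hQ
  have hQadj : symplAdj Q = P := by rw [hQ, symplAdj_symplAdj]
  have hQQ : Q * Q = Q := by rw [hQ, ← symplAdj_mul, hPP]
  have hQt : Q.transpose = Q := by rw [hQ, ← symplAdj_transpose, hPt]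
  have hQP : Q * P = 0 := by
    refine matrix_eq_zero_of_mulVec fun w => eq_zero_of_omega_eq_zero fun v => ?_
    rw [← Matrix.mulVec_mulVec, hQ, ← omega_mulVec_left]
    exact hiso _ (hPmem v) _ (hPmem w)
  -- Both idempotents are symmetric, since the symplectic adjoint commutes with transposition; thus
  -- `P`, `R`, `Q` project onto mutually Euclidean-orthogonal subspaces.
  have hPQ : P * Q = 0 := by
    have := congrArg Matrix.transpose hQP
    rwa [Matrix.transpose_mul, hPt, hQt, Matrix.transpose_zero] at this
  obtain ⟨R, hsum⟩ : ∃ R, P + R + Q = 1 := ⟨1 - P - Q, by abel⟩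
  have hR : R = 1 - P - Q := by rw [← hsum]; abel
  have hRt : R.transpose = R := by
    rw [hR, Matrix.transpose_sub, Matrix.transpose_sub, Matrix.transpose_one, hPt, hQt]
  have hPR : P * R = 0 := by rw [hR, mul_sub, mul_sub, mul_one, hPP, hPQ, sub_self, sub_zero]
  have hRP : R * P = 0 := by rw [hR, sub_mul, sub_mul, one_mul, hPP, hQP, sub_self, sub_zero]
  have hQR : Q * R = 0 := by rw [hR, mul_sub, mul_sub, mul_one, hQQ, hQP, sub_zero, sub_self]
  have hRQ : R * Q = 0 := by rw [hR, sub_mul, sub_mul, one_mul, hQQ, hPQ, sub_zero, sub_self]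
  have hRR : R * R = R := by
    nth_rewrite 1 [hR]
    rw [sub_mul, sub_mul, one_mul, hPR, hQR, sub_zero, sub_zero]
  have hRadj : symplAdj R = R := by
    rw [hR, ← symplAdjLin_apply, map_sub, map_sub, symplAdjLin_apply, symplAdjLin_apply,
      symplAdjLin_apply, symplAdj_one, hQadj, ← hQ]
    abel
  -- The symplectic dilation by `1/2` on the range of `P`, `1` on that of `R` and `2` on that of
  -- `Q`. Its inverse is `mu`.
  let lam : Matrix Idx Idx ℝ := (1 / 2 : ℝ) • P + R + (2 : ℝ) • Q
  let mu : Matrix Idx Idx ℝ := (2 : ℝ) • P + R + (1 / 2 : ℝ) • Q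
  have hmu : symplAdj lam = mu := by
    simp only [lam, mu]
    rw [← symplAdjLin_apply, map_add, map_add, map_smul, map_smul, symplAdjLin_apply,
      symplAdjLin_apply, symplAdjLin_apply, hQadj, hRadj, ← hQ]
    abel
  have hlam : lam ∈ Matrix.symplecticGroup (Fin 2) ℝ := by
    rw [mem_symplecticGroup_iff_mul_symplAdj, hmu, ← hsum]
    simp only [lam, mu, add_mul, mul_add, smul_mul_assoc, mul_smul_comm, hPP, hPQ, hPR, hQP,
      hQQ, hQR, hRP, hRQ, hRR, smul_zero, add_zero, zero_add, smul_smul]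
    norm_num
  let l : Sp4 := ⟨lam, hlam⟩
  have hl : ∀ A, conjR l A = lam * A * mu := fun A => by
    rw [conjR_apply, coe_inv_eq_symplAdj, ← hmu]
  have hleft := frob_eq_add_mul_left hsum (by rw [hPt, hPP]) (by rw [hQt, hQQ]) (by rw [hRt, hRR])
  have hright := frob_eq_add_mul_right hsum hPt hQt hRt hPP hQQ hRR
  have hnine : ∀ A, frob A = frob (P * A * P) + frob (P * A * R) + frob (P * A * Q) +
      (frob (R * A * P) + frob (R * A * R) + frob (R * A * Q)) +
      (frob (Q * A * P) + frob (Q * A * R) + frob (Q * A * Q)) := by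
    intro A
    rw [hleft A, hright (P * A), hright (R * A), hright (Q * A)]
  have hPl : P * lam = (1 / 2 : ℝ) • P := by
    simp only [lam, mul_add, mul_smul_comm, hPP, hPR, hPQ, smul_zero, add_zero]
  have hRl : R * lam = R := by
    simp only [lam, mul_add, mul_smul_comm, hRP, hRR, hRQ, smul_zero, add_zero, zero_add]
  have hQl : Q * lam = (2 : ℝ) • Q := by
    simp only [lam, mul_add, mul_smul_comm, hQP, hQR, hQQ, smul_zero, add_zero, zero_add]
  have hPm : mu * P = (2 : ℝ) • P := by
    simp only [mu, add_mul, smul_mul_assoc, hPP, hRP, hQP, smul_zero, add_zero]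
  have hRm : mu * R = R := by
    simp only [mu, add_mul, smul_mul_assoc, hPR, hRR, hQR, smul_zero, add_zero, zero_add]
  have hQm : mu * Q = (1 / 2 : ℝ) • Q := by
    simp only [mu, add_mul, smul_mul_assoc, hPQ, hRQ, hQQ, smul_zero, add_zero, zero_add]
  have hBP : ∀ i, P * (b i : Matrix Idx Idx ℝ) * P = b i * P := by
    intro i
    rw [← sub_eq_zero]
    refine matrix_eq_zero_of_mulVec fun v => ?_
    rw [Matrix.sub_mulVec, ← Matrix.mulVec_mulVec, ← Matrix.mulVec_mulVec, ← Matrix.mulVec_mulVec,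
      hPfix _ (hb i _ (hPmem v)), sub_self]
  -- The adjoint of the stability of `K` under `(b i)⁻¹`. With `hBP` it makes `b i` block upper
  -- triangular for `P`, `R`, `Q`.
  have hQB : ∀ i, Q * (b i : Matrix Idx Idx ℝ) * Q = Q * b i := by
    intro i
    have h1 : P * (((b i)⁻¹ : Sp4) : Matrix Idx Idx ℝ) * P =
        (((b i)⁻¹ : Sp4) : Matrix Idx Idx ℝ) * P := by
      rw [← sub_eq_zero]
      refine matrix_eq_zero_of_mulVec fun v => ?_
      rw [Matrix.sub_mulVec, ← Matrix.mulVec_mulVec, ← Matrix.mulVec_mulVec,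
        ← Matrix.mulVec_mulVec, hPfix _ (hb' i _ (hPmem v)), sub_self]
    have h2 := congrArg symplAdj h1
    rw [symplAdj_mul, symplAdj_mul, symplAdj_mul, coe_inv_eq_symplAdj, symplAdj_symplAdj,
      ← mul_assoc] at h2
    exact h2
  have hRBP : ∀ i, R * (b i : Matrix Idx Idx ℝ) * P = 0 := fun i => by
    rw [mul_assoc, ← hBP, ← mul_assoc, ← mul_assoc, hRP, zero_mul, zero_mul]
  have hQBP : ∀ i, Q * (b i : Matrix Idx Idx ℝ) * P = 0 := fun i => by
    rw [mul_assoc, ← hBP, ← mul_assoc, ← mul_assoc, hQP, zero_mul, zero_mul]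
  have hQBR : ∀ i, Q * (b i : Matrix Idx Idx ℝ) * R = 0 := fun i => by
    rw [← hQB, mul_assoc _ Q R, hQR, mul_zero]
  -- Conjugation by `l` fixes the diagonal blocks and scales the `PR`, `PQ`, `RQ` blocks by `1/2`,
  -- `1/4`, `1/2`; squaring gives losses `3/4`, `15/16`, `3/4`. Minimality forces these blocks to
  -- vanish.
  have hnorm : ∀ i, frob (b i : Matrix Idx Idx ℝ) - frob (conjR l (b i : Matrix Idx Idx ℝ)) =
      3 / 4 * frob (P * (b i : Matrix Idx Idx ℝ) * R) +
      15 / 16 * frob (P * (b i : Matrix Idx Idx ℝ) * Q) +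
      3 / 4 * frob (R * (b i : Matrix Idx Idx ℝ) * Q) := by
    intro i
    have hblock : ∀ X Y : Matrix Idx Idx ℝ, X * conjR l (b i : Matrix Idx Idx ℝ) * Y =
        (X * lam) * b i * (mu * Y) := fun X Y => by
      rw [hl]
      simp only [mul_assoc]
    rw [hnine (b i), hnine (conjR l _)]
    simp only [hblock, hPl, hRl, hQl, hPm, hRm, hQm, smul_mul_assoc, mul_smul_comm, smul_smul,
      frob_smul, hRBP, hQBP, hQBR, frob_zero]
    ring
  have hle : ∑ i, (3 / 4 * frob (P * (b i : Matrix Idx Idx ℝ) * R) +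
      15 / 16 * frob (P * (b i : Matrix Idx Idx ℝ) * Q) +
      3 / 4 * frob (R * (b i : Matrix Idx Idx ℝ) * Q)) ≤ 0 := by
    rw [← Finset.sum_congr rfl fun i _ => hnorm i, Finset.sum_sub_distrib]
    linarith [hmin l]
  refine ⟨P, hPmem, hPfix, hPQ, fun i => ?_⟩
  have hnn : ∀ i ∈ Finset.univ, 0 ≤ 3 / 4 * frob (P * (b i : Matrix Idx Idx ℝ) * R) +
      15 / 16 * frob (P * (b i : Matrix Idx Idx ℝ) * Q) +
      3 / 4 * frob (R * (b i : Matrix Idx Idx ℝ) * Q) := fun i _ => by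
    linarith [frob_nonneg (P * (b i : Matrix Idx Idx ℝ) * R),
      frob_nonneg (P * (b i : Matrix Idx Idx ℝ) * Q),
      frob_nonneg (R * (b i : Matrix Idx Idx ℝ) * Q)]
  have hi := (Finset.sum_eq_zero_iff_of_nonneg hnn).1
    (le_antisymm hle (Finset.sum_nonneg hnn)) i (Finset.mem_univ i)
  have n1 := frob_nonneg (P * (b i : Matrix Idx Idx ℝ) * R)
  have n2 := frob_nonneg (P * (b i : Matrix Idx Idx ℝ) * Q)
  have n3 := frob_nonneg (R * (b i : Matrix Idx Idx ℝ) * Q)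
  have h1 : P * (b i : Matrix Idx Idx ℝ) * R = 0 := frob_eq_zero (by linarith)
  have h2 : P * (b i : Matrix Idx Idx ℝ) * Q = 0 := frob_eq_zero (by linarith)
  rw [Commute, SemiconjBy, ← hBP]
  calc P * (b i : Matrix Idx Idx ℝ) * P
      = P * (b i : Matrix Idx Idx ℝ) * P + P * (b i : Matrix Idx Idx ℝ) * R +
          P * (b i : Matrix Idx Idx ℝ) * Q := by rw [h1, h2, add_zero, add_zero]
    _ = P * b i := by rw [← mul_add, ← mul_add, hsum, mul_one]

/-- Move to a minimal point of the orbit by `g`, find the commuting projection for the translate `K'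
= g K` of `V^⊥`, and conjugate it back. Commutation extends from the generators to the whole group.
-/
theorem hasInvariantSplitting_of_isClosed {π : Type*} [Group π] {k : ℕ} {γ : Fin k → π}
    (hγ : Subgroup.closure (Set.range γ) = ⊤) {ρ : π →* Sp4}
    (hcl : IsClosed (conjOrbit (evalGenerators γ ρ))) {V : Submodule ℝ (Idx → ℝ)}
    (hV : IsCoisotropic V) (hinv : IsInvariant ρ V) : HasInvariantSplitting ρ V := by
  obtain ⟨g, hg⟩ := exists_minimal_conj hcl
  have hconj : ∀ x : Sp4, conjR g (x : Matrix Idx Idx ℝ) = (g * x * g⁻¹ : Sp4) := fun _ => rfl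
  have hK := isInvariant_orthogonal hinv
  set K := omega.orthogonal V
  have hiso : ∀ v ∈ K, ∀ w ∈ K, omega v w = 0 := fun v hv w hw => hw v (hV hv)
  have hgg : ∀ (g : Sp4) (v : Idx → ℝ),
      (g : Matrix Idx Idx ℝ).mulVec (((g⁻¹ : Sp4) : Matrix Idx Idx ℝ).mulVec v) = v := by
    intro g v
    rw [Matrix.mulVec_mulVec, ← Submonoid.coe_mul, mul_inv_cancel, Submonoid.coe_one,
      Matrix.one_mulVec]
  have hgg' : ∀ (g : Sp4) (v : Idx → ℝ),
      ((g⁻¹ : Sp4) : Matrix Idx Idx ℝ).mulVec ((g : Matrix Idx Idx ℝ).mulVec v) = v := by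
    intro g v
    simpa using hgg g⁻¹ v
  let K' : Submodule ℝ (Idx → ℝ) := K.comap ((g⁻¹ : Sp4) : Matrix Idx Idx ℝ).mulVecLin
  have hK' : ∀ v, v ∈ K' ↔ ((g⁻¹ : Sp4) : Matrix Idx Idx ℝ).mulVec v ∈ K := fun _ => Iff.rfl
  have hstab : ∀ x : π, ∀ v ∈ K', ((g * ρ x * g⁻¹ : Sp4) : Matrix Idx Idx ℝ).mulVec v ∈ K' := by
    intro x v hv
    rw [hK', Submonoid.coe_mul, Submonoid.coe_mul, ← Matrix.mulVec_mulVec,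
      ← Matrix.mulVec_mulVec, hgg']
    exact hK x _ hv
  obtain ⟨P, hPmem, hPfix, hPQ, hcomm⟩ := exists_commuting_projection_of_minimal
    (b := fun i => g * ρ (γ i) * g⁻¹) (K := K') (by
      intro h
      have := hg (h * g)
      simp only [conjR_mul] at this
      exact this) (by
      intro v hv w hw
      rw [← hgg g v, omega_mulVec_left, ← coe_inv_eq_symplAdj]
      exact hiso _ hv _ hw) (fun i => hstab (γ i)) (by
      intro i
      have := hstab (γ i)⁻¹
      rwa [map_inv, ← conj_inv] at this)
  refine hasInvariantSplitting_of_projection hV (P := conjR g⁻¹ P) ?_ ?_ ?_ ?_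
  · intro v
    rw [conjR_apply, inv_inv, ← Matrix.mulVec_mulVec, ← Matrix.mulVec_mulVec]
    exact hPmem _
  · intro v hv
    rw [conjR_apply, inv_inv, ← Matrix.mulVec_mulVec, ← Matrix.mulVec_mulVec, hPfix, hgg']
    rwa [hK', hgg']
  · rw [← conjR_symplAdj, ← map_mul, hPQ, map_zero]
  · intro x
    have hx : x ∈ Subgroup.closure (Set.range γ) := hγ ▸ Subgroup.mem_top x
    induction hx using Subgroup.closure_induction with
    | mem x hx =>
      obtain ⟨i, rfl⟩ := hx
      have h1 := (hcomm i).map (conjR g⁻¹)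
      have h2 : conjR g⁻¹ ((g * ρ (γ i) * g⁻¹ : Sp4) : Matrix Idx Idx ℝ) = ρ (γ i) := by
        rw [← hconj, ← conjR_mul, inv_mul_cancel]
        simp [conjR_apply]
      rwa [h2] at h1
    | one => rw [map_one, Submonoid.coe_one]; exact Commute.one_left _
    | mul x y _ _ hx hy => rw [map_mul, Submonoid.coe_mul]; exact hx.mul_left hy
    | inv x _ hx =>
      have h1 : ((ρ x⁻¹ : Sp4) : Matrix Idx Idx ℝ) * (ρ x : Matrix Idx Idx ℝ) = 1 := by
        rw [← Submonoid.coe_mul, ← map_mul, inv_mul_cancel, map_one, Submonoid.coe_one]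
      have h2 : (ρ x : Matrix Idx Idx ℝ) * ((ρ x⁻¹ : Sp4) : Matrix Idx Idx ℝ) = 1 :=
        mul_eq_one_comm.1 h1
      set B := conjR g⁻¹ P
      calc ((ρ x⁻¹ : Sp4) : Matrix Idx Idx ℝ) * B
          = (ρ x⁻¹ : Sp4) * (B * ρ x) * (ρ x⁻¹ : Sp4) := by
            rw [mul_assoc _ (B * _), mul_assoc B, h2, mul_one]
        _ = B * (ρ x⁻¹ : Sp4) := by rw [← hx.eq, ← mul_assoc, h1, one_mul]

end SpFour

namespace SpFour

/-! ### Invariant splittings imply reductivity -/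

/-- A unipotent group fixes a nonzero vector in every nonzero stable subspace. -/
theorem exists_fixed_of_isUnipotent {N : Subgroup Sp4} (hN : IsUnipotent N)
    {W : Submodule ℝ (Idx → ℝ)} (hW : W ≠ ⊥)
    (hNW : ∀ n ∈ N, ∀ w ∈ W, (n : Matrix Idx Idx ℝ).mulVec w ∈ W) :
    ∃ w ∈ W, w ≠ 0 ∧ ∀ n ∈ N, (n : Matrix Idx Idx ℝ).mulVec w = w := by
  let s : Set (Matrix Idx Idx ℝ) := (fun n : Sp4 => (n : Matrix Idx Idx ℝ) - 1) '' (N : Set Sp4)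
  let S : Submodule ℝ (Matrix Idx Idx ℝ) := Submodule.span ℝ s
  -- Since `(n - 1)(m - 1) = (nm - 1) - (n - 1) - (m - 1)`, the span is an algebra without unit on
  -- which the trace vanishes, so all its elements are nilpotent.
  have hmul : ∀ A ∈ S, ∀ B ∈ S, A * B ∈ S := by
    intro A hA B hB
    have h := Submodule.mul_mem_mul hA hB
    rw [Submodule.span_mul_span] at h
    refine Submodule.span_le.2 ?_ h
    rintro _ ⟨_, ⟨n, hn, rfl⟩, _, ⟨m, hm, rfl⟩, rfl⟩
    have h1 : ((n : Matrix Idx Idx ℝ) - 1) * ((m : Matrix Idx Idx ℝ) - 1) =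
        (((n * m : Sp4) : Matrix Idx Idx ℝ) - 1) - ((n : Matrix Idx Idx ℝ) - 1) -
          ((m : Matrix Idx Idx ℝ) - 1) := by
      rw [Submonoid.coe_mul]
      noncomm_ring
    change _ * _ ∈ S
    rw [h1]
    exact sub_mem (sub_mem (Submodule.subset_span ⟨n * m, N.mul_mem hn hm, rfl⟩)
      (Submodule.subset_span ⟨n, hn, rfl⟩)) (Submodule.subset_span ⟨m, hm, rfl⟩)
  have htr : ∀ A ∈ S, A.trace = 0 := by
    intro A hA
    induction hA using Submodule.span_induction with
    | mem x hx => obtain ⟨n, hn, rfl⟩ := hx; exact trace_eq_zero_of_isNilpotent (hN n hn)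
    | zero => exact Matrix.trace_zero _ _
    | add x y _ _ hx hy => rw [Matrix.trace_add, hx, hy, add_zero]
    | smul c x _ hx => rw [Matrix.trace_smul, hx, smul_zero]
  have hpow : ∀ A ∈ S, ∀ k : ℕ, A ^ (k + 1) ∈ S := by
    intro A hA k
    induction k with
    | zero => simpa using hA
    | succ k ih => rw [pow_succ]; exact hmul _ ih _ hA
  have hSW : ∀ A ∈ S, ∀ w ∈ W, A.mulVec w ∈ W := by
    intro A hA w hw
    induction hA using Submodule.span_induction with
    | mem x hx =>
      obtain ⟨n, hn, rfl⟩ := hx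
      dsimp only
      rw [Matrix.sub_mulVec, Matrix.one_mulVec]
      exact sub_mem (hNW n hn w hw) hw
    | zero => rw [Matrix.zero_mulVec]; exact zero_mem W
    | add x y _ _ hx hy => rw [Matrix.add_mulVec]; exact add_mem hx hy
    | smul c x _ hx => rw [Matrix.smul_mulVec]; exact W.smul_mem c hx
  obtain ⟨w, hw, hw0, h⟩ := exists_mem_forall_mulVec_eq_zero S
    (fun A hA B hB => sub_mem (hmul A hA B hB) (hmul B hB A hA))
    (fun A hA => isNilpotent_matrix_of_trace_pow_eq_zero A fun k => htr _ (hpow A hA k)) W hW hSW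
  refine ⟨w, hw, hw0, fun n hn => ?_⟩
  have := h _ (Submodule.subset_span ⟨n, hn, rfl⟩)
  rwa [Matrix.sub_mulVec, Matrix.one_mulVec, sub_eq_zero] at this

/-- The vectors fixed by a subgroup of the symplectic group. -/
def fixedSpace (N : Subgroup Sp4) : Submodule ℝ (Idx → ℝ) where
  carrier := {v | ∀ n ∈ N, (n : Matrix Idx Idx ℝ).mulVec v = v}
  add_mem' hv hw n hn := by rw [Matrix.mulVec_add, hv n hn, hw n hn]
  zero_mem' n _ := Matrix.mulVec_zero _
  smul_mem' c v hv n hn := by rw [Matrix.mulVec_smul, hv n hn]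

theorem omega_mulVec_of_mem_fixedSpace {N : Subgroup Sp4} {n : Sp4} (hn : n ∈ N) {v : Idx → ℝ}
    (hv : v ∈ fixedSpace N) (w : Idx → ℝ) :
    omega v ((n : Matrix Idx Idx ℝ).mulVec w) = omega v w := by
  rw [omega_mulVec_right, ← coe_inv_eq_symplAdj, hv _ (N.inv_mem hn)]

/-- The fixed space `F` of a normal subgroup is invariant, and `K = F ⊓ F^⊥` is isotropic, so `K^⊥`
has an invariant complement `L`. As `N` fixes `K`, it acts trivially on the quotient by `K^⊥`,
whence `L ≤ F`. So `K` is orthogonal to `L` and to `K^⊥`, and `K = 0`. A nonzero `F^⊥` would contain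
a nonzero vector fixed by the unipotent group `N`, that is, an element of `K`. -/
theorem isReductiveRep_of_hasInvariantSplitting {π : Type*} [Group π] {ρ : π →* Sp4}
    (h : ∀ V : Submodule ℝ (Idx → ℝ), IsCoisotropic V → IsInvariant ρ V →
      HasInvariantSplitting ρ V) : IsReductiveRep ρ := by
  intro N hNH hnormal _ _ hN
  set F := fixedSpace N with hF
  have hFinv : IsInvariant ρ F := by
    intro x v hv n hn
    have hx : ρ x ∈ zariskiClosureSubgroup ρ.range := subset_zariskiClosure _ ⟨x, rfl⟩
    have h1 : (ρ x)⁻¹ * n * ρ x ∈ N := by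
      have := hnormal.conj_mem ⟨n, hNH hn⟩ hn (⟨ρ x, hx⟩⁻¹)
      rw [Subgroup.mem_subgroupOf] at this
      simpa using this
    have h2 := hv _ h1
    have h3 : (n : Matrix Idx Idx ℝ) * (ρ x : Matrix Idx Idx ℝ) =
        (ρ x : Matrix Idx Idx ℝ) * (((ρ x)⁻¹ * n * ρ x : Sp4) : Matrix Idx Idx ℝ) :=
      congrArg Subtype.val (show n * ρ x = ρ x * ((ρ x)⁻¹ * n * ρ x) by group)
    rw [Matrix.mulVec_mulVec, h3, ← Matrix.mulVec_mulVec, h2]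
  set K := F ⊓ omega.orthogonal F with hK
  have hKinv : IsInvariant ρ K := fun x v hv =>
    ⟨hFinv x v hv.1, isInvariant_orthogonal hFinv x v hv.2⟩
  have hKV : K ≤ omega.orthogonal K := fun k hk k' hk' => hk.2 k' hk'.1
  obtain ⟨W, L, -, -, hVL, -, -, -, -, hLinv, -⟩ := h (omega.orthogonal K)
    (by rw [IsCoisotropic, orthogonal_orthogonal_omega]; exact hKV) (isInvariant_orthogonal hKinv)
  have hLF : L ≤ F := by
    intro l hl n hn
    have h1 : (n : Matrix Idx Idx ℝ).mulVec l ∈ L :=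
      mulVec_mem_of_mem_zariskiClosure (S := (ρ.range : Set Sp4)) (by
        rintro _ ⟨x, rfl⟩ v hv
        exact hLinv x v hv) (hNH hn) hl
    have h2 : (n : Matrix Idx Idx ℝ).mulVec l - l ∈ omega.orthogonal K := by
      intro k hk
      rw [map_sub, omega_mulVec_of_mem_fixedSpace hn hk.1, sub_self]
    exact sub_eq_zero.1 (Submodule.disjoint_def.1 hVL.disjoint _ h2 (sub_mem h1 hl))
  have hK0 : K = ⊥ := by
    rw [eq_bot_iff]
    intro k hk
    refine (Submodule.mem_bot ℝ).2 (eq_zero_of_omega_eq_zero fun v => ?_)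
    obtain ⟨a, ha, l, hl, rfl⟩ := Submodule.mem_sup.1
      (hVL.sup_eq_top ▸ Submodule.mem_top : v ∈ omega.orthogonal K ⊔ L)
    rw [map_add, LinearMap.add_apply, hk.2 l (hLF hl), add_zero, omega_neg_swap, ha k hk, neg_zero]
  have hFperp : omega.orthogonal F = ⊥ := by
    by_contra hne
    obtain ⟨w, hw, hw0, hfix⟩ := exists_fixed_of_isUnipotent hN hne (by
      intro n hn w hw v hv
      exact (omega_mulVec_of_mem_fixedSpace hn hv w).trans (hw v hv))
    have : w ∈ K := ⟨hfix, hw⟩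
    rw [hK0, Submodule.mem_bot] at this
    exact hw0 this
  have hFtop : ∀ v, v ∈ F := by
    intro v
    rw [← orthogonal_orthogonal_omega F, hFperp]
    intro w hw
    rw [(Submodule.mem_bot ℝ).1 hw, map_zero, LinearMap.zero_apply]
  rw [eq_bot_iff]
  intro n hn
  rw [Subgroup.mem_bot]
  refine Subtype.ext ?_
  rw [Submonoid.coe_one, ← sub_eq_zero]
  refine matrix_eq_zero_of_mulVec fun v => ?_
  rw [Matrix.sub_mulVec, Matrix.one_mulVec, hFtop v n hn, sub_self]

end SpFour

theorem proposition2p3 {π : Type*} [Group π] {k : ℕ} (γ : Fin k → π)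
    (hγ : Subgroup.closure (Set.range γ) = ⊤) (ρ : π →* SpFour.Sp4) :
    List.TFAE [
      SpFour.IsReductiveRep ρ,
      IsClosed (SpFour.conjOrbit (SpFour.evalGenerators γ ρ)),
      ∀ V : Submodule ℝ (SpFour.Idx → ℝ), SpFour.IsCoisotropic V → SpFour.IsInvariant ρ V →
        SpFour.HasInvariantSplitting ρ V] := by
  tfae_have 1 → 2 := fun h =>
    SpFour.isClosed_conjOrbit hγ fun _ hK => SpFour.exists_isCompl_of_isReductiveRep h hK
  tfae_have 2 → 3 := fun h _ hV hinv => SpFour.hasInvariantSplitting_of_isClosed hγ h hV hinv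
  tfae_have 3 → 1 := SpFour.isReductiveRep_of_hasInvariantSplitting
  tfae_finish
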